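/- **Consistent estimation of $\alpha_{\rm opt}$.** *Model.* Let $\mu$ be a probability measure with compact support in $(0,1)$ and let $K$ be fixed. For each $n$, let $q_1,\dots,q_n$ be i.i.d. with law $\mu$, let $g_i\in\{1,\dots,K\}$ be the class of node $i$, with $\frac1n|\{i: g_i=k\}|\to c_k>0$ for each $k$, and let $M_{ab}=\mathcal O(1)$, $1\le a,b\le K$. Conditionally on the $q_i$'s, let the edges of a simple undirected graph on $n$ nodes be independent (for all large $n$), the edge $\{i,j\}$ being present with probability $q_iq_j\bigl(1+M_{g_ig_j}/\sqrt n\bigr)$. All graphs live on one probability space (with arbitrary joint law across different $n$). Let ${\bf d}$ be the vector of degrees, $\hat q_i=d_i/\sqrt{{\bf d}^{\sf T}{\bf 1}_n}$ and $\hat\mu=\frac1n\sum_{i=1}^n\delta_{\hat q_i}$. Let $\mathcal A\subset\mathbb R$ be compact and nonempty. *Threshold.* For a probability measure $\nu$ and $\alpha\in\mathbb R$, put, for $z\in\mathbb C^+=\{\Im z>0\}$ and $(E_1,E_2)\in\mathbb C^2$, $$e_{ab}^\alpha(z)=\int\frac{q^{a-2b\alpha}}{-z-E_1q^{1-2\alpha}+E_2q^{2-2\alpha}}\,\nu(dq).$$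 Let $(E_1^\alpha(z),E_2^\alpha(z))$ be the unique pair in $(\mathbb C^+)^2$ such that $E_1=e_{11}^\alpha(z)$, $E_2=e_{21}^\alpha(z)$ and $\Im\bigl(E_1q^{1-2\alpha}-E_2q^{2-2\alpha}\bigr)>0$ for $\nu$-almost every $q$. Let $\bar\pi^\alpha$ be the compactly supported probability measure with Stieltjes transform $\int(t-z)^{-1}\bar\pi^\alpha(dt)=e_{00}^\alpha(z)$, $z\in\mathbb C^+$ (with $(E_1,E_2)=(E_1^\alpha(z),E_2^\alpha(z))$), let $S^\alpha$ be the supremum of its support, let $E_2^\alpha(x)=\lim_{y\downarrow0}E_2^\alpha(x+iy)$ for real $x>S^\alpha$, and let $$\tau^\alpha=-\frac1{\lim_{x\downarrow S^\alpha}E_2^\alpha(x)}.$$ Write $\tau^\alpha$ for the threshold obtained with $\nu=\mu$ and $\hat\tau^\alpha$ for the one obtained with $\nu=\hat\mu$. *Claim.* For every $\alpha\in\mathcal A$, $\tau^\alpha$ is well defined (the pair $(E_1^\alpha(z),E_2^\alpha(z))$ exists and is unique for every $z\in\mathbb C^+$, $\bar\pi^\alpha$ exists, $E_2^\alpha(x)$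 exists and is real for every $x>S^\alpha$, and $\lim_{x\downarrow S^\alpha}E_2^\alpha(x)$ exists in $(-\infty,0)$), and $\tau^\alpha$ attains its minimum over $\mathcal A$. Almost surely, for all large $n$, the same holds for $\hat\tau^\alpha$; and almost surely, for every choice of $\hat\alpha_{\rm opt}=\hat\alpha_{\rm opt}(n)\in\arg\min_{\alpha\in\mathcal A}\hat\tau^\alpha$, $$\operatorname{dist}\Bigl(\hat\alpha_{\rm opt},\ \arg\min_{\alpha\in\mathcal A}\tau^\alpha\Bigr)\to0\qquad(n\to\infty).$$ In particular, if the minimizer $\alpha_{\rm opt}$ of $\tau^\alpha$ over $\mathcal A$ is unique, then $\hat\alpha_{\rm opt}\to\alpha_{\rm opt}$ almost surely. -/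

import Mathlib

open MeasureTheory ProbabilityTheory Filter Topology Set

/-! Random graph model -/

/-- Edge probability `q_i q_j (1 + M_{g_i g_j} / √n)` of the degree-corrected stochastic block
model on `n` nodes with weights `q`, classes `g` and class affinities `1 + M_{ab} / √n`. -/
noncomputable def edgeProb {n K : ℕ} (M : Matrix (Fin K) (Fin K) ℝ) (g : Fin n → Fin K)
    (q : Fin n → ℝ) (i j : Fin n) : ℝ :=
  q i * q j * (1 + M (g i) (g j) / Real.sqrt n)

open scoped Classical in
/-- Probability that the graph equals `H` when the edges `{i, j}` are independent Bernoulli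
variables with parameters `p i j`, `i < j`. -/
noncomputable def graphProb {n : ℕ} (p : Fin n → Fin n → ℝ) (H : SimpleGraph (Fin n)) : ℝ :=
  ∏ i : Fin n, ∏ j ∈ Finset.Ioi i, if H.Adj i j then p i j else 1 - p i j

/-- `G` is a degree-corrected stochastic block model graph on `n` nodes: the weights `q_i` are
i.i.d. with law `μ` and, conditionally on the weights, the edges are independent, `{i, j}` being
present with probability `edgeProb M g q i j`. -/
structure IsDCSBM {Ω : Type*} [MeasurableSpace Ω] (P : Measure Ω) (μ : Measure ℝ) {n K : ℕ}
    (M : Matrix (Fin K) (Fin K) ℝ) (g : Fin n → Fin K) (q : Ω → Fin n → ℝ)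
    (G : Ω → SimpleGraph (Fin n)) : Prop where
  measurable_weight : Measurable q
  law_weight : ∀ i, P.map (fun ω => q ω i) = μ
  indep_weight : iIndepFun (fun i ω => q ω i) P
  measurableSet_graph : ∀ H, MeasurableSet {ω | G ω = H}
  condLaw_graph : ∀ H,
    P[{ω | G ω = H}.indicator (fun _ => (1 : ℝ)) | MeasurableSpace.comap q inferInstance]
      =ᵐ[P] fun ω => graphProb (edgeProb M g (q ω)) H

/-! Estimated weights -/

open scoped Classical in
/-- `d_i / √(dᵀ 1)` where `d` is the vector of degrees. -/
noncomputable def qHat {n : ℕ} (G : SimpleGraph (Fin n)) (i : Fin n) : ℝ :=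
  (G.degree i : ℝ) / Real.sqrt (∑ j, (G.degree j : ℝ))

/-- The empirical measure `(1 / n) ∑ i, δ_{q̂ i}`. -/
noncomputable def muHat {n : ℕ} (G : SimpleGraph (Fin n)) : Measure ℝ :=
  (n : ENNReal)⁻¹ • ∑ i, Measure.dirac (qHat G i)

/-! Limiting spectrum and detectability threshold attached to a weight distribution `μ` -/

/-- `e_{ab}^α(z) = ∫ q^{a-2bα} / (-z - E₁ q^{1-2α} + E₂ q^{2-2α}) μ(dq)`, as a function of `z`
and of the pair `E = (E₁, E₂)`. -/
noncomputable def eInt (μ : Measure ℝ) (α : ℝ) (a b : ℤ) (z : ℂ) (E : ℂ × ℂ) : ℂ :=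
  ∫ q : ℝ, ((q ^ ((a : ℝ) - 2 * b * α) : ℝ) : ℂ) /
    (-z - E.1 * ((q ^ (1 - 2 * α) : ℝ) : ℂ) + E.2 * ((q ^ (2 - 2 * α) : ℝ) : ℂ)) ∂μ

/-- `(E₁, E₂) ∈ (ℂ⁺)²` solves `E₁ = e₁₁(z)`, `E₂ = e₂₁(z)`, and the self-energy
`E₁ q^{1-2α} - E₂ q^{2-2α}` of a node of weight `q` is in `ℂ⁺` for `μ`-almost all `q`. -/
structure IsFixedPoint (μ : Measure ℝ) (α : ℝ) (z : ℂ) (E : ℂ × ℂ) : Prop where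
  im_fst : 0 < E.1.im
  im_snd : 0 < E.2.im
  im_self : ∀ᵐ q ∂μ,
    0 < (E.1 * ((q ^ (1 - 2 * α) : ℝ) : ℂ) - E.2 * ((q ^ (2 - 2 * α) : ℝ) : ℂ)).im
  eq_fst : E.1 = eInt μ α 1 1 z E
  eq_snd : E.2 = eInt μ α 2 1 z E

/-- The solution `(E₁^α(z), E₂^α(z))` for `z ∈ ℂ⁺`. -/
noncomputable def fixedPoint (μ : Measure ℝ) (α : ℝ) (z : ℂ) : ℂ × ℂ :=
  Classical.epsilon (IsFixedPoint μ α z)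

/-- `π` is a compactly supported probability measure with Stieltjes transform
`E₀^α(z) = e₀₀^α(z)`. -/
structure IsLimitSpectrum (μ : Measure ℝ) (α : ℝ) (π : Measure ℝ) : Prop where
  prob : IsProbabilityMeasure π
  compact : IsCompact π.support
  stieltjes : ∀ z : ℂ, 0 < z.im →
    ∫ t : ℝ, ((t : ℂ) - z)⁻¹ ∂π = eInt μ α 0 0 z (fixedPoint μ α z)

/-- The limiting spectral measure, determined by its Stieltjes transform. -/
noncomputable def limitSpectrum (μ : Measure ℝ) (α : ℝ) : Measure ℝ :=
  Classical.epsilon (IsLimitSpectrum μ α)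

/-- The right edge `S^α` of the support of the limiting spectral measure. -/
noncomputable def rightEdge (μ : Measure ℝ) (α : ℝ) : ℝ :=
  sSup (limitSpectrum μ α).support

/-- The (real) value `E₂^α(x)` at a real `x` outside the support of the limiting spectral
measure, where `E₂^α` extends analytically from `ℂ⁺`. -/
noncomputable def E2Real (μ : Measure ℝ) (α x : ℝ) : ℝ :=
  limUnder (𝓝[>] (0 : ℝ)) fun y : ℝ => (fixedPoint μ α (x + y * Complex.I)).2.re

/-- `lim_{x ↓ S^α} E₂^α(x)`. -/
noncomputable def E2Edge (μ : Measure ℝ) (α : ℝ) : ℝ :=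
  limUnder (𝓝[>] rightEdge μ α) (E2Real μ α)

/-- The detectability threshold `τ^α = -1 / lim_{x ↓ S^α} E₂^α(x)`. -/
noncomputable def threshold (μ : Measure ℝ) (α : ℝ) : ℝ := -1 / E2Edge μ α

/-- All objects entering the definition of `threshold μ α` exist: the fixed point is unique, the
limiting spectral measure exists, and the two limits are genuine. -/
structure ThresholdWellDefined (μ : Measure ℝ) (α : ℝ) : Prop where
  existsUnique_fixedPoint : ∀ z : ℂ, 0 < z.im → ∃! E, IsFixedPoint μ α z E
  isLimitSpectrum : IsLimitSpectrum μ α (limitSpectrum μ α)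
  tendsto_E2Real : ∀ x, rightEdge μ α < x →
    Tendsto (fun y : ℝ => (fixedPoint μ α (x + y * Complex.I)).2) (𝓝[>] 0)
      (𝓝 (E2Real μ α x : ℂ))
  tendsto_E2Edge : Tendsto (E2Real μ α) (𝓝[>] rightEdge μ α) (𝓝 (E2Edge μ α))
  E2Edge_neg : E2Edge μ α < 0

/-- The set of minimizers of `f` over `A`. -/
def argminOn (A : Set ℝ) (f : ℝ → ℝ) : Set ℝ := {a | a ∈ A ∧ IsMinOn f A a}

/-!
For each `α`, the pair `(E₁, E₂)` encodes the functions `g_q(z) = 1 / (-z - E₁ q^{1-2α} + E₂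
q^{2-2α})` of the quadratic vector equation `-1 / g_q = z + ∫ s(q, p) g_p ν(dp)`, whose kernel
`s(q, p) = (qp)^{1-2α} (1 - qp)` is bounded above and below by positive constants when `ν` is
carried by `[a, b] ⊂ (0, 1)`. All statements about thresholds are proved for such `ν`, which
covers both the weight distribution and, eventually, the empirical measures.

*Existence.* The iteration for `(E₁, E₂)` is a strict contraction for the hyperbolic distance of
the upper half plane (`hypClose_step`), which gives the unique fixed point. Cauchy transforms of
measures of mass at most one form a class that is closed under limits, under mixtures and, by the
resolvent formula for arrow-shaped Hermitian matrices, under the step `F ↦ -1 / (z + c F)`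
(`inCauchyHull_schur`); hence the `g_q` and their average `e₀₀` are Cauchy transforms.

*The edge.* A positive integrable `h` with `1 / h + ∫ s(·, p) h(p) ν(dp) ≤ x` almost everywhere, a
supersolution at level `x`, dominates the iteration at `|z| > x` and bounds the imaginary parts by
a multiple of `Im z`. So the spectrum lies in `[-x, x]` (`IsSupersolution.rightEdge_le`); a
constant supersolution gives compact support. Conversely, to the right of the edge `(E₁, E₂)` has
real boundary values, `-g_q` has positive ones, and these are a supersolution (`real_solution`).
`E₂` is monotone there and bounded, so its limit at the edge exists.

*Continuity.* The boundary values at the edge solve a relaxed form of the equation that is stable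
under weak convergence (`RelaxedSolution`). A relaxed solution is a supersolution, and by strict
convexity of the inverse there is only one supersolution at the level of the edge
(`IsSupersolution.ae_eq`): the mean of two would improve to one at a lower level. Hence every
limit point of edge values of `ν_n` at `α_n` is the edge value of `ν` at `α`, as soon as `ν_n → ν`
weakly with supports entering every neighbourhood of the support of `ν`, and `α_n → α`
(`SupportedConv.tendsto_E2Edge`). Compactness of `A` turns this joint continuity of the threshold
into convergence of minimizers.

*Concentration.* Given the weights, a degree is a sum of independent indicators; Chernoff's bound,
a union bound and the Borel–Cantelli lemma give `d_i / n → q_i ∫ q dμ` uniformly in `i`, almost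
surely, hence `max_i |q̂_i - q_i| → 0`. With Hoeffding's inequality for the moments of the weights
and polynomial approximation, the empirical measures of the `q̂_i` converge to `μ` in the above
sense (`ae_supportedConv_muHat`).
-/

/-! ### Cauchy transforms as a closed convex set -/

/-- The Cauchy kernel `1 / (t - z)` in the compactified parameter `s = t / (1 + |t|) ∈ [-1, 1]`;
the endpoints `s = ±1` stand for `t = ±∞`, where the kernel is `0`. -/
noncomputable def cauchyKernel (z : ℂ) (s : ℝ) : ℂ :=
  ((1 - |s| : ℝ) : ℂ) / ((s : ℂ) - z * ((1 - |s| : ℝ) : ℂ))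

lemma cauchyKernel_den_ne_zero {z : ℂ} (hz : 0 < z.im) (s : ℝ) :
    (s : ℂ) - z * ((1 - |s| : ℝ) : ℂ) ≠ 0 := by
  intro h
  have h1 := congrArg Complex.im h
  have h2 := congrArg Complex.re h
  simp only [Complex.sub_im, Complex.ofReal_im, Complex.im_mul_ofReal, Complex.zero_im,
    Complex.sub_re, Complex.ofReal_re, Complex.re_mul_ofReal, Complex.zero_re] at h1 h2
  have h3 : 1 - |s| = 0 := by
    rcases mul_eq_zero.1 (by linarith : z.im * (1 - |s|) = 0) with h | h
    · exact absurd h hz.ne'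
    · exact h
  rw [h3] at h2
  have : s = 0 := by linarith
  rw [this] at h3
  norm_num at h3

lemma continuous_cauchyKernel {z : ℂ} (hz : 0 < z.im) : Continuous (cauchyKernel z) := by
  unfold cauchyKernel
  exact Continuous.div (by fun_prop) (by fun_prop) (cauchyKernel_den_ne_zero hz)

lemma cauchyKernel_im_nonneg {z : ℂ} (hz : 0 < z.im) {s : ℝ} (hs : s ∈ Icc (-1 : ℝ) 1) :
    0 ≤ (cauchyKernel z s).im := by
  have h : 0 ≤ 1 - |s| := by rw [sub_nonneg]; exact abs_le.2 hs
  unfold cauchyKernel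
  rw [Complex.div_im]
  simp only [Complex.ofReal_im, zero_mul, zero_div, Complex.sub_im, Complex.im_mul_ofReal,
    Complex.ofReal_re]
  rw [zero_sub, zero_sub, ← neg_div, neg_mul_eq_mul_neg, neg_neg]
  exact div_nonneg (mul_nonneg h (mul_nonneg hz.le h)) (Complex.normSq_nonneg _)

lemma cauchyKernel_of_real (z : ℂ) (t : ℝ) :
    cauchyKernel z (t / (1 + |t|)) = ((t : ℂ) - z)⁻¹ := by
  have h0 : (0 : ℝ) < 1 + |t| := by positivity
  have h1 : 1 - |t / (1 + |t|)| = (1 + |t|)⁻¹ := by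
    rw [abs_div, abs_of_pos h0]; field_simp; ring
  unfold cauchyKernel
  rw [h1]
  have h2 : ((1 + |t| : ℝ) : ℂ) ≠ 0 := by exact_mod_cast h0.ne'
  push_cast at h2 ⊢
  rw [show (t : ℂ) / (1 + (|t| : ℝ)) - z * (1 + ((|t| : ℝ) : ℂ))⁻¹
    = (1 + ((|t| : ℝ) : ℂ))⁻¹ * (t - z) by field_simp]
  rw [div_eq_mul_inv, mul_inv, inv_inv, ← mul_assoc, inv_mul_cancel₀ h2, one_mul]

lemma cauchyKernel_of_abs_lt (z : ℂ) {s : ℝ} (hs : |s| < 1) :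
    cauchyKernel z s = (((s / (1 - |s|) : ℝ) : ℂ) - z)⁻¹ := by
  have h0 : 0 < 1 - |s| := by linarith
  have : s = (s / (1 - |s|)) / (1 + |s / (1 - |s|)|) := by
    rw [abs_div, abs_of_pos h0]; field_simp; ring
  conv_lhs => rw [this]
  exact cauchyKernel_of_real z _

lemma cauchyKernel_of_abs_eq (z : ℂ) {s : ℝ} (hs : |s| = 1) : cauchyKernel z s = 0 := by
  simp [cauchyKernel, hs]

lemma div_one_add_abs_mem (t : ℝ) : t / (1 + |t|) ∈ Icc (-1 : ℝ) 1 := by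
  have h0 : (0 : ℝ) < 1 + |t| := by positivity
  rw [mem_Icc, ← abs_le, abs_div, abs_of_pos h0, div_le_one h0]
  linarith

/-- The curve of Cauchy kernels at the points `z 1, …, z n`. -/
def kernelCurve {n : ℕ} (z : Fin n → ℂ) : Set (Fin n → ℂ) :=
  (fun (s : ℝ) i => cauchyKernel (z i) s) '' Icc (-1) 1

/-- At any finitely many points of the upper half plane, `F` is a limit of averages of Cauchy
kernels. By compactness such an `F` is the Cauchy transform of a measure of mass at most one; this
form makes limits and mixtures immediate. -/
def InCauchyHull (F : ℂ → ℂ) : Prop :=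
  ∀ (n : ℕ) (z : Fin n → ℂ), (∀ i, 0 < (z i).im) →
    (fun i => F (z i)) ∈ closure (convexHull ℝ (kernelCurve z))

lemma inCauchyHull_of_tendsto {F : ℕ → ℂ → ℂ} {G : ℂ → ℂ} (hF : ∀ k, InCauchyHull (F k))
    (h : ∀ z : ℂ, 0 < z.im → Tendsto (fun k => F k z) atTop (𝓝 (G z))) : InCauchyHull G := by
  intro n z hz
  refine isClosed_closure.mem_of_tendsto (f := fun (k : ℕ) (i : Fin n) => F k (z i)) (b := atTop)
    ?_ (Eventually.of_forall fun k => hF k n z hz)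
  exact tendsto_pi_nhds.2 fun i => h _ (hz i)

lemma inCauchyHull_integral {β : Type*} [MeasurableSpace β] (m : Measure β)
    [IsProbabilityMeasure m] {F : β → ℂ → ℂ} (hF : ∀ᵐ p ∂m, InCauchyHull (F p))
    (hi : ∀ z : ℂ, 0 < z.im → Integrable (fun p => F p z) m) :
    InCauchyHull fun z => ∫ p, F p z ∂m := by
  intro n z hz
  have h1 : ∀ i, Integrable (fun p => F p (z i)) m := fun i => hi _ (hz i)
  have h2 : (fun i => ∫ p, F p (z i) ∂m) = ∫ p, (fun i => F p (z i)) ∂m := by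
    funext i; rw [eval_integral h1]
  rw [h2]
  exact (convex_convexHull ℝ _).closure.integral_mem isClosed_closure
    (hF.mono fun p hp => hp n z hz) (Integrable.of_eval h1)

/-- The resolvent of an arrow-shaped Hermitian matrix at its corner is an average of simple
fractions with real poles. -/
lemma exists_corner_resolvent {ι : Type*} [Fintype ι] (t b : ι → ℝ) :
    ∃ (l p : Option ι → ℝ), (∀ j, 0 ≤ p j) ∧ ∑ j, p j = 1 ∧ ∀ z : ℂ, 0 < z.im →
      -z - ∑ i, ((b i : ℂ)) ^ 2 / (t i - z) ≠ 0 →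
      (-z - ∑ i, ((b i : ℂ)) ^ 2 / (t i - z))⁻¹ = ∑ j, (p j : ℂ) * ((l j : ℂ) - z)⁻¹ := by
  classical
  -- `-z - ∑ i, b i ^ 2 / (t i - z)` is the Schur complement of the block `diag (t i - z)` in
  -- `A - z`; the poles and weights come from the eigenvalues and eigenvectors of `A`.
  let A : Matrix (Option ι) (Option ι) ℂ := fun i j =>
    match i, j with
    | none, none => 0
    | none, some j => (b j : ℂ)
    | some i, none => (b i : ℂ)
    | some i, some j => if i = j then (t i : ℂ) else 0
  have hA : A.IsHermitian := by
    refine Matrix.IsHermitian.ext fun i j => ?_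
    match i, j with
    | none, none => simp [A]
    | none, some j => simp [A]
    | some i, none => simp [A]
    | some i, some j =>
      by_cases h : i = j
      · subst h; simp [A]
      · simp [A, h, Ne.symm h]
  let u := hA.eigenvectorBasis
  let e : EuclideanSpace ℂ (Option ι) := EuclideanSpace.single none 1
  refine ⟨hA.eigenvalues, fun j => ‖inner ℂ (u j) e‖ ^ 2, fun j => by positivity, ?_, ?_⟩
  · have := u.sum_sq_norm_inner_right e
    rw [this]; simp [e]
  intro z hz hc
  set c : ℂ := (-z - ∑ i, ((b i : ℂ)) ^ 2 / (t i - z))⁻¹ with hcdef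
  have ht : ∀ i, (t i : ℂ) - z ≠ 0 := by
    intro i h
    have := congrArg Complex.im h
    simp at this; exact hz.ne' this
  let x : EuclideanSpace ℂ (Option ι) := WithLp.toLp 2 fun i =>
    match i with
    | none => c
    | some i => -(b i) * c / (t i - z)
  have hx : A.mulVec (x.ofLp) - z • x.ofLp = e.ofLp := by
    funext i
    rcases i with _ | i
    · simp only [Pi.sub_apply, Matrix.mulVec, dotProduct, Fintype.sum_option, A, x, e,
        Pi.smul_apply, smul_eq_mul, zero_mul, zero_add, PiLp.single_apply, if_true]
      have : ∑ i, (b i : ℂ) * (-(b i) * c / (t i - z)) = -c * ∑ i, ((b i : ℂ)) ^ 2 / (t i - z) := by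
        rw [Finset.mul_sum]; refine Finset.sum_congr rfl fun i _ => ?_; ring
      rw [this, show -c * ∑ i, ((b i : ℂ)) ^ 2 / (t i - z) - z * c
        = c * (-z - ∑ i, ((b i : ℂ)) ^ 2 / (t i - z)) by ring, hcdef, inv_mul_cancel₀ hc]
    · simp only [Pi.sub_apply, Matrix.mulVec, dotProduct, Fintype.sum_option, A, x, e,
        Pi.smul_apply, smul_eq_mul, PiLp.single_apply, ite_mul, zero_mul, Finset.sum_ite_eq,
        Finset.mem_univ, if_true]
      rw [if_neg (by simp)]
      have := ht i
      field_simp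
      ring
  have hin : ∀ j, inner ℂ (u j) x = inner ℂ (u j) e * ((hA.eigenvalues j : ℂ) - z)⁻¹ := by
    intro j
    have hl : (hA.eigenvalues j : ℂ) - z ≠ 0 := by
      intro h
      have := congrArg Complex.im h
      simp at this; exact hz.ne' this
    rw [eq_mul_inv_iff_mul_eq₀ hl]
    have h1 : inner ℂ (u j) e = star (u j).ofLp ⬝ᵥ e.ofLp := by
      rw [EuclideanSpace.inner_eq_star_dotProduct, dotProduct_comm]
    have h2 : inner ℂ (u j) x = star (u j).ofLp ⬝ᵥ x.ofLp := by
      rw [EuclideanSpace.inner_eq_star_dotProduct, dotProduct_comm]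
    have h3 : star (u j).ofLp ⬝ᵥ A.mulVec x.ofLp
        = (hA.eigenvalues j : ℂ) * (star (u j).ofLp ⬝ᵥ x.ofLp) := by
      rw [Matrix.dotProduct_mulVec]
      have h4 : Matrix.vecMul (star (u j).ofLp) A = star (A.mulVec (u j).ofLp) := by
        rw [Matrix.star_mulVec, hA.eq]
      rw [h4, hA.mulVec_eigenvectorBasis j]
      simp [u]
    rw [h1, ← hx, dotProduct_sub, h3, dotProduct_smul, h2, smul_eq_mul]
    ring
  have hcx : c = inner ℂ e x := by
    simp [e, x, EuclideanSpace.inner_single_left]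
  rw [hcx, ← u.sum_inner_mul_inner e x]
  refine Finset.sum_congr rfl fun j _ => ?_
  rw [hin, ← mul_assoc, ← inner_conj_symm e (u j), ← Complex.normSq_eq_conj_mul_self,
    Complex.normSq_eq_norm_sq]

lemma kernelCurve_im_nonneg {n : ℕ} {z : Fin n → ℂ} (hz : ∀ i, 0 < (z i).im) {v : Fin n → ℂ}
    (hv : v ∈ closure (convexHull ℝ (kernelCurve z))) (i : Fin n) : 0 ≤ (v i).im := by
  have hcl : IsClosed {v : Fin n → ℂ | 0 ≤ (v i).im} :=
    isClosed_le continuous_const (Complex.continuous_im.comp (continuous_apply i))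
  have hcv : Convex ℝ {v : Fin n → ℂ | 0 ≤ (v i).im} := by
    intro v hv w hw a b ha hb _
    simp only [mem_ofPred_eq, Pi.add_apply, Pi.smul_apply, Complex.add_im, Complex.smul_im,
      smul_eq_mul] at hv hw ⊢
    positivity
  have : kernelCurve z ⊆ {v : Fin n → ℂ | 0 ≤ (v i).im} := by
    rintro _ ⟨s, hs, rfl⟩
    exact cauchyKernel_im_nonneg (hz i) hs
  exact closure_minimal (convexHull_min this hcv) hcl hv

lemma neg_sub_ne_zero_of_im {z w : ℂ} (hz : 0 < z.im) (hw : 0 ≤ w.im) : -z - w ≠ 0 := by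
  intro h
  have := congrArg Complex.im h
  simp at this
  linarith

/-- The class of Cauchy transforms is stable under the Schur complement step
`F ↦ -1 / (z + c F)`. -/
lemma inCauchyHull_schur {F : ℂ → ℂ} (hF : InCauchyHull F) {c : ℝ} (hc : 0 ≤ c) :
    InCauchyHull fun z => (-z - c * F z)⁻¹ := by
  intro n z hz
  have hne : ∀ v ∈ closure (convexHull ℝ (kernelCurve z)), ∀ i, -(z i) - (c : ℂ) * v i ≠ 0 := by
    intro v hv i
    refine neg_sub_ne_zero_of_im (hz i) ?_
    rw [Complex.im_ofReal_mul]
    exact mul_nonneg hc (kernelCurve_im_nonneg hz hv i)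
  let Ψ : (Fin n → ℂ) → (Fin n → ℂ) := fun v i => (-(z i) - (c : ℂ) * v i)⁻¹
  have hmaps : MapsTo Ψ (convexHull ℝ (kernelCurve z)) (convexHull ℝ (kernelCurve z)) := by
    intro v hv
    have hv' := subset_closure hv
    rw [mem_convexHull_iff_exists_fintype] at hv
    obtain ⟨ι, _, w, a, hw0, hw1, ha, rfl⟩ := hv
    choose s hs hsa using ha
    have hnn : ∀ i, 0 ≤ c * w i := fun i => mul_nonneg hc (hw0 i)
    obtain ⟨l, p, hp0, hp1, hres⟩ := exists_corner_resolvent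
      (fun i => s i / (1 - |s i|)) (fun i => if |s i| < 1 then Real.sqrt (c * w i) else 0)
    have hsum : ∀ k, (c : ℂ) * (∑ i, w i • a i) k = ∑ i,
        (((if |s i| < 1 then Real.sqrt (c * w i) else 0 : ℝ) : ℂ)) ^ 2 /
          (((s i / (1 - |s i|) : ℝ) : ℂ) - z k) := by
      intro k
      rw [Finset.sum_apply, Finset.mul_sum]
      refine Finset.sum_congr rfl fun i _ => ?_
      rw [← hsa i, Pi.smul_apply]
      change (c : ℂ) * w i • cauchyKernel (z k) (s i) = _
      by_cases h : |s i| < 1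
      · rw [if_pos h, ← Complex.ofReal_pow, Real.sq_sqrt (hnn i), cauchyKernel_of_abs_lt _ h,
          Complex.real_smul, div_eq_mul_inv]
        push_cast; ring
      · have h1 : |s i| = 1 := le_antisymm (abs_le.2 (hs i)) (not_lt.1 h)
        simp [h1, cauchyKernel_of_abs_eq]
    have : Ψ (∑ i, w i • a i) = ∑ j, p j • fun k => cauchyKernel (z k) (l j / (1 + |l j|)) := by
      funext k
      have h1 := hne _ hv' k
      simp only [Ψ]
      rw [hsum k] at h1 ⊢
      rw [hres (z k) (hz k) h1, Finset.sum_apply]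
      refine Finset.sum_congr rfl fun j _ => ?_
      simp [cauchyKernel_of_real]
    rw [this]
    exact (convex_convexHull ℝ _).sum_mem (fun j _ => hp0 j) hp1 fun j _ =>
      subset_convexHull ℝ _ ⟨_, div_one_add_abs_mem _, rfl⟩
  have hcont : ContinuousOn Ψ (closure (convexHull ℝ (kernelCurve z))) := by
    refine continuousOn_pi.2 fun i => ContinuousOn.inv₀ (by fun_prop) fun v hv => hne v hv i
  exact hmaps.closure_of_continuousOn hcont (hF n z hz)

/-- An element of the class is the Cauchy transform of a measure of mass at most one. -/
lemma InCauchyHull.exists_measure {F : ℂ → ℂ} (hF : InCauchyHull F) :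
    ∃ ρ : Measure ℝ, ρ univ ≤ 1 ∧ ∀ z : ℂ, 0 < z.im →
      ∫ t : ℝ, ((t : ℂ) - z)⁻¹ ∂ρ = F z := by
  let X := Icc (-1 : ℝ) 1
  let f : {z : ℂ // 0 < z.im} → BoundedContinuousFunction X ℂ := fun z =>
    BoundedContinuousFunction.mkOfCompact
      ⟨fun s => cauchyKernel z s, (continuous_cauchyKernel z.2).comp continuous_subtype_val⟩
  have hcont : ∀ z, Continuous fun ρ : ProbabilityMeasure X => ∫ s, f z s ∂(ρ : Measure X) := by
    intro z
    refine continuous_iff_continuousAt.2 fun ρ => ?_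
    exact (ProbabilityMeasure.tendsto_iff_forall_integral_rclike_tendsto ℂ).1 tendsto_id (f z)
  -- The constraints at finitely many points can be met, since the set of attainable values is
  -- closed and contains the convex hull; the probability measures on `[-1, 1]` are compact.
  have key : (⋂ z : {z : ℂ // 0 < z.im},
      {ρ : ProbabilityMeasure X | ∫ s, f z s ∂(ρ : Measure X) = F z}).Nonempty := by
    refine CompactSpace.iInter_nonempty
      (fun z => isClosed_eq (hcont z) continuous_const) fun u => ?_
    let z : Fin u.card → ℂ := fun i => (u.equivFin.symm i).1
    have hz : ∀ i, 0 < (z i).im := fun i => (u.equivFin.symm i).1.2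
    let T : Set (Fin u.card → ℂ) :=
      range fun (ρ : ProbabilityMeasure X) i => ∫ s, f ⟨z i, hz i⟩ s ∂(ρ : Measure X)
    have hT : IsClosed T :=
      (isCompact_range (continuous_pi fun i => hcont ⟨z i, hz i⟩)).isClosed
    have hsub : convexHull ℝ (kernelCurve z) ⊆ T := by
      intro v hv
      rw [mem_convexHull_iff_exists_fintype] at hv
      obtain ⟨ι, _, w, a, hw0, hw1, ha, rfl⟩ := hv
      choose s hs hsa using ha
      let m : Measure X := ∑ i, ENNReal.ofReal (w i) • Measure.dirac ⟨s i, hs i⟩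
      have hm : IsProbabilityMeasure m := by
        constructor
        simp only [m, Measure.finsetSum_apply, Measure.smul_apply, smul_eq_mul, measure_univ,
          mul_one]
        rw [← ENNReal.ofReal_sum_of_nonneg fun i _ => hw0 i, hw1, ENNReal.ofReal_one]
      refine ⟨⟨m, hm⟩, ?_⟩
      funext k
      simp only [ProbabilityMeasure.coe_mk, m]
      rw [integral_finsetSum_measure fun i _ => by
        refine Integrable.smul_measure ?_ ENNReal.ofReal_ne_top
        exact (integrable_dirac (by simp))]
      rw [Finset.sum_apply]
      refine Finset.sum_congr rfl fun i _ => ?_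
      rw [integral_smul_measure, integral_dirac, ENNReal.toReal_ofReal (hw0 i), ← hsa i]
      rfl
    obtain ⟨ρ, hρ⟩ := closure_minimal hsub hT (hF _ z hz)
    refine ⟨ρ, mem_iInter₂.2 fun y hy => ?_⟩
    have := congrFun hρ (u.equivFin ⟨y, hy⟩)
    simpa [z] using this
  -- Undo the compactification; mass at `s = ±1` is lost, but does not contribute to the transform.
  obtain ⟨ρ, hρ⟩ := key
  rw [mem_iInter] at hρ
  let φ : X → ℝ := fun s => (s : ℝ) / (1 - |(s : ℝ)|)
  have hφ : Measurable φ := by fun_prop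
  let B : Set X := {s | |(s : ℝ)| < 1}
  have hB : MeasurableSet B := measurableSet_lt (by fun_prop) (by fun_prop)
  refine ⟨((ρ : Measure X).restrict B).map φ, ?_, fun z hz => ?_⟩
  · rw [Measure.map_apply hφ MeasurableSet.univ]
    exact prob_le_one.trans' (Measure.restrict_apply_le _ _)
  · rw [← show ∫ s, f ⟨z, hz⟩ s ∂(ρ : Measure X) = F z from hρ ⟨z, hz⟩,
      integral_map hφ.aemeasurable (by
        refine Measurable.aestronglyMeasurable ?_
        fun_prop)]
    have h0 : ∀ s : X, s ∉ B → f ⟨z, hz⟩ s = 0 := by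
      intro s hs
      exact cauchyKernel_of_abs_eq z (le_antisymm (abs_le.2 s.2) (not_lt.1 hs))
    rw [← setIntegral_eq_integral_of_forall_compl_eq_zero h0]
    refine setIntegral_congr_fun hB fun s hs => ?_
    exact (cauchyKernel_of_abs_lt z hs).symm

/-! ### The self-consistent equation -/

/-- The weight `q^{1-2α}`. -/
noncomputable def wU (α q : ℝ) : ℝ := q ^ (1 - 2 * α)

/-- The weight `q^{2-2α}`. -/
noncomputable def wV (α q : ℝ) : ℝ := q ^ (2 - 2 * α)

/-- The variance profile `(pq)^{1-2α} (1 - pq)` of the normalised adjacency matrix. -/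
noncomputable def kern (α q p : ℝ) : ℝ := wU α q * wU α p - wV α q * wV α p

/-- The measure `ν` is carried by the interval `[a, b] ⊆ (0, 1)`. -/
structure CarriedBy (ν : Measure ℝ) (a b : ℝ) : Prop where
  pos : 0 < a
  lt_one : b < 1
  null : ν (Icc a b)ᶜ = 0

lemma CarriedBy.ae_mem {ν : Measure ℝ} {a b : ℝ} (h : CarriedBy ν a b) : ∀ᵐ q ∂ν, q ∈ Icc a b :=
  mem_ae_iff.2 h.null

lemma CarriedBy.nonempty {ν : Measure ℝ} [IsProbabilityMeasure ν] {a b : ℝ}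
    (h : CarriedBy ν a b) : (Icc a b).Nonempty := h.ae_mem.exists

@[fun_prop] lemma measurable_wU (α : ℝ) : Measurable (wU α) := by unfold wU; fun_prop
@[fun_prop] lemma measurable_wV (α : ℝ) : Measurable (wV α) := by unfold wV; fun_prop
@[fun_prop] lemma measurable_kern (α q : ℝ) : Measurable (kern α q) := by unfold kern; fun_prop

lemma wV_eq {α q : ℝ} (hq : 0 < q) : wV α q = q * wU α q := by
  unfold wV wU
  rw [show 2 - 2 * α = 1 + (1 - 2 * α) by ring, Real.rpow_add hq, Real.rpow_one]

lemma wU_pos {α q : ℝ} (hq : 0 < q) : 0 < wU α q := Real.rpow_pos_of_pos hq _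

lemma wV_pos {α q : ℝ} (hq : 0 < q) : 0 < wV α q := Real.rpow_pos_of_pos hq _

lemma kern_eq {α q p : ℝ} (hq : 0 < q) (hp : 0 < p) :
    kern α q p = wU α q * wU α p * (1 - q * p) := by
  unfold kern; rw [wV_eq hq, wV_eq hp]; ring

/-- A common lower bound of `q^{1-2α}` and its inverse for `q ∈ [a, 1]`. -/
noncomputable def wLow (a α : ℝ) : ℝ := a ^ |1 - 2 * α|

lemma wLow_pos {a α : ℝ} (ha : 0 < a) : 0 < wLow a α := Real.rpow_pos_of_pos ha _

lemma wLow_le_wU {a α q : ℝ} (ha : 0 < a) (h1 : a ≤ q) (h2 : q ≤ 1) : wLow a α ≤ wU α q := by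
  unfold wLow wU
  calc a ^ |1 - 2 * α| ≤ q ^ |1 - 2 * α| := Real.rpow_le_rpow ha.le h1 (abs_nonneg _)
    _ ≤ q ^ (1 - 2 * α) := Real.rpow_le_rpow_of_exponent_ge (ha.trans_le h1) h2 (le_abs_self _)

lemma wU_le {a α q : ℝ} (ha : 0 < a) (h1 : a ≤ q) (h2 : q ≤ 1) : wU α q ≤ (wLow a α)⁻¹ := by
  unfold wLow wU
  have hq := ha.trans_le h1
  calc q ^ (1 - 2 * α) ≤ q ^ (-|1 - 2 * α|) :=
        Real.rpow_le_rpow_of_exponent_ge hq h2 (neg_abs_le _)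
    _ = (q ^ |1 - 2 * α|)⁻¹ := Real.rpow_neg hq.le _
    _ ≤ _ := by
        apply inv_anti₀ (Real.rpow_pos_of_pos ha _)
        exact Real.rpow_le_rpow ha.le h1 (abs_nonneg _)

lemma wV_le {a α q : ℝ} (ha : 0 < a) (h1 : a ≤ q) (h2 : q ≤ 1) : wV α q ≤ (wLow a α)⁻¹ := by
  rw [wV_eq (ha.trans_le h1)]
  calc q * wU α q ≤ 1 * wU α q :=
        mul_le_mul_of_nonneg_right h2 (wU_pos (ha.trans_le h1)).le
    _ ≤ _ := by rw [one_mul]; exact wU_le ha h1 h2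

lemma kern_pos {α q p : ℝ} (hq : q ∈ Ioo (0 : ℝ) 1) (hp : p ∈ Ioo (0 : ℝ) 1) :
    0 < kern α q p := by
  rw [kern_eq hq.1 hp.1]
  have : q * p < 1 := by nlinarith [hq.1, hq.2, hp.1, hp.2]
  have h1 := wU_pos (α := α) hq.1
  have h2 := wU_pos (α := α) hp.1
  have : 0 < 1 - q * p := by linarith
  positivity

lemma kern_le {a b α q p : ℝ} (ha : 0 < a) (hb : b < 1) (hq : q ∈ Icc a b) (hp : p ∈ Icc a b) :
    kern α q p ≤ (wLow a α)⁻¹ ^ 2 := by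
  have hq0 := ha.trans_le hq.1
  have hp0 := ha.trans_le hp.1
  rw [kern_eq hq0 hp0]
  have h1 := wU_le (α := α) ha hq.1 (hq.2.trans hb.le)
  have h2 := wU_le (α := α) ha hp.1 (hp.2.trans hb.le)
  have h3 := wU_pos (α := α) hq0
  have h4 := wU_pos (α := α) hp0
  calc wU α q * wU α p * (1 - q * p) ≤ wU α q * wU α p * 1 := by
        apply mul_le_mul_of_nonneg_left _ (by positivity)
        have : 0 < q * p := by positivity
        linarith
    _ ≤ _ := by rw [mul_one, sq]; exact mul_le_mul h1 h2 h4.le (h3.le.trans h1)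

lemma le_kern {a b α q p : ℝ} (ha : 0 < a) (hb : b < 1) (hq : q ∈ Icc a b) (hp : p ∈ Icc a b) :
    wLow a α ^ 2 * (1 - b ^ 2) ≤ kern α q p := by
  have hq0 := ha.trans_le hq.1
  have hp0 := ha.trans_le hp.1
  rw [kern_eq hq0 hp0]
  have h1 := wLow_le_wU (α := α) ha hq.1 (hq.2.trans hb.le)
  have h2 := wLow_le_wU (α := α) ha hp.1 (hp.2.trans hb.le)
  have h0 := wLow_pos (α := α) ha
  have hb0 : 0 < b := hq0.trans_le hq.2
  have h5 : q * p ≤ b ^ 2 := by rw [sq]; exact mul_le_mul hq.2 hp.2 hp0.le hb0.le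
  have h6 : 0 ≤ 1 - b ^ 2 := by nlinarith
  have h7 : 0 ≤ wU α q * wU α p := by have := h0.le.trans h1; have := h0.le.trans h2; positivity
  rw [sq]
  have h8 := h0.le.trans h1
  gcongr

lemma CarriedBy.Icc_subset {ν : Measure ℝ} {a b : ℝ} (h : CarriedBy ν a b) :
    Icc a b ⊆ Ioo (0 : ℝ) 1 := fun _ hq => ⟨h.pos.trans_le hq.1, hq.2.trans_lt h.lt_one⟩

lemma CarriedBy.integrable {ν : Measure ℝ} [IsProbabilityMeasure ν] {a b : ℝ}
    (h : CarriedBy ν a b) {F : Type*} [NormedAddCommGroup F] {f : ℝ → F}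
    (hf : AEStronglyMeasurable f ν) {C : ℝ} (hC : ∀ q ∈ Icc a b, ‖f q‖ ≤ C) : Integrable f ν :=
  Integrable.of_bound hf C (h.ae_mem.mono hC)

/-- Multiplication by a power weight preserves integrability. -/
lemma CarriedBy.integrable_wU_mul {ν : Measure ℝ} {a b : ℝ}
    (h : CarriedBy ν a b) (α : ℝ) {f : ℝ → ℝ}
    (hf : Integrable f ν) : Integrable (fun q => wU α q * f q) ν := by
  refine hf.bdd_mul (c := (wLow a α)⁻¹) (by fun_prop) (h.ae_mem.mono fun q hq => ?_)
  rw [Real.norm_of_nonneg (wU_pos (h.pos.trans_le hq.1)).le]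
  exact wU_le h.pos hq.1 (hq.2.trans h.lt_one.le)

lemma CarriedBy.integrable_wV_mul {ν : Measure ℝ} {a b : ℝ}
    (h : CarriedBy ν a b) (α : ℝ) {f : ℝ → ℝ}
    (hf : Integrable f ν) : Integrable (fun q => wV α q * f q) ν := by
  refine hf.bdd_mul (c := (wLow a α)⁻¹) (by fun_prop) (h.ae_mem.mono fun q hq => ?_)
  rw [Real.norm_of_nonneg (wV_pos (h.pos.trans_le hq.1)).le]
  exact wV_le h.pos hq.1 (hq.2.trans h.lt_one.le)

lemma CarriedBy.integrable_kern_mul {ν : Measure ℝ} {a b : ℝ}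
    (h : CarriedBy ν a b) (α q : ℝ) {f : ℝ → ℝ}
    (hf : Integrable f ν) : Integrable (fun p => kern α q p * f p) ν := by
  have := ((h.integrable_wU_mul α hf).const_mul (wU α q)).sub
    ((h.integrable_wV_mul α hf).const_mul (wV α q))
  refine this.congr (Eventually.of_forall fun p => ?_)
  simp only [Pi.sub_apply, kern]; ring

lemma CarriedBy.integral_kern_mul {ν : Measure ℝ} {a b : ℝ}
    (h : CarriedBy ν a b) (α q : ℝ) {f : ℝ → ℝ} (hf : Integrable f ν) :
    ∫ p, kern α q p * f p ∂ν = wU α q * ∫ p, wU α p * f p ∂ν - wV α q * ∫ p, wV α p * f p ∂ν := by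
  rw [← integral_const_mul, ← integral_const_mul, ← integral_sub
    ((h.integrable_wU_mul α hf).const_mul _) ((h.integrable_wV_mul α hf).const_mul _)]
  refine integral_congr_ae (Eventually.of_forall fun p => ?_)
  simp only [kern]; ring

/-- The self-energy of a node of weight `q`. -/
noncomputable def selfE (α : ℝ) (E : ℂ × ℂ) (q : ℝ) : ℂ := E.1 * (wU α q : ℂ) - E.2 * (wV α q : ℂ)

/-- The diagonal resolvent entry `1 / (-z - E₁ q^{1-2α} + E₂ q^{2-2α})` of a node of weight `q`. -/
noncomputable def res (α : ℝ) (z : ℂ) (E : ℂ × ℂ) (q : ℝ) : ℂ := (-z - selfE α E q)⁻¹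

@[fun_prop] lemma measurable_res (α : ℝ) (z : ℂ) (E : ℂ × ℂ) : Measurable (res α z E) := by
  unfold res selfE; fun_prop

/-- One step of the fixed point iteration: `(e₁₁(z), e₂₁(z))` as a function of `(E₁, E₂)`. -/
noncomputable def step (ν : Measure ℝ) (α : ℝ) (z : ℂ) (E : ℂ × ℂ) : ℂ × ℂ :=
  (∫ q, (wU α q : ℂ) * res α z E q ∂ν, ∫ q, (wV α q : ℂ) * res α z E q ∂ν)

lemma eInt_one_one (ν : Measure ℝ) (α : ℝ) (z : ℂ) (E : ℂ × ℂ) :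
    eInt ν α 1 1 z E = (step ν α z E).1 := by
  unfold eInt step res selfE wU wV
  refine integral_congr_ae (Eventually.of_forall fun q => ?_)
  simp only [Int.cast_one, mul_one, div_eq_mul_inv]
  congr 2; ring

lemma eInt_two_one (ν : Measure ℝ) (α : ℝ) (z : ℂ) (E : ℂ × ℂ) :
    eInt ν α 2 1 z E = (step ν α z E).2 := by
  unfold eInt step res selfE wU wV
  refine integral_congr_ae (Eventually.of_forall fun q => ?_)
  simp only [Int.cast_one, mul_one, div_eq_mul_inv, Int.cast_ofNat]
  congr 2; ring

lemma eInt_zero_zero (ν : Measure ℝ) (α : ℝ) (z : ℂ) (E : ℂ × ℂ) :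
    eInt ν α 0 0 z E = ∫ q, res α z E q ∂ν := by
  unfold eInt res selfE wU wV
  refine integral_congr_ae (Eventually.of_forall fun q => ?_)
  simp only [Int.cast_zero, mul_zero, zero_mul, sub_zero, Real.rpow_zero, Complex.ofReal_one,
    one_div]
  congr 1; ring

/-- All self-energies over the carrier have nonnegative imaginary part. -/
def Good (α a b : ℝ) (E : ℂ × ℂ) : Prop := ∀ q ∈ Icc a b, 0 ≤ (selfE α E q).im

lemma Good.ae {α a b : ℝ} {E : ℂ × ℂ} (h : Good α a b E) {ν : Measure ℝ}
    (hν : CarriedBy ν a b) : ∀ᵐ q ∂ν, 0 ≤ (selfE α E q).im := hν.ae_mem.mono h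

section resolvent

variable {α q : ℝ} {z : ℂ} {E : ℂ × ℂ}

lemma res_den_ne_zero (hz : 0 < z.im) (h : 0 ≤ (selfE α E q).im) : -z - selfE α E q ≠ 0 :=
  neg_sub_ne_zero_of_im hz h

lemma norm_res_le (hz : 0 < z.im) (h : 0 ≤ (selfE α E q).im) : ‖res α z E q‖ ≤ z.im⁻¹ := by
  unfold res
  rw [norm_inv]
  apply inv_anti₀ hz
  calc z.im ≤ |(-z - selfE α E q).im| := by
        rw [Complex.sub_im, Complex.neg_im, abs_of_nonpos (by linarith)]; linarith
    _ ≤ _ := Complex.abs_im_le_norm _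

lemma res_im (α : ℝ) (z : ℂ) (E : ℂ × ℂ) (q : ℝ) :
    (res α z E q).im = ‖res α z E q‖ ^ 2 * (z.im + (selfE α E q).im) := by
  unfold res
  rw [Complex.inv_im, norm_inv, inv_pow, Complex.normSq_eq_norm_sq, Complex.sub_im, Complex.neg_im]
  ring

lemma norm_res_pos (hz : 0 < z.im) (h : 0 ≤ (selfE α E q).im) : 0 < ‖res α z E q‖ :=
  norm_pos_iff.2 (inv_ne_zero (res_den_ne_zero hz h))

lemma res_im_pos (hz : 0 < z.im) (h : 0 ≤ (selfE α E q).im) : 0 < (res α z E q).im := by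
  rw [res_im]
  have := norm_res_pos hz h
  positivity

lemma res_sub_res {E' : ℂ × ℂ} (hz : 0 < z.im) (h : 0 ≤ (selfE α E q).im)
    (h' : 0 ≤ (selfE α E' q).im) : res α z E q - res α z E' q =
      res α z E q * res α z E' q * (selfE α E q - selfE α E' q) := by
  have h1 := res_den_ne_zero hz h
  have h2 := res_den_ne_zero hz h'
  unfold res
  field_simp
  ring

end resolvent

section iteration

variable {ν : Measure ℝ} [IsProbabilityMeasure ν] {a b α : ℝ} {z : ℂ} {E E' : ℂ × ℂ}

lemma integrable_res (hz : 0 < z.im) (hE : ∀ᵐ q ∂ν, 0 ≤ (selfE α E q).im) :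
    Integrable (res α z E) ν :=
  Integrable.of_bound (by fun_prop) z.im⁻¹ (hE.mono fun _ hq => norm_res_le hz hq)

lemma integrable_ofReal_mul_res (hν : CarriedBy ν a b) (hz : 0 < z.im)
    (hE : ∀ᵐ q ∂ν, 0 ≤ (selfE α E q).im)
    {f : ℝ → ℝ} (hf : Measurable f) {C : ℝ} (hC : ∀ q ∈ Icc a b, |f q| ≤ C) :
    Integrable (fun q => (f q : ℂ) * res α z E q) ν := by
  refine Integrable.of_bound (by fun_prop) (C * z.im⁻¹) ?_
  filter_upwards [hE, hν.ae_mem] with q hEq hq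
  rw [norm_mul, Complex.norm_real, Real.norm_eq_abs]
  have := norm_res_le hz hEq
  have := hC q hq
  gcongr
  exact (abs_nonneg _).trans this

lemma integrable_wU_mul_res (hν : CarriedBy ν a b) (hz : 0 < z.im)
    (hE : ∀ᵐ q ∂ν, 0 ≤ (selfE α E q).im) :
    Integrable (fun q => (wU α q : ℂ) * res α z E q) ν :=
  integrable_ofReal_mul_res hν hz hE (by fun_prop) (C := (wLow a α)⁻¹) fun q hq => by
    rw [abs_of_pos (wU_pos (hν.pos.trans_le hq.1))]
    exact wU_le hν.pos hq.1 (hq.2.trans hν.lt_one.le)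

lemma integrable_wV_mul_res (hν : CarriedBy ν a b) (hz : 0 < z.im)
    (hE : ∀ᵐ q ∂ν, 0 ≤ (selfE α E q).im) :
    Integrable (fun q => (wV α q : ℂ) * res α z E q) ν :=
  integrable_ofReal_mul_res hν hz hE (by fun_prop) (C := (wLow a α)⁻¹) fun q hq => by
    rw [abs_of_pos (wV_pos (hν.pos.trans_le hq.1))]
    exact wV_le hν.pos hq.1 (hq.2.trans hν.lt_one.le)

lemma integrable_kern_mul_res (hν : CarriedBy ν a b) (hz : 0 < z.im)
    (hE : ∀ᵐ q ∂ν, 0 ≤ (selfE α E q).im) (q : ℝ) :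
    Integrable (fun p => (kern α q p : ℂ) * res α z E p) ν := by
  have := ((integrable_wU_mul_res hν hz hE).const_mul (wU α q : ℂ)).sub
    ((integrable_wV_mul_res hν hz hE).const_mul (wV α q : ℂ))
  refine this.congr (Eventually.of_forall fun p => ?_)
  simp only [Pi.sub_apply, kern]; push_cast; ring

lemma selfE_step (hν : CarriedBy ν a b) (hz : 0 < z.im)
    (hE : ∀ᵐ q ∂ν, 0 ≤ (selfE α E q).im) (q : ℝ) :
    selfE α (step ν α z E) q = ∫ p, (kern α q p : ℂ) * res α z E p ∂ν := by
  unfold selfE step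
  rw [mul_comm, mul_comm _ (wV α q : ℂ), ← integral_const_mul, ← integral_const_mul,
    ← integral_sub ((integrable_wU_mul_res hν hz hE).const_mul _)
      ((integrable_wV_mul_res hν hz hE).const_mul _)]
  refine integral_congr_ae (Eventually.of_forall fun p => ?_)
  simp only [kern]; push_cast; ring

lemma selfE_step_im (hν : CarriedBy ν a b) (hz : 0 < z.im)
    (hE : ∀ᵐ q ∂ν, 0 ≤ (selfE α E q).im) (q : ℝ) :
    (selfE α (step ν α z E) q).im = ∫ p, kern α q p * (res α z E p).im ∂ν := by
  rw [selfE_step hν hz hE, ← RCLike.im_eq_complex_im,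
    ← integral_im (integrable_kern_mul_res hν hz hE q)]
  refine integral_congr_ae (Eventually.of_forall fun p => ?_)
  simp

lemma integrable_res_im (hz : 0 < z.im) (hE : ∀ᵐ q ∂ν, 0 ≤ (selfE α E q).im) :
    Integrable (fun p => (res α z E p).im) ν := (integrable_res hz hE).im

/-- The integral of a positive function against a probability measure is positive. -/
lemma integral_pos_of_ae_pos {f : ℝ → ℝ} (hf : Integrable f ν)
    (h : ∀ᵐ q ∂ν, 0 < f q) : 0 < ∫ q, f q ∂ν := by
  rw [integral_pos_iff_support_of_nonneg_ae (h.mono fun q hq => hq.le) hf]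
  have : ν (Function.support f) = 1 := by
    rw [← measure_univ (μ := ν)]
    exact measure_congr (eventuallyEq_univ.2 (h.mono fun q hq => hq.ne'))
  rw [this]
  exact zero_lt_one

lemma selfE_step_im_pos (hν : CarriedBy ν a b) (hz : 0 < z.im)
    (hE : ∀ᵐ q ∂ν, 0 ≤ (selfE α E q).im) {q : ℝ}
    (hq : q ∈ Icc a b) : 0 < (selfE α (step ν α z E) q).im := by
  rw [selfE_step_im hν hz hE]
  refine integral_pos_of_ae_pos (hν.integrable_kern_mul α q (integrable_res_im hz hE)) ?_
  filter_upwards [hE, hν.ae_mem] with p hEp hp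
  exact mul_pos (kern_pos (hν.Icc_subset hq) (hν.Icc_subset hp)) (res_im_pos hz hEp)

lemma good_step (hν : CarriedBy ν a b) (hz : 0 < z.im)
    (hE : ∀ᵐ q ∂ν, 0 ≤ (selfE α E q).im) :
    Good α a b (step ν α z E) := fun _ hq => (selfE_step_im_pos hν hz hE hq).le

lemma norm_selfE_step_le (hν : CarriedBy ν a b) (hz : 0 < z.im)
    (hE : ∀ᵐ q ∂ν, 0 ≤ (selfE α E q).im) {q : ℝ}
    (hq : q ∈ Icc a b) : ‖selfE α (step ν α z E) q‖ ≤ (wLow a α)⁻¹ ^ 2 / z.im := by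
  rw [selfE_step hν hz hE]
  refine (norm_integral_le_of_norm_le_const (C := (wLow a α)⁻¹ ^ 2 / z.im) ?_).trans (by simp)
  filter_upwards [hE, hν.ae_mem] with p hEp hp
  rw [norm_mul, Complex.norm_real, Real.norm_of_nonneg
    (kern_pos (hν.Icc_subset hq) (hν.Icc_subset hp)).le, div_eq_mul_inv]
  have h1 := norm_res_le hz hEp
  have h2 := kern_le (α := α) hν.pos hν.lt_one hq hp
  gcongr

/-- The resolvents of `E` and `E'` are at distance at most `M` in the supremum over the carrier of
the quantity `|g - g'| / √(Im g · Im g')`, a gauge of the hyperbolic distance of the upper half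
plane. By the inequality of arithmetic and geometric means, the square root is encoded by a free
parameter `l`, which makes the condition linear. -/
def HypClose (α a b : ℝ) (z : ℂ) (E E' : ℂ × ℂ) (M : ℝ) : Prop :=
  ∀ q ∈ Icc a b, ∀ l : ℝ, 0 < l →
    2 * ‖res α z E q - res α z E' q‖ ≤ M * (l * (res α z E q).im + (res α z E' q).im / l)

/-- The contraction ratio of the iteration at `z`: a self-energy with imaginary part `s ≤ B / Im z`
contributes at most this share of `Im z + s`. -/
noncomputable def ratio (a α : ℝ) (z : ℂ) : ℝ :=
  ((wLow a α)⁻¹ ^ 2 / z.im) / (z.im + (wLow a α)⁻¹ ^ 2 / z.im)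

lemma ratio_nonneg (a α : ℝ) (hz : 0 < z.im) : 0 ≤ ratio a α z := by
  unfold ratio; positivity

lemma ratio_lt_one (a α : ℝ) (hz : 0 < z.im) : ratio a α z < 1 := by
  unfold ratio
  rw [div_lt_one (by positivity)]; linarith

lemma le_ratio_mul {a α s : ℝ} (hz : 0 < z.im) (hs : s ≤ (wLow a α)⁻¹ ^ 2 / z.im) :
    s ≤ ratio a α z * (z.im + s) := by
  unfold ratio
  rw [div_mul_eq_mul_div, le_div_iff₀ (by positivity)]
  nlinarith

/-- The iteration contracts the hyperbolic distance. -/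
lemma hypClose_step {M : ℝ} (hM : 0 ≤ M) (hν : CarriedBy ν a b) (hz : 0 < z.im)
    (hE : Good α a b E) (hE' : Good α a b E') (h : HypClose α a b z E E' M) :
    HypClose α a b z (step ν α z E) (step ν α z E') (M * ratio a α z) := by
  intro q hq l hl
  have hEa := hE.ae hν
  have hEa' := hE'.ae hν
  have hG := good_step hν hz hEa
  have hG' := good_step hν hz hEa'
  set g := res α z (step ν α z E) q
  set g' := res α z (step ν α z E') q
  have hg : 0 < ‖g‖ := norm_res_pos hz (hG q hq)
  have hg' : 0 < ‖g'‖ := norm_res_pos hz (hG' q hq)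
  set s := (selfE α (step ν α z E) q).im with hs
  set s' := (selfE α (step ν α z E') q).im with hs'
  have hsr : s ≤ ratio a α z * (z.im + s) := le_ratio_mul hz
    (((le_abs_self _).trans (Complex.abs_im_le_norm _)).trans (norm_selfE_step_le hν hz hEa hq))
  have hsr' : s' ≤ ratio a α z * (z.im + s') := le_ratio_mul hz
    (((le_abs_self _).trans (Complex.abs_im_le_norm _)).trans (norm_selfE_step_le hν hz hEa' hq))
  have key : ∀ k : ℝ, 0 < k → 2 * ‖selfE α (step ν α z E) q -
      selfE α (step ν α z E') q‖ ≤ M * (k * s + s' / k) := by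
    intro k hk
    have hi := integrable_res_im hz hEa
    have hi' := integrable_res_im hz hEa'
    rw [selfE_step hν hz hEa, selfE_step hν hz hEa', ← integral_sub
      (integrable_kern_mul_res hν hz hEa q) (integrable_kern_mul_res hν hz hEa' q),
      hs, hs', selfE_step_im hν hz hEa, selfE_step_im hν hz hEa', ← integral_const_mul,
      ← integral_div, ← integral_add ((hν.integrable_kern_mul α q hi).const_mul k)
        ((hν.integrable_kern_mul α q hi').div_const k), ← integral_const_mul]
    rw [← le_div_iff₀' two_pos, ← integral_div]
    refine norm_integral_le_of_norm_le ?_ (hν.ae_mem.mono fun p hp => ?_)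
    · exact ((((hν.integrable_kern_mul α q hi).const_mul k).add
        ((hν.integrable_kern_mul α q hi').div_const k)).const_mul M).div_const 2
    · have hk0 := kern_pos (α := α) (hν.Icc_subset hq) (hν.Icc_subset hp)
      rw [← mul_sub, norm_mul, Complex.norm_real, Real.norm_of_nonneg hk0.le]
      have := mul_le_mul_of_nonneg_left (h p hp k hk) hk0.le
      rw [le_div_iff₀ two_pos]
      calc _ = kern α q p * (2 * ‖res α z E p - res α z E' p‖) := by ring
        _ ≤ _ := this
        _ = _ := by ring
  rw [res_sub_res hz (hG q hq) (hG' q hq), res_im, res_im, norm_mul, norm_mul]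
  have hk := key (l * ‖g‖ / ‖g'‖) (by positivity)
  calc 2 * (‖g‖ * ‖g'‖ * ‖selfE α (step ν α z E) q - selfE α (step ν α z E') q‖)
      = ‖g‖ * ‖g'‖ * (2 * ‖selfE α (step ν α z E) q -
          selfE α (step ν α z E') q‖) := by ring
    _ ≤ ‖g‖ * ‖g'‖ * (M * (l * ‖g‖ / ‖g'‖ * s + s' / (l * ‖g‖ / ‖g'‖))) := by gcongr
    _ = M * (l * (‖g‖ ^ 2 * s) + ‖g'‖ ^ 2 * s' / l) := by field_simp
    _ ≤ M * (l * (‖g‖ ^ 2 * (ratio a α z * (z.im + s))) +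
          ‖g'‖ ^ 2 * (ratio a α z * (z.im + s')) / l) := by gcongr
    _ = _ := by ring

end iteration

section iteration

variable {ν : Measure ℝ} [IsProbabilityMeasure ν] {a b α : ℝ} {z : ℂ} {E E' : ℂ × ℂ}

lemma norm_selfE_le (ha : 0 < a) (hb : b < 1) (E : ℂ × ℂ) {q : ℝ} (hq : q ∈ Icc a b) :
    ‖selfE α E q‖ ≤ (‖E.1‖ + ‖E.2‖) * (wLow a α)⁻¹ := by
  have hq0 := ha.trans_le hq.1
  have h1 := wU_le (α := α) ha hq.1 (hq.2.trans hb.le)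
  have h2 := wV_le (α := α) ha hq.1 (hq.2.trans hb.le)
  unfold selfE
  refine (norm_sub_le _ _).trans ?_
  rw [norm_mul, norm_mul, Complex.norm_real, Complex.norm_real,
    Real.norm_of_nonneg (wU_pos hq0).le, Real.norm_of_nonneg (wV_pos hq0).le, add_mul]
  gcongr

lemma exists_le_res_im (ha : 0 < a) (hb : b < 1) (hz : 0 < z.im) (hE : Good α a b E) :
    ∃ c, 0 < c ∧ ∀ q ∈ Icc a b, c ≤ (res α z E q).im := by
  set B := (‖E.1‖ + ‖E.2‖) * (wLow a α)⁻¹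
  have hB : 0 ≤ B := by have := wLow_pos (α := α) ha; positivity
  have hz0 : 0 < ‖z‖ := norm_pos_iff.2 fun h => by simp [h] at hz
  refine ⟨(‖z‖ + B)⁻¹ ^ 2 * z.im, by positivity, fun q hq => ?_⟩
  rw [res_im]
  have h1 : (‖z‖ + B)⁻¹ ≤ ‖res α z E q‖ := by
    unfold res
    rw [norm_inv]
    apply inv_anti₀ (norm_pos_iff.2 (res_den_ne_zero hz (hE q hq)))
    refine (norm_sub_le _ _).trans ?_
    rw [norm_neg]
    gcongr
    exact norm_selfE_le ha hb E hq
  have := hE q hq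
  gcongr
  linarith

lemma exists_hypClose (ha : 0 < a) (hb : b < 1) (hz : 0 < z.im) (hE : Good α a b E)
    (hE' : Good α a b E') : ∃ M, 0 ≤ M ∧ HypClose α a b z E E' M := by
  obtain ⟨c, hc, h⟩ := exists_le_res_im ha hb hz hE
  obtain ⟨c', hc', h'⟩ := exists_le_res_im ha hb hz hE'
  set d := min c c'
  have hd : 0 < d := lt_min hc hc'
  refine ⟨2 / (z.im * d), by positivity, fun q hq l hl => ?_⟩
  have h1 : ‖res α z E q - res α z E' q‖ ≤ 2 * z.im⁻¹ := by
    refine (norm_sub_le _ _).trans ?_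
    linarith [norm_res_le hz (hE q hq), norm_res_le hz (hE' q hq)]
  have h2 : d ≤ (res α z E q).im := (min_le_left _ _).trans (h q hq)
  have h3 : d ≤ (res α z E' q).im := (min_le_right _ _).trans (h' q hq)
  have h4 : 2 ≤ l + 1 / l := by
    rw [← sub_nonneg, show l + 1 / l - 2 = (l - 1) ^ 2 / l by field_simp; ring]
    positivity
  calc 2 * ‖res α z E q - res α z E' q‖ ≤ 2 * (2 * z.im⁻¹) := by gcongr
    _ = 2 / (z.im * d) * (d * 2) := by field_simp
    _ ≤ 2 / (z.im * d) * (d * (l + 1 / l)) := by gcongr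
    _ = 2 / (z.im * d) * (l * d + d / l) := by ring
    _ ≤ _ := by gcongr

lemma HypClose.norm_sub_le {M : ℝ} (hM : 0 ≤ M) (hz : 0 < z.im) (hE : Good α a b E)
    (hE' : Good α a b E') (h : HypClose α a b z E E' M) {q : ℝ} (hq : q ∈ Icc a b) :
    ‖res α z E q - res α z E' q‖ ≤ M * z.im⁻¹ := by
  have h1 := h q hq 1 one_pos
  have h2 := ((le_abs_self _).trans (Complex.abs_im_le_norm _)).trans (norm_res_le hz (hE q hq))
  have h3 := ((le_abs_self _).trans (Complex.abs_im_le_norm _)).trans (norm_res_le hz (hE' q hq))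
  have : M * (1 * (res α z E q).im + (res α z E' q).im / 1) ≤ M * (2 * z.im⁻¹) := by
    gcongr; linarith
  linarith

lemma norm_step_sub_le (hν : CarriedBy ν a b) (hz : 0 < z.im) (hE : Good α a b E)
    (hE' : Good α a b E') {d : ℝ} (h : ∀ q ∈ Icc a b, ‖res α z E q - res α z E' q‖ ≤ d) :
    ‖step ν α z E - step ν α z E'‖ ≤ (wLow a α)⁻¹ * d := by
  unfold step
  rw [Prod.mk_sub_mk, Prod.norm_mk]
  have hEa := hE.ae hν
  have hEa' := hE'.ae hν
  have hL : (0 : ℝ) ≤ (wLow a α)⁻¹ := by have := wLow_pos (α := α) hν.pos; positivity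
  refine max_le ?_ ?_
  · rw [← integral_sub (integrable_wU_mul_res hν hz hEa) (integrable_wU_mul_res hν hz hEa')]
    refine (norm_integral_le_of_norm_le_const (C := (wLow a α)⁻¹ * d) ?_).trans (by simp)
    filter_upwards [hν.ae_mem] with q hq
    have hq0 := hν.pos.trans_le hq.1
    rw [← mul_sub, norm_mul, Complex.norm_real, Real.norm_of_nonneg (wU_pos hq0).le]
    exact mul_le_mul (wU_le hν.pos hq.1 (hq.2.trans hν.lt_one.le)) (h q hq) (norm_nonneg _) hL
  · rw [← integral_sub (integrable_wV_mul_res hν hz hEa) (integrable_wV_mul_res hν hz hEa')]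
    refine (norm_integral_le_of_norm_le_const (C := (wLow a α)⁻¹ * d) ?_).trans (by simp)
    filter_upwards [hν.ae_mem] with q hq
    have hq0 := hν.pos.trans_le hq.1
    rw [← mul_sub, norm_mul, Complex.norm_real, Real.norm_of_nonneg (wV_pos hq0).le]
    exact mul_le_mul (wV_le hν.pos hq.1 (hq.2.trans hν.lt_one.le)) (h q hq) (norm_nonneg _) hL

/-- The fixed point iteration started at `0`. -/
noncomputable def iter (ν : Measure ℝ) (α : ℝ) (z : ℂ) (k : ℕ) : ℂ × ℂ :=
  (step ν α z)^[k] 0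

lemma iter_succ (ν : Measure ℝ) (α : ℝ) (z : ℂ) (k : ℕ) :
    iter ν α z (k + 1) = step ν α z (iter ν α z k) := Function.iterate_succ_apply' _ _ _

lemma selfE_zero (α q : ℝ) : selfE α 0 q = 0 := by simp [selfE]

lemma good_iter (hν : CarriedBy ν a b) (hz : 0 < z.im) (k : ℕ) :
    Good α a b (iter ν α z k) := by
  induction k with
  | zero => intro q _; simp [iter, selfE_zero]
  | succ k ih => rw [iter_succ]; exact good_step hν hz (ih.ae hν)

lemma continuous_selfE (α q : ℝ) : Continuous fun E : ℂ × ℂ => selfE α E q := by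
  unfold selfE; fun_prop

/-- The iteration converges, and its limit is a fixed point. -/
lemma exists_tendsto_iter (hν : CarriedBy ν a b) (hz : 0 < z.im) (α : ℝ) :
    ∃ E, Good α a b E ∧ step ν α z E = E ∧ Tendsto (iter ν α z) atTop (𝓝 E) := by
  obtain ⟨M, hM, h0⟩ := exists_hypClose hν.pos hν.lt_one hz (good_iter (α := α) hν hz 0)
    (good_iter (α := α) hν hz 1)
  set r := ratio a α z
  have hr0 : 0 ≤ r := ratio_nonneg a α hz
  have hk : ∀ k, HypClose α a b z (iter ν α z k) (iter ν α z (k + 1)) (M * r ^ k) := by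
    intro k
    induction k with
    | zero => simpa using h0
    | succ k ih =>
      rw [iter_succ, iter_succ ν α z (k + 1), pow_succ, ← mul_assoc]
      exact hypClose_step (by positivity) hν hz (good_iter hν hz _) (good_iter hν hz _) ih
  have hd : ∀ k, dist (iter ν α z (k + 1)) (iter ν α z (k + 1 + 1)) ≤
      ((wLow a α)⁻¹ * (M * z.im⁻¹)) * r ^ k := by
    intro k
    rw [dist_eq_norm, iter_succ, iter_succ ν α z (k + 1)]
    refine (norm_step_sub_le hν hz (good_iter hν hz _) (good_iter hν hz _) fun q hq =>
      (hk k).norm_sub_le (by positivity) hz (good_iter hν hz _) (good_iter hν hz _) hq).trans ?_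
    exact le_of_eq (by ring)
  obtain ⟨E, hE⟩ := cauchySeq_tendsto_of_complete
    (cauchySeq_of_le_geometric r _ (ratio_lt_one a α hz) hd)
  have hE' : Tendsto (iter ν α z) atTop (𝓝 E) := (tendsto_add_atTop_iff_nat 1).1 hE
  have hgood : Good α a b E := fun q hq => by
    have := (Complex.continuous_im.tendsto _).comp (((continuous_selfE α q).tendsto E).comp hE')
    exact ge_of_tendsto' this fun k => good_iter hν hz k q hq
  refine ⟨E, hgood, ?_, hE'⟩
  refine tendsto_nhds_unique ?_ hE
  simp only [iter_succ]
  have hpt : ∀ q ∈ Icc a b, Tendsto (fun k => res α z (iter ν α z k) q) atTop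
      (𝓝 (res α z E q)) := fun q hq =>
    (tendsto_const_nhds.sub (((continuous_selfE α q).tendsto E).comp hE')).inv₀
      (res_den_ne_zero hz (hgood q hq))
  refine Tendsto.prodMk_nhds ?_ ?_
  · refine tendsto_integral_of_dominated_convergence (fun _ => (wLow a α)⁻¹ * z.im⁻¹)
      (fun k => by fun_prop) (integrable_const _) (fun k => ?_) ?_
    · filter_upwards [hν.ae_mem] with q hq
      have hq0 := hν.pos.trans_le hq.1
      rw [norm_mul, Complex.norm_real, Real.norm_of_nonneg (wU_pos hq0).le]
      have h1 := wU_le (α := α) hν.pos hq.1 (hq.2.trans hν.lt_one.le)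
      exact mul_le_mul h1 (norm_res_le hz (good_iter hν hz k q hq)) (norm_nonneg _)
        ((wU_pos hq0).le.trans h1)
    · filter_upwards [hν.ae_mem] with q hq
      exact (hpt q hq).const_mul _
  · refine tendsto_integral_of_dominated_convergence (fun _ => (wLow a α)⁻¹ * z.im⁻¹)
      (fun k => by fun_prop) (integrable_const _) (fun k => ?_) ?_
    · filter_upwards [hν.ae_mem] with q hq
      have hq0 := hν.pos.trans_le hq.1
      rw [norm_mul, Complex.norm_real, Real.norm_of_nonneg (wV_pos hq0).le]
      have h1 := wV_le (α := α) hν.pos hq.1 (hq.2.trans hν.lt_one.le)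
      exact mul_le_mul h1 (norm_res_le hz (good_iter hν hz k q hq)) (norm_nonneg _)
        ((wV_pos hq0).le.trans h1)
    · filter_upwards [hν.ae_mem] with q hq
      exact (hpt q hq).const_mul _

lemma isFixedPoint_of_step_eq (hν : CarriedBy ν a b) (hz : 0 < z.im) (hE : Good α a b E)
    (h : step ν α z E = E) : IsFixedPoint ν α z E where
  im_fst := by
    have hEa := hE.ae hν
    rw [← h]
    change 0 < (∫ q, (wU α q : ℂ) * res α z E q ∂ν).im
    have hi := integrable_wU_mul_res hν hz hEa
    rw [← RCLike.im_eq_complex_im, ← integral_im hi]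
    refine integral_pos_of_ae_pos hi.im (hν.ae_mem.mono fun q hq => ?_)
    rw [RCLike.im_eq_complex_im, Complex.im_ofReal_mul]
    exact mul_pos (wU_pos (hν.pos.trans_le hq.1)) (res_im_pos hz (hE q hq))
  im_snd := by
    have hEa := hE.ae hν
    rw [← h]
    change 0 < (∫ q, (wV α q : ℂ) * res α z E q ∂ν).im
    have hi := integrable_wV_mul_res hν hz hEa
    rw [← RCLike.im_eq_complex_im, ← integral_im hi]
    refine integral_pos_of_ae_pos hi.im (hν.ae_mem.mono fun q hq => ?_)
    rw [RCLike.im_eq_complex_im, Complex.im_ofReal_mul]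
    exact mul_pos (wV_pos (hν.pos.trans_le hq.1)) (res_im_pos hz (hE q hq))
  im_self := hν.ae_mem.mono fun q hq => by
    have := selfE_step_im_pos hν hz (hE.ae hν) hq
    rwa [h] at this
  eq_fst := by rw [eInt_one_one, h]
  eq_snd := by rw [eInt_two_one, h]

lemma IsFixedPoint.step_eq {ν : Measure ℝ} (h : IsFixedPoint ν α z E) : step ν α z E = E :=
  Prod.ext (by rw [← eInt_one_one, ← h.eq_fst]) (by rw [← eInt_two_one, ← h.eq_snd])

lemma IsFixedPoint.good (h : IsFixedPoint ν α z E) (hν : CarriedBy ν a b) (hz : 0 < z.im) :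
    Good α a b E := by
  have := good_step hν hz (h.im_self.mono fun q hq => le_of_lt hq)
  rwa [h.step_eq] at this

lemma IsFixedPoint.eq (h : IsFixedPoint ν α z E) (h' : IsFixedPoint ν α z E')
    (hν : CarriedBy ν a b) (hz : 0 < z.im) : E = E' := by
  have hE := h.good hν hz
  have hE' := h'.good hν hz
  obtain ⟨M, hM, h0⟩ := exists_hypClose hν.pos hν.lt_one hz hE hE'
  have hr0 := ratio_nonneg a α hz
  have hk : ∀ k : ℕ, HypClose α a b z E E' (M * ratio a α z ^ k) := by
    intro k
    induction k with
    | zero => simpa using h0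
    | succ k ih =>
      have := hypClose_step (by positivity) hν hz hE hE' ih
      rwa [h.step_eq, h'.step_eq, mul_assoc, ← pow_succ] at this
  have hd : ∀ k : ℕ, ‖E - E'‖ ≤ ((wLow a α)⁻¹ * (M * z.im⁻¹)) * ratio a α z ^ k := by
    intro k
    have := norm_step_sub_le hν hz hE hE' fun q hq =>
      (hk k).norm_sub_le (by positivity) hz hE hE' hq
    rw [h.step_eq, h'.step_eq] at this
    exact this.trans (le_of_eq (by ring))
  have hlim := (tendsto_pow_atTop_nhds_zero_of_lt_one hr0 (ratio_lt_one a α hz)).const_mul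
    ((wLow a α)⁻¹ * (M * z.im⁻¹))
  rw [mul_zero] at hlim
  exact sub_eq_zero.1 (norm_le_zero_iff.1 (ge_of_tendsto' hlim hd))

lemma CarriedBy.existsUnique_isFixedPoint (hν : CarriedBy ν a b) (α : ℝ) (hz : 0 < z.im) :
    ∃! E, IsFixedPoint ν α z E := by
  obtain ⟨E, hE, hs, _⟩ := exists_tendsto_iter hν hz α
  have := isFixedPoint_of_step_eq hν hz hE hs
  exact ⟨E, this, fun E' h' => h'.eq this hν hz⟩

lemma CarriedBy.isFixedPoint (hν : CarriedBy ν a b) (α : ℝ) (hz : 0 < z.im) :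
    IsFixedPoint ν α z (fixedPoint ν α z) :=
  Classical.epsilon_spec (hν.existsUnique_isFixedPoint α hz).exists

lemma CarriedBy.tendsto_iter (hν : CarriedBy ν a b) (α : ℝ) (hz : 0 < z.im) :
    Tendsto (iter ν α z) atTop (𝓝 (fixedPoint ν α z)) := by
  obtain ⟨E, hE, hs, ht⟩ := exists_tendsto_iter hν hz α
  rwa [(hν.isFixedPoint α hz).eq (isFixedPoint_of_step_eq hν hz hE hs) hν hz]

/-- The resolvent entry `g_q(z)` of the limiting model. -/
noncomputable def gLim (ν : Measure ℝ) (α q : ℝ) (z : ℂ) : ℂ := res α z (fixedPoint ν α z) q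

lemma CarriedBy.good (hν : CarriedBy ν a b) (α : ℝ) (hz : 0 < z.im) :
    Good α a b (fixedPoint ν α z) := (hν.isFixedPoint α hz).good hν hz

lemma CarriedBy.tendsto_res_iter (hν : CarriedBy ν a b) (α : ℝ) (hz : 0 < z.im) {q : ℝ}
    (hq : q ∈ Icc a b) :
    Tendsto (fun k => res α z (iter ν α z k) q) atTop (𝓝 (gLim ν α q z)) :=
  (tendsto_const_nhds.sub (((continuous_selfE α q).tendsto _).comp (hν.tendsto_iter α hz))).inv₀
      (res_den_ne_zero hz (hν.good α hz q hq))

lemma inCauchyHull_zero : InCauchyHull fun _ => 0 := by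
  intro n z _
  refine subset_closure (subset_convexHull ℝ _ ⟨1, by simp, ?_⟩)
  funext i
  exact cauchyKernel_of_abs_eq _ (by simp)

lemma inCauchyHull_res_iter (hν : CarriedBy ν a b) (α : ℝ) (k : ℕ) {q : ℝ} (hq : q ∈ Icc a b) :
    InCauchyHull fun z => res α z (iter ν α z k) q := by
  induction k generalizing q with
  | zero =>
    have := inCauchyHull_schur inCauchyHull_zero le_rfl
    simpa [res, iter, selfE_zero] using this
  | succ k ih =>
    have hk0 : ∀ p ∈ Icc a b, 0 < kern α q p :=
      fun p hp => kern_pos (hν.Icc_subset hq) (hν.Icc_subset hp)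
    have hki : Integrable (kern α q) ν := by
      simpa using hν.integrable_kern_mul α q (integrable_const (1 : ℝ))
    set c := ∫ p, kern α q p ∂ν with hc
    have hc0 : 0 < c := integral_pos_of_ae_pos hki (hν.ae_mem.mono hk0)
    -- The self-energy is `c` times the average of the resolvents under the normalised kernel `m`.
    let f : ℝ → ENNReal := fun p => ENNReal.ofReal (kern α q p / c)
    have hf : Measurable f := by fun_prop
    have hfr : ∀ᵐ p ∂ν, (f p).toReal = kern α q p / c := hν.ae_mem.mono fun p hp =>
      ENNReal.toReal_ofReal (div_nonneg (hk0 p hp).le hc0.le)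
    let m := ν.withDensity f
    have hm : IsProbabilityMeasure m := by
      constructor
      rw [withDensity_apply _ MeasurableSet.univ, Measure.restrict_univ,
        ← ofReal_integral_eq_lintegral_ofReal (hki.div_const c)
          (hν.ae_mem.mono fun p hp => div_nonneg (hk0 p hp).le hc0.le),
        integral_div, ← hc, div_self hc0.ne', ENNReal.ofReal_one]
    have hmac : ∀ᵐ p ∂m, p ∈ Icc a b := (withDensity_absolutelyContinuous ν f).ae_le hν.ae_mem
    have h1 : InCauchyHull fun z => ∫ p, res α z (iter ν α z k) p ∂m := by
      refine inCauchyHull_integral m (hmac.mono fun p hp => ih hp) fun z hz => ?_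
      refine Integrable.of_bound (by fun_prop) z.im⁻¹ (hmac.mono fun p hp => ?_)
      exact norm_res_le hz (good_iter hν hz k p hp)
    have h2 := inCauchyHull_schur h1 hc0.le
    intro n z hz
    refine (congrArg (· ∈ closure (convexHull ℝ (kernelCurve z))) (funext fun i => ?_)).mpr
      (h2 n z hz)
    have hz := hz i
    change (-z i - selfE α (iter ν α (z i) (k + 1)) q)⁻¹ = (-z i - _)⁻¹
    rw [iter_succ, selfE_step hν hz ((good_iter hν hz k).ae hν)]
    congr 2
    rw [integral_withDensity_eq_integral_toReal_smul hf
      (Eventually.of_forall fun p => ENNReal.ofReal_lt_top), ← integral_const_mul]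
    refine integral_congr_ae (hfr.mono fun p hp => ?_)
    simp only
    rw [hp, Complex.real_smul]
    push_cast
    have : (c : ℂ) ≠ 0 := by exact_mod_cast hc0.ne'
    field_simp

lemma inCauchyHull_gLim (hν : CarriedBy ν a b) (α : ℝ) {q : ℝ} (hq : q ∈ Icc a b) :
    InCauchyHull (gLim ν α q) :=
  inCauchyHull_of_tendsto (fun k => inCauchyHull_res_iter hν α k hq)
    fun _ hz => hν.tendsto_res_iter α hz hq

lemma integrable_gLim (hν : CarriedBy ν a b) (α : ℝ) (hz : 0 < z.im) :
    Integrable (fun q => gLim ν α q z) ν := integrable_res hz ((hν.good α hz).ae hν)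

lemma inCauchyHull_integral_gLim (hν : CarriedBy ν a b) (α : ℝ) :
    InCauchyHull fun z => ∫ q, gLim ν α q z ∂ν :=
  inCauchyHull_integral ν (hν.ae_mem.mono fun _ hq => inCauchyHull_gLim hν α hq)
    fun _ hz => integrable_gLim hν α hz

end iteration

/-! ### Cauchy transforms near the real axis -/

section cauchy

variable {π : Measure ℝ} [IsFiniteMeasure π]

lemma norm_inv_sub_le {z : ℂ} (hz : 0 < z.im) (t : ℝ) : ‖((t : ℂ) - z)⁻¹‖ ≤ z.im⁻¹ := by
  rw [norm_inv]
  apply inv_anti₀ hz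
  calc z.im ≤ |((t : ℂ) - z).im| := by simp [le_abs_self]
    _ ≤ _ := Complex.abs_im_le_norm _

lemma inv_sub_im (t x y : ℝ) :
    (((t : ℂ) - (x + y * Complex.I))⁻¹).im = y / ((t - x) ^ 2 + y ^ 2) := by
  rw [Complex.inv_im, Complex.normSq_apply]
  simp
  ring

lemma measurable_inv_sub (z : ℂ) : Measurable fun t : ℝ => ((t : ℂ) - z)⁻¹ := by fun_prop

lemma integrable_inv_sub {z : ℂ} (hz : 0 < z.im) : Integrable (fun t : ℝ => ((t : ℂ) - z)⁻¹) π :=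
  Integrable.of_bound (measurable_inv_sub z).aestronglyMeasurable z.im⁻¹
    (Eventually.of_forall (norm_inv_sub_le hz))

lemma add_mul_I_im (x y : ℝ) : ((x : ℂ) + y * Complex.I).im = y := by simp

lemma integrable_im_kernel (x : ℝ) {y : ℝ} (hy : 0 < y) :
    Integrable (fun t : ℝ => y / ((t - x) ^ 2 + y ^ 2)) π := by
  have h := (integrable_inv_sub (π := π) (z := x + y * Complex.I) (by simpa using hy)).im
  refine h.congr (Eventually.of_forall fun t => ?_)
  exact inv_sub_im t x y

lemma cauchy_im (x : ℝ) {y : ℝ} (hy : 0 < y) :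
    (∫ t : ℝ, ((t : ℂ) - (x + y * Complex.I))⁻¹ ∂π).im = ∫ t, y / ((t - x) ^ 2 + y ^ 2) ∂π := by
  rw [← RCLike.im_eq_complex_im,
    ← integral_im (integrable_inv_sub (π := π) (z := x + y * Complex.I) (by simpa using hy))]
  exact integral_congr_ae (Eventually.of_forall fun t => inv_sub_im t x y)

/-- The mass of an interval is controlled by the imaginary part of the Cauchy transform at the
centres of `N` equal pieces, at height half the length of a piece. -/
lemma measureReal_Icc_le_sum {x₁ x₂ : ℝ} (h12 : x₁ < x₂) {N : ℕ} (hN : 0 < N) :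
    π.real (Icc x₁ x₂) ≤ ∑ j ∈ Finset.range N, 2 * ((x₂ - x₁) / (2 * N)) *
      (∫ t : ℝ, ((t : ℂ) - ((x₁ + (2 * j + 1) * ((x₂ - x₁) / (2 * N)) : ℝ) +
        ((x₂ - x₁) / (2 * N) : ℝ) * Complex.I))⁻¹ ∂π).im := by
  have hN' : (0 : ℝ) < N := by exact_mod_cast hN
  set y := (x₂ - x₁) / (2 * N) with hy
  have hy0 : 0 < y := div_pos (by linarith) (by positivity)
  simp_rw [cauchy_im _ hy0]
  have hint : ∀ j ∈ Finset.range N, Integrable (fun t : ℝ => 2 * y *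
      (y / ((t - (x₁ + (2 * j + 1) * y)) ^ 2 + y ^ 2))) π := fun j _ =>
    (integrable_im_kernel _ hy0).const_mul _
  simp_rw [← integral_const_mul]
  rw [← integral_finsetSum _ hint, ← integral_indicator_one measurableSet_Icc]
  refine integral_mono ((integrable_const 1).indicator measurableSet_Icc)
    (integrable_finsetSum _ hint) fun t => ?_
  have hnn : ∀ j ∈ Finset.range N,
      0 ≤ 2 * y * (y / ((t - (x₁ + (2 * j + 1) * y)) ^ 2 + y ^ 2)) := fun j _ => by positivity
  by_cases ht : t ∈ Icc x₁ x₂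
  · rw [indicator_of_mem ht]
    -- Some centre is at distance at most `y` from `t`.
    obtain ⟨j, hj, hjt⟩ : ∃ j ∈ Finset.range N, |t - (x₁ + (2 * j + 1) * y)| ≤ y := by
      have h2 : x₂ = x₁ + N * (2 * y) := by rw [hy]; field_simp; ring
      rcases eq_or_lt_of_le ht.2 with h | h
      · refine ⟨N - 1, Finset.mem_range.2 (by omega), ?_⟩
        rw [h, h2, Nat.cast_sub hN, abs_le]
        push_cast
        constructor <;> nlinarith
      · have hs0 : 0 ≤ (t - x₁) / (2 * y) := div_nonneg (by linarith [ht.1]) (by positivity)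
        refine ⟨⌊(t - x₁) / (2 * y)⌋₊, Finset.mem_range.2 ?_, ?_⟩
        · rw [Nat.floor_lt hs0, div_lt_iff₀ (by positivity)]
          linarith
        · have h3 := Nat.floor_le hs0
          have h4 := Nat.lt_floor_add_one ((t - x₁) / (2 * y))
          rw [le_div_iff₀ (by positivity)] at h3
          rw [div_lt_iff₀ (by positivity)] at h4
          rw [abs_le]
          constructor <;> nlinarith
    refine le_trans ?_ (Finset.single_le_sum hnn hj)
    rw [mul_div_assoc', le_div_iff₀ (by positivity)]
    have := sq_le_sq' (abs_le.1 hjt).1 (abs_le.1 hjt).2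
    simp only [Pi.one_apply]
    nlinarith
  · rw [indicator_of_notMem ht]
    exact Finset.sum_nonneg hnn

lemma measure_Icc_eq_zero_of_im_le {x₁ x₂ C : ℝ} (h12 : x₁ < x₂)
    (h : ∀ x ∈ Icc x₁ x₂, ∀ y : ℝ, 0 < y →
      (∫ t : ℝ, ((t : ℂ) - (x + y * Complex.I))⁻¹ ∂π).im ≤ C * y) : π (Icc x₁ x₂) = 0 := by
  have key : ∀ N : ℕ, π.real (Icc x₁ x₂) ≤ C * (x₂ - x₁) ^ 2 / 2 * ((N : ℝ) + 1)⁻¹ := by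
    intro N
    have hN : (0 : ℝ) < (N : ℝ) + 1 := by positivity
    refine (measureReal_Icc_le_sum h12 N.succ_pos).trans ?_
    simp only [Nat.succ_eq_add_one, Nat.cast_add, Nat.cast_one]
    set y := (x₂ - x₁) / (2 * ((N : ℝ) + 1)) with hy
    have hy0 : 0 < y := div_pos (by linarith) (by positivity)
    have h2 : x₂ = x₁ + (N + 1) * (2 * y) := by rw [hy]; field_simp; ring
    calc _ ≤ ∑ j ∈ Finset.range (N + 1), 2 * y * (C * y) := by
          refine Finset.sum_le_sum fun j hj => ?_
          have hj' : (j : ℝ) + 1 ≤ N + 1 := by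
            exact_mod_cast Finset.mem_range.1 hj
          refine mul_le_mul_of_nonneg_left ?_ (by positivity)
          exact h (x₁ + (2 * j + 1) * y) ⟨by nlinarith, by rw [h2]; nlinarith⟩ y hy0
      _ = _ := by
          rw [Finset.sum_const, Finset.card_range, nsmul_eq_mul, hy]
          push_cast
          field_simp
  have hlim : Tendsto (fun N : ℕ => C * (x₂ - x₁) ^ 2 / 2 * ((N : ℝ) + 1)⁻¹) atTop (𝓝 0) := by
    have := tendsto_one_div_add_atTop_nhds_zero_nat (𝕜 := ℝ)
    simp only [one_div] at this
    simpa using this.const_mul (C * (x₂ - x₁) ^ 2 / 2)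
  have h0 := ge_of_tendsto' hlim key
  exact (measureReal_eq_zero_iff (measure_ne_top _ _)).1 (le_antisymm h0 measureReal_nonneg)

end cauchy

lemma measure_Ioi_eq_zero_of_Icc {π : Measure ℝ} {S : ℝ}
    (h : ∀ n : ℕ, π (Icc (S + 1 / ((n : ℝ) + 1)) (S + ((n : ℝ) + 2))) = 0) : π (Ioi S) = 0 := by
  refine measure_mono_null (fun x hx => ?_) (measure_iUnion_null h)
  obtain ⟨n, hn⟩ := exists_nat_one_div_lt (show (0 : ℝ) < x - S from sub_pos.2 hx)
  obtain ⟨m, hm⟩ := exists_nat_ge (x - S)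
  refine mem_iUnion.2 ⟨max n m, ?_, ?_⟩
  · have : (1 : ℝ) / ((max n m : ℕ) + 1) ≤ 1 / ((n : ℝ) + 1) := by
      apply one_div_le_one_div_of_le (by positivity)
      have : (n : ℝ) ≤ (max n m : ℕ) := by exact_mod_cast le_max_left _ _
      linarith
    linarith
  · have : (m : ℝ) ≤ (max n m : ℕ) := by exact_mod_cast le_max_right _ _
    linarith

lemma one_div_lt_add_two (n : ℕ) : 1 / ((n : ℝ) + 1) < (n : ℝ) + 2 := by
  have h0 : (0 : ℝ) ≤ n := n.cast_nonneg
  rw [div_lt_iff₀ (by positivity)]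
  nlinarith

/-! ### Supersolutions and the support of the limiting spectrum -/

/-- `h` is a positive integrable supersolution, at the real level `x`, of the self-consistent
equation `1 / h + S h = x`, where `S` is the integral operator with kernel `kern`. -/
structure IsSupersolution (ν : Measure ℝ) (α x : ℝ) (h : ℝ → ℝ) : Prop where
  integrable : Integrable h ν
  pos : ∀ᵐ q ∂ν, 0 < h q
  le : ∀ᵐ q ∂ν, (h q)⁻¹ + ∫ p, kern α q p * h p ∂ν ≤ x

section supersolution

variable {ν : Measure ℝ} [IsProbabilityMeasure ν] {a b α : ℝ} {z : ℂ}

lemma IsSupersolution.nonneg {x : ℝ} {h : ℝ → ℝ} (hs : IsSupersolution ν α x h)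
    (hν : CarriedBy ν a b) : 0 ≤ x := by
  obtain ⟨q, hq, hle, hqm⟩ := (hs.pos.and (hs.le.and hν.ae_mem)).exists
  have : 0 ≤ ∫ p, kern α q p * h p ∂ν := by
    refine integral_nonneg_of_ae ?_
    filter_upwards [hs.pos, hν.ae_mem] with p hp hpm
    exact mul_nonneg (kern_pos (hν.Icc_subset hqm) (hν.Icc_subset hpm)).le hp.le
  have := inv_pos.2 hq
  linarith

/-- Scalar form of the induction step in `IsSupersolution.iter_le`. -/
lemma supersolution_step {g h y v d T w : ℝ} (hg : 0 < g) (hh : 0 < h) (hd : 0 < d) (hT : 0 ≤ T)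
    (hy : 0 < y) (h1 : d + T ≤ g⁻¹ - h⁻¹) (h2 : w * d ≤ y * T) (hv : v = g ^ 2 * (y + w)) :
    g ≤ h ∧ v * d ≤ y * (h - g) := by
  have h3 : h⁻¹ ≤ g⁻¹ := by linarith
  have h4 : g ≤ h := (inv_le_inv₀ hh hg).1 h3
  refine ⟨h4, ?_⟩
  have h5 : h - g = h * g * (g⁻¹ - h⁻¹) := by field_simp
  calc v * d = g ^ 2 * (y * d + w * d) := by rw [hv]; ring
    _ ≤ g ^ 2 * (y * d + y * T) := by gcongr
    _ = y * (g * g * (d + T)) := by ring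
    _ ≤ y * (h * g * (g⁻¹ - h⁻¹)) := by gcongr
    _ = _ := by rw [← h5]

/-- Outside the disc of radius `x₀`, a supersolution `h` at level `x₀` dominates the iterates, and
the difference `h - |g|` controls their imaginary part. -/
lemma IsSupersolution.iter_le (hν : CarriedBy ν a b) {x₀ x : ℝ} {h : ℝ → ℝ}
    (hs : IsSupersolution ν α x₀ h) (hz : 0 < z.im) (hx : x₀ < x) (hzx : x ≤ ‖z‖) (k : ℕ) :
    ∀ᵐ q ∂ν, ‖res α z (iter ν α z k) q‖ ≤ h q ∧
      (res α z (iter ν α z k) q).im * (x - x₀) ≤ z.im * (h q - ‖res α z (iter ν α z k) q‖) := by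
  have hSh : ∀ q ∈ Icc a b, 0 ≤ ∫ p, kern α q p * h p ∂ν := by
    intro q hq
    refine integral_nonneg_of_ae ?_
    filter_upwards [hs.pos, hν.ae_mem] with p hp hpm
    exact mul_nonneg (kern_pos (hν.Icc_subset hq) (hν.Icc_subset hpm)).le hp.le
  induction k with
  | zero =>
    filter_upwards [hs.pos, hs.le, hν.ae_mem] with q hq hle hqm
    have h0 : (selfE α (iter ν α z 0) q) = 0 := selfE_zero α q
    refine supersolution_step (T := 0) (w := 0) (norm_res_pos hz (by rw [h0]; simp)) hq
      (sub_pos.2 hx) le_rfl hz ?_ (by simp) (by rw [res_im, h0]; simp)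
    have := hSh q hqm
    rw [res, h0, sub_zero, norm_inv, inv_inv, norm_neg]
    linarith
  | succ k ih =>
    have hg := good_iter (α := α) hν hz k
    have hga := hg.ae hν
    have hi := integrable_res (α := α) hz hga
    have hg' := good_iter (α := α) hν hz (k + 1)
    filter_upwards [hs.pos, hs.le, hν.ae_mem] with q hq hle hqm
    have hk : ∀ᵐ p ∂ν, 0 < kern α q p :=
      hν.ae_mem.mono fun p hp => kern_pos (hν.Icc_subset hqm) (hν.Icc_subset hp)
    have hin := hν.integrable_kern_mul α q hi.norm
    have hih := hν.integrable_kern_mul α q hs.integrable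
    have hiv := hν.integrable_kern_mul α q (integrable_res_im hz hga)
    refine supersolution_step
      (T := ∫ p, kern α q p * h p ∂ν - ∫ p, kern α q p * ‖res α z (iter ν α z k) p‖ ∂ν)
      (norm_res_pos hz (hg' q hqm)) hq (sub_pos.2 hx) ?_ hz ?_ ?_ (res_im _ _ _ _)
    · rw [← integral_sub hih hin]
      refine integral_nonneg_of_ae ?_
      filter_upwards [ih, hk] with p hp hkp
      exact sub_nonneg.2 (mul_le_mul_of_nonneg_left hp.1 hkp.le)
    · have h1 : ‖selfE α (iter ν α z (k + 1)) q‖ ≤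
          ∫ p, kern α q p * ‖res α z (iter ν α z k) p‖ ∂ν := by
        rw [iter_succ, selfE_step hν hz hga]
        refine norm_integral_le_of_norm_le hin (hk.mono fun p hp => ?_)
        rw [norm_mul, Complex.norm_real, Real.norm_of_nonneg hp.le]
      have h2 : ‖z‖ - ‖selfE α (iter ν α z (k + 1)) q‖ ≤
          ‖res α z (iter ν α z (k + 1)) q‖⁻¹ := by
        rw [res, norm_inv, inv_inv, ← norm_neg z]
        exact norm_sub_norm_le _ _
      linarith
    · rw [iter_succ, selfE_step_im hν hz hga, ← integral_sub hih hin, ← integral_mul_const,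
        ← integral_const_mul]
      refine integral_mono_ae (hiv.mul_const _) ((hih.sub hin).const_mul _) ?_
      filter_upwards [ih, hk] with p hp hkp
      have := mul_le_mul_of_nonneg_left hp.2 hkp.le
      linarith

lemma IsSupersolution.gLim_im_le (hν : CarriedBy ν a b) {x₀ x : ℝ} {h : ℝ → ℝ}
    (hs : IsSupersolution ν α x₀ h) (hz : 0 < z.im) (hx : x₀ < x) (hzx : x ≤ ‖z‖) :
    ∀ᵐ q ∂ν, (gLim ν α q z).im ≤ z.im / (x - x₀) * h q := by
  have hall := ae_all_iff.2 fun k => hs.iter_le hν hz hx hzx k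
  filter_upwards [hall, hν.ae_mem] with q hq hqm
  have ht := (Complex.continuous_im.tendsto _).comp (hν.tendsto_res_iter α hz hqm)
  refine le_of_tendsto' ht fun k => ?_
  have h1 := (hq k).2
  have h2 : 0 < x - x₀ := sub_pos.2 hx
  simp only [Function.comp]
  rw [div_mul_eq_mul_div, le_div_iff₀ h2]
  refine h1.trans (mul_le_mul_of_nonneg_left ?_ hz.le)
  linarith [norm_nonneg (res α z (iter ν α z k) q)]

lemma integral_gLim_im (hν : CarriedBy ν a b) (hz : 0 < z.im) :
    (∫ q, gLim ν α q z ∂ν).im = ∫ q, (gLim ν α q z).im ∂ν := by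
  rw [← RCLike.im_eq_complex_im, ← integral_im (integrable_gLim hν α hz)]

/-- A measure whose Cauchy transform is `e₀₀` has no mass at distance more than `x₀` from the origin
if there is a supersolution at level `x₀`. -/
lemma IsSupersolution.measure_eq_zero (hν : CarriedBy ν a b) {x₀ : ℝ} {h : ℝ → ℝ}
    (hs : IsSupersolution ν α x₀ h) {π : Measure ℝ} [IsFiniteMeasure π]
    (hπ : ∀ z : ℂ, 0 < z.im → ∫ t : ℝ, ((t : ℂ) - z)⁻¹ ∂π = ∫ q, gLim ν α q z ∂ν) :
    π (Ioi x₀) = 0 ∧ π (Iio (-x₀)) = 0 := by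
  have key : ∀ x₁ x₂ x : ℝ, x₁ < x₂ → x₀ < x → (∀ t ∈ Icc x₁ x₂, x ≤ |t|) →
      π (Icc x₁ x₂) = 0 := by
    intro x₁ x₂ x h12 hx hxt
    refine measure_Icc_eq_zero_of_im_le (C := (∫ q, h q ∂ν) / (x - x₀)) h12 fun t ht y hy => ?_
    have hz : 0 < ((t : ℂ) + y * Complex.I).im := by simpa using hy
    rw [hπ _ hz, integral_gLim_im hν hz]
    have hzx : x ≤ ‖(t : ℂ) + y * Complex.I‖ := by
      refine (hxt t ht).trans ((le_of_eq ?_).trans (Complex.abs_re_le_norm _))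
      simp
    refine (integral_mono_ae (integrable_gLim hν α hz).im (hs.integrable.const_mul _)
      (hs.gLim_im_le hν hz hx hzx)).trans (le_of_eq ?_)
    rw [integral_const_mul, add_mul_I_im]
    ring
  have hx0 := hs.nonneg hν
  have hn : ∀ n : ℕ, (0 : ℝ) < 1 / ((n : ℝ) + 1) := fun n => by positivity
  constructor
  · refine measure_Ioi_eq_zero_of_Icc fun n => key _ _ (x₀ + 1 / ((n : ℝ) + 1)) ?_ ?_ ?_
    · linarith [one_div_lt_add_two n]
    · linarith [hn n]
    · intro t ht; exact ht.1.trans (le_abs_self t)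
  · have hmap : (π.map (fun t => -t)) (Ioi x₀) = 0 := by
      refine measure_Ioi_eq_zero_of_Icc fun n => ?_
      rw [Measure.map_apply measurable_neg measurableSet_Icc]
      have : (fun t : ℝ => -t) ⁻¹' Icc (x₀ + 1 / ((n : ℝ) + 1)) (x₀ + ((n : ℝ) + 2)) =
          Icc (-(x₀ + ((n : ℝ) + 2))) (-(x₀ + 1 / ((n : ℝ) + 1))) := by
        ext t; simp only [mem_preimage, mem_Icc]
        constructor <;> rintro ⟨h1, h2⟩ <;> constructor <;> linarith
      rw [this]
      refine key _ _ (x₀ + 1 / ((n : ℝ) + 1)) ?_ ?_ ?_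
      · linarith [one_div_lt_add_two n]
      · linarith [hn n]
      · intro t ht; refine le_trans ?_ (neg_le_abs t); linarith [ht.2]
    rw [Measure.map_apply measurable_neg measurableSet_Ioi] at hmap
    convert hmap using 2
    ext t; simp only [mem_preimage, mem_Ioi, mem_Iio]
    constructor <;> intro h <;> linarith

lemma isSupersolution_const (hν : CarriedBy ν a b) (α : ℝ) :
    IsSupersolution ν α (2 * (wLow a α)⁻¹) fun _ => wLow a α where
  integrable := integrable_const _
  pos := Eventually.of_forall fun _ => wLow_pos hν.pos
  le := hν.ae_mem.mono fun q hq => by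
    have h0 := wLow_pos (α := α) hν.pos
    have : ∫ p, kern α q p * wLow a α ∂ν ≤ ∫ p, (wLow a α)⁻¹ ∂ν := by
      refine integral_mono_ae (hν.integrable_kern_mul α q (integrable_const _))
        (integrable_const _) (hν.ae_mem.mono fun p hp => ?_)
      have := mul_le_mul_of_nonneg_right (kern_le (α := α) hν.pos hν.lt_one hq hp) h0.le
      refine this.trans (le_of_eq ?_)
      field_simp
    simp only [integral_const, probReal_univ, one_smul] at this
    linarith

end supersolution

/-! ### The limiting spectral measure -/

section spectrum

variable {ν : Measure ℝ} [IsProbabilityMeasure ν] {a b α : ℝ} {z : ℂ}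

lemma eInt_fixedPoint (ν : Measure ℝ) (α : ℝ) (z : ℂ) :
    eInt ν α 0 0 z (fixedPoint ν α z) = ∫ q, gLim ν α q z ∂ν := eInt_zero_zero _ _ _ _

lemma tendsto_neg_mul_gLim (hν : CarriedBy ν a b) (α : ℝ) {q : ℝ} (hq : q ∈ Icc a b) :
    Tendsto (fun k : ℕ => -(((k : ℂ) + 1) * Complex.I) * gLim ν α q (((k : ℂ) + 1) * Complex.I))
      atTop (𝓝 1) := by
  have hz : ∀ k : ℕ, (((k : ℂ) + 1) * Complex.I).im = (k : ℝ) + 1 := fun k => by simp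
  have hz0 : ∀ k : ℕ, 0 < (((k : ℂ) + 1) * Complex.I).im := fun k => by rw [hz]; positivity
  set C := (wLow a α)⁻¹ ^ 2
  have hC : 0 ≤ C := by positivity
  have hle : ∀ k : ℕ, ‖-(((k : ℂ) + 1) * Complex.I) * gLim ν α q (((k : ℂ) + 1) * Complex.I) - 1‖
      ≤ C * (1 / ((k : ℝ) + 1)) := by
    intro k
    have hg := hν.good α (hz0 k)
    set z := ((k : ℂ) + 1) * Complex.I
    have hne : -z - selfE α (fixedPoint ν α z) q ≠ 0 := res_den_ne_zero (hz0 k) (hg q hq)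
    have h1 : -z * gLim ν α q z - 1 = selfE α (fixedPoint ν α z) q * gLim ν α q z := by
      unfold gLim res
      field_simp
      ring
    have h2 : ‖selfE α (fixedPoint ν α z) q‖ ≤ C / z.im := by
      have := norm_selfE_step_le hν (hz0 k) (hg.ae hν) hq
      rwa [(hν.isFixedPoint α (hz0 k)).step_eq] at this
    have h3 : ‖gLim ν α q z‖ ≤ z.im⁻¹ := norm_res_le (hz0 k) (hg q hq)
    rw [h1, norm_mul]
    have h4 : (1 : ℝ) ≤ (k : ℝ) + 1 := by linarith [k.cast_nonneg (α := ℝ)]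
    calc _ ≤ C / z.im * z.im⁻¹ := by
            apply mul_le_mul h2 h3 (norm_nonneg _); rw [hz]; positivity
      _ = C * (1 / ((k : ℝ) + 1)) * ((k : ℝ) + 1)⁻¹ := by rw [hz]; ring
      _ ≤ C * (1 / ((k : ℝ) + 1)) * 1 := by gcongr; exact inv_le_one_of_one_le₀ h4
      _ = _ := mul_one _
  have hlim := (tendsto_one_div_add_atTop_nhds_zero_nat (𝕜 := ℝ)).const_mul C
  rw [mul_zero] at hlim
  exact tendsto_sub_nhds_zero_iff.1 (squeeze_zero_norm hle hlim)

lemma CarriedBy.exists_isLimitSpectrum (hν : CarriedBy ν a b) (α : ℝ) :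
    ∃ π, IsLimitSpectrum ν α π := by
  obtain ⟨π, hπ1, hπ⟩ := (inCauchyHull_integral_gLim hν α).exists_measure
  have hfin : IsFiniteMeasure π := ⟨hπ1.trans_lt ENNReal.one_lt_top⟩
  have hz : ∀ k : ℕ, (((k : ℂ) + 1) * Complex.I).im = (k : ℝ) + 1 := fun k => by simp
  have hz0 : ∀ k : ℕ, 0 < (((k : ℂ) + 1) * Complex.I).im := fun k => by rw [hz]; positivity
  have hnz : ∀ k : ℕ, ‖((k : ℂ) + 1) * Complex.I‖ = (k : ℝ) + 1 := fun k => by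
    rw [norm_mul, Complex.norm_I, mul_one]
    exact_mod_cast Complex.norm_natCast (k + 1)
  -- Both sides of the Cauchy transform identity, multiplied by `-z`, converge along `z = i(k+1)`.
  have h1 : Tendsto (fun k : ℕ => ∫ t : ℝ, -(((k : ℂ) + 1) * Complex.I) *
      ((t : ℂ) - ((k : ℂ) + 1) * Complex.I)⁻¹ ∂π) atTop (𝓝 (∫ _, (1 : ℂ) ∂π)) := by
    refine tendsto_integral_of_dominated_convergence (fun _ => 1) (fun k => ?_)
      (integrable_const _) (fun k => Eventually.of_forall fun t => ?_)
      (Eventually.of_forall fun t => ?_)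
    · exact ((measurable_inv_sub _).const_mul _).aestronglyMeasurable
    · rw [norm_mul, norm_neg, hnz]
      refine (mul_le_mul_of_nonneg_left (norm_inv_sub_le (hz0 k) t) (by positivity)).trans ?_
      rw [hz, mul_inv_cancel₀ (by positivity)]
    · have hle : ∀ k : ℕ, ‖-(((k : ℂ) + 1) * Complex.I) *
          ((t : ℂ) - ((k : ℂ) + 1) * Complex.I)⁻¹ - 1‖ ≤ |t| * (1 / ((k : ℝ) + 1)) := by
        intro k
        have hne : (t : ℂ) - ((k : ℂ) + 1) * Complex.I ≠ 0 := by
          intro h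
          have := congrArg Complex.im h
          simp at this
          have h0 : (0 : ℝ) ≤ k := k.cast_nonneg
          linarith
        rw [show -(((k : ℂ) + 1) * Complex.I) * ((t : ℂ) - ((k : ℂ) + 1) * Complex.I)⁻¹ - 1
          = -(t : ℂ) * ((t : ℂ) - ((k : ℂ) + 1) * Complex.I)⁻¹ by field_simp; ring,
          norm_mul, norm_neg, Complex.norm_real, Real.norm_eq_abs]
        refine mul_le_mul_of_nonneg_left ((norm_inv_sub_le (hz0 k) t).trans (le_of_eq ?_))
          (abs_nonneg _)
        rw [hz, one_div]
      have hlim := (tendsto_one_div_add_atTop_nhds_zero_nat (𝕜 := ℝ)).const_mul |t|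
      rw [mul_zero] at hlim
      exact tendsto_sub_nhds_zero_iff.1 (squeeze_zero_norm hle hlim)
  have h2 : Tendsto (fun k : ℕ => ∫ q, -(((k : ℂ) + 1) * Complex.I) *
      gLim ν α q (((k : ℂ) + 1) * Complex.I) ∂ν) atTop (𝓝 (∫ _, (1 : ℂ) ∂ν)) := by
    refine tendsto_integral_of_dominated_convergence (fun _ => 1) (fun k => ?_)
      (integrable_const _) (fun k => ?_) ?_
    · exact ((measurable_res _ _ _).const_mul _).aestronglyMeasurable
    · filter_upwards [hν.ae_mem] with q hq
      rw [norm_mul, norm_neg, hnz]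
      refine (mul_le_mul_of_nonneg_left (norm_res_le (hz0 k) (hν.good α (hz0 k) q hq))
        (by positivity)).trans ?_
      rw [hz, mul_inv_cancel₀ (by positivity)]
    · filter_upwards [hν.ae_mem] with q hq using tendsto_neg_mul_gLim hν α hq
  have h3 : (∫ _, (1 : ℂ) ∂π) = ∫ _, (1 : ℂ) ∂ν := by
    refine tendsto_nhds_unique h1 (h2.congr fun k => ?_)
    rw [integral_const_mul, integral_const_mul, hπ _ (hz0 k)]
  have hprob : IsProbabilityMeasure π := by
    constructor
    have : π.real univ = 1 := by
      simp only [integral_const, probReal_univ, one_smul] at h3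
      have h4 := congrArg Complex.re h3
      simpa using h4
    rw [measureReal_def] at this
    rw [← ENNReal.ofReal_toReal (measure_ne_top π univ), this, ENNReal.ofReal_one]
  refine ⟨π, hprob, ?_, fun z hz => by rw [eInt_fixedPoint, hπ z hz]⟩
  obtain ⟨h4, h5⟩ := (isSupersolution_const hν α).measure_eq_zero hν hπ
  refine (isCompact_Icc (a := -(2 * (wLow a α)⁻¹)) (b := 2 * (wLow a α)⁻¹)).of_isClosed_subset
    Measure.isClosed_support (Measure.support_subset_of_isClosed isClosed_Icc ?_)
  rw [mem_ae_iff]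
  refine measure_mono_null (fun t ht => ?_) (measure_union_null h4 h5)
  simp only [mem_compl_iff, mem_Icc, not_and_or, not_le] at ht
  exact ht.symm

lemma CarriedBy.isLimitSpectrum (hν : CarriedBy ν a b) (α : ℝ) :
    IsLimitSpectrum ν α (limitSpectrum ν α) :=
  Classical.epsilon_spec (hν.exists_isLimitSpectrum α)

lemma CarriedBy.cauchy_limitSpectrum (hν : CarriedBy ν a b) (α : ℝ) (hz : 0 < z.im) :
    ∫ t : ℝ, ((t : ℂ) - z)⁻¹ ∂(limitSpectrum ν α) = ∫ q, gLim ν α q z ∂ν := by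
  rw [(hν.isLimitSpectrum α).stieltjes z hz, eInt_fixedPoint]

lemma CarriedBy.limitSpectrum_Ioi (hν : CarriedBy ν a b) (α : ℝ) :
    limitSpectrum ν α (Ioi (rightEdge ν α)) = 0 := by
  refine measure_mono_null (fun t (ht : rightEdge ν α < t) => ?_)
    (Measure.measure_compl_support (μ := limitSpectrum ν α))
  exact fun hts => (not_lt.2 (le_csSup (hν.isLimitSpectrum α).compact.bddAbove hts)) ht

/-- The right edge lies below every level that admits a supersolution. -/
lemma IsSupersolution.rightEdge_le (hν : CarriedBy ν a b) {x₀ : ℝ} {h : ℝ → ℝ}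
    (hs : IsSupersolution ν α x₀ h) : rightEdge ν α ≤ x₀ := by
  have := (hν.isLimitSpectrum α).prob
  have h0 := (hs.measure_eq_zero hν (π := limitSpectrum ν α)
    fun z hz => hν.cauchy_limitSpectrum α hz).1
  refine csSup_le (Measure.nonempty_support (IsProbabilityMeasure.ne_zero _)) fun t ht => ?_
  have hsub : (limitSpectrum ν α).support ⊆ Iic x₀ :=
    Measure.support_subset_of_isClosed isClosed_Iic (mem_ae_iff.2 (by rwa [compl_Iic]))
  exact hsub ht

end spectrum

/-! ### Real solutions to the right of the spectrum -/

/-- The (real) value `E₁^α(x)` at a real `x` to the right of the limiting spectrum. -/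
noncomputable def E1Real (μ : Measure ℝ) (α x : ℝ) : ℝ :=
  limUnder (𝓝[>] (0 : ℝ)) fun y : ℝ => (fixedPoint μ α (x + y * Complex.I)).1.re

/-- The denominator `x - q^{1-2α} m + q^{2-2α} l` of the resolvent entry of a node of weight `q` at
the real point `x`, where `(E₁, E₂) = (-m, -l)`. -/
noncomputable def den (α x m l q : ℝ) : ℝ := x - wU α q * m + wV α q * l

section real

variable {ν : Measure ℝ} [IsProbabilityMeasure ν] {a b α : ℝ}

lemma limitSpectrum_im_le (hν : CarriedBy ν a b) {x y : ℝ} (hx : rightEdge ν α < x) (hy : 0 < y) :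
    ∫ q, (gLim ν α q (x + y * Complex.I)).im ∂ν ≤ y / (x - rightEdge ν α) ^ 2 := by
  have := (hν.isLimitSpectrum α).prob
  have hz : 0 < ((x : ℂ) + y * Complex.I).im := by simpa using hy
  rw [← integral_gLim_im hν hz, ← hν.cauchy_limitSpectrum α hz, cauchy_im x hy]
  have hx0 : 0 < x - rightEdge ν α := sub_pos.2 hx
  have hae : ∀ᵐ t ∂(limitSpectrum ν α), t ≤ rightEdge ν α := by
    rw [ae_iff]; simp only [not_le]; exact hν.limitSpectrum_Ioi α
  calc ∫ t, y / ((t - x) ^ 2 + y ^ 2) ∂(limitSpectrum ν α)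
      ≤ ∫ _, y / (x - rightEdge ν α) ^ 2 ∂(limitSpectrum ν α) := by
        refine integral_mono_ae (integrable_im_kernel x hy) (integrable_const _)
          (hae.mono fun t ht => ?_)
        apply div_le_div_of_nonneg_left hy.le (by positivity)
        nlinarith
    _ = _ := by simp

/-- The spectral measures `ρ q` of the individual nodes have no mass to the right of the limiting
spectrum, for almost every weight `q`: their average over `q` has the Cauchy transform of the
limiting spectrum, whose imaginary part vanishes linearly there. The mass `ρ q` of an interval is
not assumed to be measurable in `q`, so Markov's inequality is applied to the sums of
`measureReal_Icc_le_sum`. -/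
lemma ae_nodeMeasure_Ioi (hν : CarriedBy ν a b) {ρ : ℝ → Measure ℝ}
    (hρ1 : ∀ q ∈ Icc a b, ρ q univ ≤ 1)
    (hρ : ∀ q ∈ Icc a b, ∀ z : ℂ, 0 < z.im → ∫ t : ℝ, ((t : ℂ) - z)⁻¹ ∂(ρ q) = gLim ν α q z) :
    ∀ᵐ q ∂ν, ρ q (Ioi (rightEdge ν α)) = 0 := by
  set S := rightEdge ν α
  have key : ∀ x₁ x₂ : ℝ, S < x₁ → x₁ < x₂ → ∀ᵐ q ∂ν, ρ q (Icc x₁ x₂) = 0 := by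
    intro x₁ x₂ h1 h12
    have hε : ∀ m : ℕ, ν {q | q ∈ Icc a b ∧ 1 / ((m : ℝ) + 1) ≤ (ρ q).real (Icc x₁ x₂)} = 0 := by
      intro m
      set ε : ℝ := 1 / ((m : ℝ) + 1)
      have hε0 : 0 < ε := by positivity
      have hbd : ∀ N : ℕ, ν.real {q | q ∈ Icc a b ∧ ε ≤ (ρ q).real (Icc x₁ x₂)} ≤
          (x₂ - x₁) ^ 2 / (2 * (x₁ - S) ^ 2 * ε) * ((N : ℝ) + 1)⁻¹ := by
        intro N
        set y := (x₂ - x₁) / (2 * ((N + 1 : ℕ) : ℝ)) with hy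
        have hy0 : 0 < y := div_pos (by linarith) (by positivity)
        have hz : ∀ c : ℝ, 0 < ((c : ℂ) + y * Complex.I).im := fun c => by simpa using hy0
        let φ : ℝ → ℝ := fun q => ∑ j ∈ Finset.range (N + 1),
          2 * y * (gLim ν α q ((x₁ + (2 * j + 1) * y : ℝ) + y * Complex.I)).im
        have hφi : ∀ j ∈ Finset.range (N + 1), Integrable (fun q =>
            2 * y * (gLim ν α q ((x₁ + (2 * j + 1) * y : ℝ) + y * Complex.I)).im) ν := fun j _ =>
          ((integrable_gLim hν α (hz _)).im).const_mul _
        have hφint : ∫ q, φ q ∂ν ≤ (x₂ - x₁) * y / (x₁ - S) ^ 2 := by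
          have hx0 : 0 < x₁ - S := sub_pos.2 h1
          rw [integral_finsetSum _ hφi]
          calc _ ≤ ∑ j ∈ Finset.range (N + 1), 2 * y * (y / (x₁ - S) ^ 2) := by
                refine Finset.sum_le_sum fun j _ => ?_
                rw [integral_const_mul]
                refine mul_le_mul_of_nonneg_left ?_ (by positivity)
                have hxj : x₁ ≤ x₁ + (2 * j + 1) * y := by
                  have : (0 : ℝ) ≤ (2 * j + 1) * y := by positivity
                  linarith
                refine (limitSpectrum_im_le hν (h1.trans_le hxj) hy0).trans ?_
                apply div_le_div_of_nonneg_left hy0.le (by positivity)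
                have : x₁ - S ≤ x₁ + (2 * j + 1) * y - S := by linarith
                gcongr
            _ = _ := by
                rw [Finset.sum_const, Finset.card_range, nsmul_eq_mul]
                have : (x₂ - x₁) = ((N + 1 : ℕ) : ℝ) * (2 * y) := by rw [hy]; field_simp
                rw [this]; ring
        have hφ0 : 0 ≤ᵐ[ν] φ := hν.ae_mem.mono fun q hq => Finset.sum_nonneg fun j _ =>
          mul_nonneg (by positivity) (res_im_pos (hz _) (hν.good α (hz _) q hq)).le
        have hmarkov := mul_meas_ge_le_integral_of_nonneg hφ0 (integrable_finsetSum _ hφi) ε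
        have hsub : {q | q ∈ Icc a b ∧ ε ≤ (ρ q).real (Icc x₁ x₂)} ⊆ {q | ε ≤ φ q} := by
          rintro q ⟨hq, hle⟩
          have : IsFiniteMeasure (ρ q) := ⟨(hρ1 q hq).trans_lt ENNReal.one_lt_top⟩
          refine hle.trans ((measureReal_Icc_le_sum h12 N.succ_pos).trans (le_of_eq ?_))
          refine Finset.sum_congr rfl fun j _ => ?_
          rw [hρ q hq _ (by rw [add_mul_I_im]; exact hy0)]
        have h3 := (mul_le_mul_of_nonneg_left (measureReal_mono (μ := ν) hsub) hε0.le).trans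
          (hmarkov.trans hφint)
        rw [← le_div_iff₀' hε0] at h3
        refine h3.trans (le_of_eq ?_)
        rw [hy]
        push_cast
        have hx0 : x₁ - S ≠ 0 := (sub_pos.2 h1).ne'
        field_simp
      have hlim : Tendsto (fun N : ℕ => (x₂ - x₁) ^ 2 / (2 * (x₁ - S) ^ 2 * ε) * ((N : ℝ) + 1)⁻¹)
          atTop (𝓝 0) := by
        have := tendsto_one_div_add_atTop_nhds_zero_nat (𝕜 := ℝ)
        simp only [one_div] at this
        simpa using this.const_mul ((x₂ - x₁) ^ 2 / (2 * (x₁ - S) ^ 2 * ε))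
      exact (measureReal_eq_zero_iff (measure_ne_top _ _)).1
        (le_antisymm (ge_of_tendsto' hlim hbd) measureReal_nonneg)
    have hall := measure_iUnion_null hε
    filter_upwards [hν.ae_mem, mem_ae_iff.2 (by rwa [compl_compl] : ν (⋃ m : ℕ, {q | q ∈ Icc a b ∧
      1 / ((m : ℝ) + 1) ≤ (ρ q).real (Icc x₁ x₂)})ᶜᶜ = 0)] with q hq hnot
    have : IsFiniteMeasure (ρ q) := ⟨(hρ1 q hq).trans_lt ENNReal.one_lt_top⟩
    by_contra hne
    have hpos : 0 < (ρ q).real (Icc x₁ x₂) :=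
      lt_of_le_of_ne measureReal_nonneg
        fun h => hne ((measureReal_eq_zero_iff (measure_ne_top _ _)).1 h.symm)
    obtain ⟨m, hm⟩ := exists_nat_one_div_lt hpos
    exact hnot (mem_iUnion.2 ⟨m, hq, hm.le⟩)
  have hall := ae_all_iff.2 fun n : ℕ => key (S + 1 / ((n : ℝ) + 1)) (S + ((n : ℝ) + 2))
    (by have : (0 : ℝ) < 1 / ((n : ℝ) + 1) := by positivity
        linarith) (by linarith [one_div_lt_add_two n])
  exact hall.mono fun q hq => measure_Ioi_eq_zero_of_Icc hq

/-- To the right of its support, a Cauchy transform has boundary values `-h x` with `h` nonnegative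
and decreasing. -/
lemma exists_boundary_value {ρ : Measure ℝ} {S : ℝ} (hρ1 : ρ univ ≤ 1) (hρS : ρ (Ioi S) = 0) :
    ∃ h : ℝ → ℝ, (∀ x, S < x → Tendsto (fun y : ℝ => ∫ t : ℝ, ((t : ℂ) - (x + y * Complex.I))⁻¹ ∂ρ)
        (𝓝[>] 0) (𝓝 (-(h x : ℂ)))) ∧ (∀ x, S < x → 0 ≤ h x) ∧ (∀ x, S < x → h x ≤ (x - S)⁻¹) ∧
      (∀ x x', S < x → x ≤ x' → h x' ≤ h x) ∧
      ∀ x, S < x → ∀ y : ℝ, ‖∫ t : ℝ, ((t : ℂ) - (x + y * Complex.I))⁻¹ ∂ρ‖ ≤ (x - S)⁻¹ := by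
  have hfin : IsFiniteMeasure ρ := ⟨hρ1.trans_lt ENNReal.one_lt_top⟩
  have hreal : ρ.real univ ≤ 1 := ENNReal.toReal_mono ENNReal.one_ne_top hρ1
  have hae : ∀ᵐ t ∂ρ, t ≤ S := by
    rw [ae_iff]; simp only [not_le]; exact hρS
  have hnorm : ∀ x, S < x → ∀ y : ℝ, ∀ᵐ t : ℝ ∂ρ,
      ‖((t : ℂ) - (x + y * Complex.I))⁻¹‖ ≤ (x - S)⁻¹ := by
    intro x hx y
    filter_upwards [hae] with t ht
    rw [norm_inv]
    apply inv_anti₀ (sub_pos.2 hx)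
    refine le_trans ?_ (Complex.abs_re_le_norm _)
    refine le_trans ?_ (neg_le_abs _)
    simp
    linarith
  have hinv : ∀ x, S < x → ∀ᵐ t ∂ρ, 0 ≤ (x - t)⁻¹ ∧ (x - t)⁻¹ ≤ (x - S)⁻¹ := by
    intro x hx
    filter_upwards [hae] with t ht
    exact ⟨inv_nonneg.2 (by linarith), inv_anti₀ (sub_pos.2 hx) (by linarith)⟩
  have hint : ∀ x, S < x → Integrable (fun t => (x - t)⁻¹) ρ := fun x hx =>
    Integrable.of_bound (by fun_prop) (x - S)⁻¹ ((hinv x hx).mono fun t ht => by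
      rw [Real.norm_of_nonneg ht.1]; exact ht.2)
  have hS0 : ∀ x, S < x → (0 : ℝ) ≤ (x - S)⁻¹ := fun x hx => inv_nonneg.2 (sub_pos.2 hx).le
  refine ⟨fun x => ∫ t, (x - t)⁻¹ ∂ρ, fun x hx => ?_, fun x hx => ?_, fun x hx => ?_,
    fun x x' hx hxx => ?_, fun x hx y => ?_⟩
  · have h1 : (-((∫ t, (x - t)⁻¹ ∂ρ : ℝ) : ℂ)) = ∫ t : ℝ, ((t : ℂ) - x)⁻¹ ∂ρ := by
      rw [← integral_complex_ofReal, ← integral_neg]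
      refine integral_congr_ae (Eventually.of_forall fun t => ?_)
      simp only
      push_cast
      rw [← neg_sub (x : ℂ) t, inv_neg]
    rw [h1]
    refine tendsto_integral_filter_of_dominated_convergence (fun _ => (x - S)⁻¹)
      (Eventually.of_forall fun y => (measurable_inv_sub _).aestronglyMeasurable)
      (Eventually.of_forall fun y => hnorm x hx y) (integrable_const _) ?_
    filter_upwards [hae] with t ht
    have hne : (t : ℂ) - x ≠ 0 := by
      rw [← Complex.ofReal_sub]
      exact_mod_cast (by linarith : t - x < 0).ne
    refine Tendsto.mono_left ?_ nhdsWithin_le_nhds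
    have hc : ContinuousAt (fun y : ℝ => ((t : ℂ) - (x + y * Complex.I))⁻¹) 0 := by
      refine ContinuousAt.inv₀ (by fun_prop) ?_
      simpa using hne
    simpa [ContinuousAt] using hc
  · exact integral_nonneg_of_ae ((hinv x hx).mono fun t ht => ht.1)
  · refine (integral_mono_ae (hint x hx) (integrable_const _)
      ((hinv x hx).mono fun t ht => ht.2)).trans ?_
    rw [integral_const, smul_eq_mul]
    exact mul_le_of_le_one_left (hS0 x hx) hreal
  · refine integral_mono_ae (hint x' (hx.trans_le hxx)) (hint x hx) ?_
    filter_upwards [hae] with t ht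
    exact inv_anti₀ (by linarith) (by linarith)
  · refine (norm_integral_le_of_norm_le_const (hnorm x hx y)).trans ?_
    exact mul_le_of_le_one_right (hS0 x hx) hreal

/-- For almost every weight, the resolvent entries have nonnegative decreasing boundary values to
the right of the spectrum. -/
lemma exists_boundary_gLim (hν : CarriedBy ν a b) (α : ℝ) :
    ∃ h : ℝ → ℝ → ℝ, ∀ᵐ q ∂ν,
      (∀ x, rightEdge ν α < x → Tendsto (fun y : ℝ => gLim ν α q (x + y * Complex.I))
        (𝓝[>] 0) (𝓝 (-(h x q : ℂ)))) ∧
      (∀ x, rightEdge ν α < x → 0 ≤ h x q) ∧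
      (∀ x, rightEdge ν α < x → h x q ≤ (x - rightEdge ν α)⁻¹) ∧
      (∀ x x', rightEdge ν α < x → x ≤ x' → h x' q ≤ h x q) ∧
      ∀ x, rightEdge ν α < x → ∀ y : ℝ, 0 < y →
        ‖gLim ν α q (x + y * Complex.I)‖ ≤ (x - rightEdge ν α)⁻¹ := by
  classical
  have h1 : ∀ q, ∃ ρ : Measure ℝ, q ∈ Icc a b → (ρ univ ≤ 1 ∧ ∀ z : ℂ, 0 < z.im →
      ∫ t : ℝ, ((t : ℂ) - z)⁻¹ ∂ρ = gLim ν α q z) := by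
    intro q
    by_cases hq : q ∈ Icc a b
    · obtain ⟨ρ, hρ⟩ := (inCauchyHull_gLim hν α hq).exists_measure
      exact ⟨ρ, fun _ => hρ⟩
    · exact ⟨0, fun h => absurd h hq⟩
  choose ρ hρ using h1
  have hae := ae_nodeMeasure_Ioi (α := α) hν (ρ := ρ) (fun q hq => (hρ q hq).1)
    fun q hq => (hρ q hq).2
  have h2 : ∀ q, ∃ h : ℝ → ℝ, q ∈ Icc a b → ρ q (Ioi (rightEdge ν α)) = 0 →
      (∀ x, rightEdge ν α < x → Tendsto (fun y : ℝ => gLim ν α q (x + y * Complex.I))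
        (𝓝[>] 0) (𝓝 (-(h x : ℂ)))) ∧
      (∀ x, rightEdge ν α < x → 0 ≤ h x) ∧
      (∀ x, rightEdge ν α < x → h x ≤ (x - rightEdge ν α)⁻¹) ∧
      (∀ x x', rightEdge ν α < x → x ≤ x' → h x' ≤ h x) ∧
      ∀ x, rightEdge ν α < x → ∀ y : ℝ, 0 < y →
        ‖gLim ν α q (x + y * Complex.I)‖ ≤ (x - rightEdge ν α)⁻¹ := by
    intro q
    by_cases hq : q ∈ Icc a b ∧ ρ q (Ioi (rightEdge ν α)) = 0
    · obtain ⟨h, ht, h0, hle, hanti, hnorm⟩ := exists_boundary_value (hρ q hq.1).1 hq.2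
      have hz : ∀ x y : ℝ, 0 < y → 0 < ((x : ℂ) + y * Complex.I).im := fun x y hy => by
        simpa using hy
      refine ⟨h, fun _ _ => ⟨fun x hx => ?_, h0, hle, hanti, fun x hx y hy => ?_⟩⟩
      · refine (ht x hx).congr' ?_
        filter_upwards [self_mem_nhdsWithin] with y hy
        exact (hρ q hq.1).2 _ (hz x y hy)
      · rw [← (hρ q hq.1).2 _ (hz x y hy)]
        exact hnorm x hx y
    · exact ⟨0, fun h h' => absurd ⟨h, h'⟩ hq⟩
  choose h hh using h2
  refine ⟨fun x q => h q x, ?_⟩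
  filter_upwards [hν.ae_mem, hae] with q hq hq'
  exact hh q hq hq'

/-- To the right of the spectrum, `(E₁, E₂)` has real boundary values, and the resolvent entries
there are `-1 / den` with `den` bounded below by the distance to the spectrum. -/
lemma real_solution (hν : CarriedBy ν a b) (α : ℝ) :
    (∀ x, rightEdge ν α < x →
      Tendsto (fun y : ℝ => fixedPoint ν α (x + y * Complex.I)) (𝓝[>] 0)
        (𝓝 ((E1Real ν α x : ℂ), (E2Real ν α x : ℂ))) ∧
      (∀ᵐ q ∂ν, x - rightEdge ν α ≤ den α x (-E1Real ν α x) (-E2Real ν α x) q) ∧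
      -E1Real ν α x = ∫ q, wU α q * (den α x (-E1Real ν α x) (-E2Real ν α x) q)⁻¹ ∂ν ∧
      -E2Real ν α x = ∫ q, wV α q * (den α x (-E1Real ν α x) (-E2Real ν α x) q)⁻¹ ∂ν) ∧
    MonotoneOn (E2Real ν α) (Ioi (rightEdge ν α)) := by
  obtain ⟨h, hh⟩ := exists_boundary_gLim hν α
  set S := rightEdge ν α
  have hpos : ∀ᶠ y : ℝ in 𝓝[>] 0, 0 < y := self_mem_nhdsWithin
  have hz : ∀ x y : ℝ, 0 < y → 0 < ((x : ℂ) + y * Complex.I).im := fun x y hy => by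
    simpa using hy
  have hmeas : ∀ x, S < x → AEStronglyMeasurable (h x) ν := by
    intro x hx
    have h1 : AEStronglyMeasurable (fun q => (-(h x q : ℂ))) ν :=
      aestronglyMeasurable_of_tendsto_ae (𝓝[>] (0 : ℝ))
        (f := fun (y : ℝ) q => gLim ν α q (x + y * Complex.I))
        (fun y => (measurable_res α _ _).aestronglyMeasurable) (hh.mono fun q hq => hq.1 x hx)
    have h2 := (Complex.continuous_re.comp_aestronglyMeasurable h1).neg
    exact h2.congr (Eventually.of_forall fun q => by simp)
  have hint : ∀ x, S < x → Integrable (h x) ν := fun x hx =>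
    Integrable.of_bound (hmeas x hx) (x - S)⁻¹ (hh.mono fun q hq => by
      rw [Real.norm_of_nonneg (hq.2.1 x hx)]; exact hq.2.2.1 x hx)
  have hlim : ∀ x, S < x → ∀ f : ℝ → ℝ, Measurable f → ∀ C : ℝ, (∀ q ∈ Icc a b, |f q| ≤ C) →
      Tendsto (fun y : ℝ => ∫ q, (f q : ℂ) * gLim ν α q (x + y * Complex.I) ∂ν) (𝓝[>] 0)
        (𝓝 ((-∫ q, f q * h x q ∂ν : ℝ) : ℂ)) := by
    intro x hx f hf C hC
    have h1 : ((-∫ q, f q * h x q ∂ν : ℝ) : ℂ) = ∫ q, (f q : ℂ) * (-(h x q : ℂ)) ∂ν := by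
      rw [← integral_neg, ← integral_complex_ofReal]
      refine integral_congr_ae (Eventually.of_forall fun q => ?_)
      push_cast; ring
    rw [h1]
    refine tendsto_integral_filter_of_dominated_convergence (fun _ => C * (x - S)⁻¹)
      (Eventually.of_forall fun y => ?_) (hpos.mono fun y hy => ?_) (integrable_const _) ?_
    · exact (hf.complex_ofReal.mul (measurable_res α _ _)).aestronglyMeasurable
    · filter_upwards [hν.ae_mem, hh] with q hq hhq
      rw [norm_mul, Complex.norm_real, Real.norm_eq_abs]
      exact mul_le_mul (hC q hq) (hhq.2.2.2.2 x hx y hy) (norm_nonneg _)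
        ((abs_nonneg _).trans (hC q hq))
    · filter_upwards [hh] with q hq
      exact (hq.1 x hx).const_mul _
  have hfix : ∀ x, S < x → Tendsto (fun y : ℝ => fixedPoint ν α (x + y * Complex.I)) (𝓝[>] 0)
      (𝓝 (((-∫ q, wU α q * h x q ∂ν : ℝ) : ℂ), ((-∫ q, wV α q * h x q ∂ν : ℝ) : ℂ))) := by
    intro x hx
    have h1 := hlim x hx (wU α) (by fun_prop) (wLow a α)⁻¹ fun q hq => by
      rw [abs_of_pos (wU_pos (hν.pos.trans_le hq.1))]
      exact wU_le hν.pos hq.1 (hq.2.trans hν.lt_one.le)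
    have h2 := hlim x hx (wV α) (by fun_prop) (wLow a α)⁻¹ fun q hq => by
      rw [abs_of_pos (wV_pos (hν.pos.trans_le hq.1))]
      exact wV_le hν.pos hq.1 (hq.2.trans hν.lt_one.le)
    refine (h1.prodMk_nhds h2).congr' (hpos.mono fun y hy => ?_)
    exact (hν.isFixedPoint α (hz x y hy)).step_eq
  have hE1 : ∀ x, S < x → E1Real ν α x = -∫ q, wU α q * h x q ∂ν := fun x hx => by
    have := ((Complex.continuous_re.comp continuous_fst).tendsto _).comp (hfix x hx)
    exact this.limUnder_eq
  have hE2 : ∀ x, S < x → E2Real ν α x = -∫ q, wV α q * h x q ∂ν := fun x hx => by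
    have := ((Complex.continuous_re.comp continuous_snd).tendsto _).comp (hfix x hx)
    exact this.limUnder_eq
  have hden : ∀ x, S < x → ∀ᵐ q ∂ν,
      h x q * den α x (-E1Real ν α x) (-E2Real ν α x) q = 1 := by
    intro x hx
    filter_upwards [hh, hν.ae_mem] with q hq hqm
    have h1 : Tendsto (fun y : ℝ => gLim ν α q (x + y * Complex.I) * (-((x : ℂ) + y * Complex.I) -
        selfE α (fixedPoint ν α (x + y * Complex.I)) q)) (𝓝[>] 0)
        (𝓝 (-(h x q : ℂ) * (-((x : ℂ) + (0 : ℝ) * Complex.I) -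
          selfE α ((E1Real ν α x : ℂ), (E2Real ν α x : ℂ)) q))) := by
      refine (hq.1 x hx).mul (Tendsto.sub ?_ ?_)
      · have : Continuous fun y : ℝ => -((x : ℂ) + y * Complex.I) := by fun_prop
        exact (this.tendsto 0).mono_left nhdsWithin_le_nhds
      · rw [hE1 x hx, hE2 x hx]
        exact ((continuous_selfE α q).tendsto _).comp (hfix x hx)
    have h2 : Tendsto (fun y : ℝ => gLim ν α q (x + y * Complex.I) * (-((x : ℂ) + y * Complex.I) -
        selfE α (fixedPoint ν α (x + y * Complex.I)) q)) (𝓝[>] 0) (𝓝 1) := by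
      refine tendsto_const_nhds.congr' (hpos.mono fun y hy => ?_)
      exact (inv_mul_cancel₀ (res_den_ne_zero (hz x y hy) (hν.good α (hz x y hy) q hqm))).symm
    have h3 := tendsto_nhds_unique h1 h2
    have h4 : ((h x q * den α x (-E1Real ν α x) (-E2Real ν α x) q : ℝ) : ℂ) = 1 := by
      rw [← h3]
      unfold den selfE
      push_cast
      ring
    exact_mod_cast h4
  have hinv : ∀ x, S < x → ∀ᵐ q ∂ν,
      h x q = (den α x (-E1Real ν α x) (-E2Real ν α x) q)⁻¹ := fun x hx =>
    (hden x hx).mono fun q hq => eq_inv_of_mul_eq_one_left hq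
  refine ⟨fun x hx => ⟨?_, ?_, ?_, ?_⟩, ?_⟩
  · rw [hE1 x hx, hE2 x hx]; exact hfix x hx
  · filter_upwards [hden x hx, hh] with q hq hhq
    have h0 := hhq.2.1 x hx
    have h1 : 0 < h x q := lt_of_le_of_ne h0 fun h => by rw [← h, zero_mul] at hq; simp at hq
    have h2 := hhq.2.2.1 x hx
    rw [eq_inv_of_mul_eq_one_right hq]
    exact (le_inv_comm₀ h1 (sub_pos.2 hx)).1 h2
  · exact (neg_eq_iff_eq_neg.2 (hE1 x hx)).trans
      (integral_congr_ae ((hinv x hx).mono fun q hq => congrArg (wU α q * ·) hq))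
  · exact (neg_eq_iff_eq_neg.2 (hE2 x hx)).trans
      (integral_congr_ae ((hinv x hx).mono fun q hq => congrArg (wV α q * ·) hq))
  · intro x hx x' hx' hxx
    rw [hE2 x hx, hE2 x' hx', neg_le_neg_iff]
    refine integral_mono_ae (hν.integrable_wV_mul α (hint x' hx'))
      (hν.integrable_wV_mul α (hint x hx)) ?_
    filter_upwards [hh, hν.ae_mem] with q hq hqm
    exact mul_le_mul_of_nonneg_left (hq.2.2.2.1 x x' hx hxx) (wV_pos (hν.pos.trans_le hqm.1)).le

end real

/-! ### The solution at the edge -/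

/-- `(m, l) = (-E₁, -E₂)` solves, up to a loss of mass, the self-consistent equation at the real
level `x`: the second field is the inequality `∫ wU p (1 - q p) / den p ≤ m - q l`, which as an
equality for all `q` is the equation itself, with the denominator truncated from below so that it
survives weak limits. The third field is implied by the equation and is retained in the limit; it
is what determines `l` when `ν` is a point mass. -/
structure RelaxedSolution (ν : Measure ℝ) (α x m l : ℝ) : Prop where
  den_nonneg : ∀ᵐ q ∂ν, 0 ≤ den α x m l q
  integral_le : ∀ η : ℝ, 0 < η → ∀ q ∈ Icc (0 : ℝ) 1,
    ∫ p, wU α p * (1 - q * p) * (max (den α x m l p) η)⁻¹ ∂ν ≤ m - q * l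
  ratio : ∀ a b, CarriedBy ν a b → a * m ≤ l ∧ l ≤ b * m

@[fun_prop] lemma measurable_den (α x m l : ℝ) : Measurable (den α x m l) := by
  unfold den; fun_prop

lemma den_eq {α x m l q : ℝ} (hq : 0 < q) : den α x m l q = x - wU α q * (m - q * l) := by
  unfold den; rw [wV_eq hq]; ring

section edge

variable {ν : Measure ℝ} [IsProbabilityMeasure ν] {a b α : ℝ}

lemma integrable_truncated (hν : CarriedBy ν a b) {x m l η q : ℝ} (hη : 0 < η)
    (hq : q ∈ Icc (0 : ℝ) 1) :
    Integrable (fun p => wU α p * (1 - q * p) * (max (den α x m l p) η)⁻¹) ν := by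
  refine hν.integrable (by fun_prop) (C := (wLow a α)⁻¹ * 1 * η⁻¹) fun p hp => ?_
  have hp' := hν.Icc_subset hp
  have h0 := wU_pos (α := α) hp'.1
  have h2 : q * p ≤ 1 := by nlinarith [hq.1, hq.2, hp'.1, hp'.2]
  have h3 : 0 ≤ q * p := mul_nonneg hq.1 hp'.1.le
  have h4 : 0 < max (den α x m l p) η := lt_max_of_lt_right hη
  rw [Real.norm_of_nonneg (mul_nonneg (mul_nonneg h0.le (by linarith)) (inv_nonneg.2 h4.le))]
  have h5 := wU_le (α := α) hν.pos hp.1 hp'.2.le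
  have h6 : (max (den α x m l p) η)⁻¹ ≤ η⁻¹ := inv_anti₀ hη (le_max_right _ _)
  have h7 : 1 - q * p ≤ 1 := by linarith
  have h8 : 0 ≤ 1 - q * p := by linarith
  have h9 : 0 ≤ (wLow a α)⁻¹ := h0.le.trans h5
  gcongr

lemma RelaxedSolution.nonneg {ν : Measure ℝ} {x m l : ℝ} (h : RelaxedSolution ν α x m l)
    (hν : CarriedBy ν a b) : 0 ≤ m := by
  have h1 := h.integral_le 1 one_pos 0 (by simp)
  rw [zero_mul, sub_zero] at h1
  refine le_trans (integral_nonneg_of_ae (hν.ae_mem.mono fun p hp => ?_)) h1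
  have h0 := wU_pos (α := α) (hν.pos.trans_le hp.1)
  simp only [zero_mul, sub_zero, mul_one, Pi.zero_apply]
  positivity

lemma RelaxedSolution.le_div {x m l : ℝ} (h : RelaxedSolution ν α x m l) (hν : CarriedBy ν a b) :
    m ≤ x / (wLow a α * (1 - b ^ 2)) := by
  obtain ⟨q, hd, hq⟩ := (h.den_nonneg.and hν.ae_mem).exists
  have hq' := hν.Icc_subset hq
  have hb0 : 0 < b := hq'.1.trans_le hq.2
  have hb1 : 0 < 1 - b ^ 2 := by nlinarith [hν.lt_one]
  have hL := wLow_pos (α := α) hν.pos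
  have hm := h.nonneg hν
  rw [le_div_iff₀ (by positivity)]
  rw [den_eq hq'.1] at hd
  have h1 := (h.ratio a b hν).2
  have h2 : q * l ≤ b ^ 2 * m := by
    have h3 : b * (b * m) = b ^ 2 * m := by ring
    rw [← h3]
    have h4 : 0 ≤ l := le_trans (mul_nonneg hν.pos.le hm) (h.ratio a b hν).1
    exact mul_le_mul hq.2 h1 h4 hb0.le
  have h5 : 0 ≤ m * (1 - b ^ 2) := mul_nonneg hm hb1.le
  have h6 := wLow_le_wU (α := α) hν.pos hq.1 hq'.2.le
  calc m * (wLow a α * (1 - b ^ 2)) = wLow a α * (m * (1 - b ^ 2)) := by ring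
    _ ≤ wU α q * (m * (1 - b ^ 2)) := by gcongr
    _ ≤ wU α q * (m - q * l) := by
        apply mul_le_mul_of_nonneg_left _ (wU_pos hq'.1).le
        linarith
    _ ≤ x := by linarith

/-- A relaxed solution has a positive denominator, whose inverse is a supersolution. -/
lemma RelaxedSolution.isSupersolution {x m l : ℝ} (h : RelaxedSolution ν α x m l)
    (hν : CarriedBy ν a b) :
    (∀ᵐ q ∂ν, 0 < den α x m l q) ∧ IsSupersolution ν α x fun q => (den α x m l q)⁻¹ := by
  have hL := wLow_pos (α := α) hν.pos
  let f : ℕ → ℝ → ℝ := fun k p => (max (den α x m l p) (1 / ((k : ℝ) + 1)))⁻¹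
  have hη : ∀ k : ℕ, (0 : ℝ) < 1 / ((k : ℝ) + 1) := fun k => by positivity
  have hf0 : ∀ k p, 0 ≤ f k p := fun k p =>
    inv_nonneg.2 ((hη k).le.trans (le_max_right _ _))
  have hfm : ∀ k, Measurable (f k) := fun k => by fun_prop
  have hfi : ∀ k, Integrable (f k) ν := fun k =>
    Integrable.of_bound (hfm k).aestronglyMeasurable (1 / ((k : ℝ) + 1))⁻¹
      (Eventually.of_forall fun p => by
        rw [Real.norm_of_nonneg (hf0 k p)]
        exact inv_anti₀ (hη k) (le_max_right _ _))
  have hfB : ∀ k, ∫ p, f k p ∂ν ≤ m / wLow a α := by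
    intro k
    rw [le_div_iff₀' hL, ← integral_const_mul]
    refine le_trans ?_ ((h.integral_le _ (hη k) 0 (by simp)).trans (by simp))
    refine integral_mono_ae ((hfi k).const_mul _) (integrable_truncated hν (hη k) (by simp))
      (hν.ae_mem.mono fun p hp => ?_)
    have h1 := wLow_le_wU (α := α) hν.pos hp.1 (hν.Icc_subset hp).2.le
    simp only [zero_mul, sub_zero, mul_one]
    exact mul_le_mul_of_nonneg_right h1 (hf0 k p)
  have hpos : ∀ᵐ q ∂ν, 0 < den α x m l q := by
    have hbd : ∀ k : ℕ, ν.real {q | den α x m l q ≤ 0} ≤ m / wLow a α * (1 / ((k : ℝ) + 1)) := by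
      intro k
      have hmarkov := mul_meas_ge_le_integral_of_nonneg
        (Eventually.of_forall (hf0 k)) (hfi k) ((k : ℝ) + 1)
      have hsub : {q | den α x m l q ≤ 0} ⊆ {q | (k : ℝ) + 1 ≤ f k q} := by
        intro q (hq : den α x m l q ≤ 0)
        change (k : ℝ) + 1 ≤ (max (den α x m l q) (1 / ((k : ℝ) + 1)))⁻¹
        rw [max_eq_right (hq.trans (hη k).le), one_div, inv_inv]
      have hk : (0 : ℝ) < (k : ℝ) + 1 := by positivity
      have h3 := (mul_le_mul_of_nonneg_left (measureReal_mono (μ := ν) hsub) hk.le).trans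
        (hmarkov.trans (hfB k))
      rw [mul_one_div, le_div_iff₀' hk]
      exact h3
    have hlim := (tendsto_one_div_add_atTop_nhds_zero_nat (𝕜 := ℝ)).const_mul (m / wLow a α)
    rw [mul_zero] at hlim
    have h0 := (measureReal_eq_zero_iff (measure_ne_top _ _)).1
      (le_antisymm (ge_of_tendsto' hlim hbd) measureReal_nonneg)
    rw [ae_iff]
    simpa only [not_lt] using h0
  have hfle : ∀ k, ∀ᵐ p ∂ν, f k p ≤ (den α x m l p)⁻¹ := fun k =>
    hpos.mono fun p hp => inv_anti₀ hp (le_max_left _ _)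
  have hft : ∀ᵐ p ∂ν, Tendsto (fun k => f k p) atTop (𝓝 (den α x m l p)⁻¹) := by
    filter_upwards [hpos] with p hp
    refine tendsto_const_nhds.congr' ?_
    obtain ⟨n, hn⟩ := exists_nat_one_div_lt hp
    filter_upwards [eventually_ge_atTop n] with k hk
    have h1 : 1 / ((k : ℝ) + 1) ≤ 1 / ((n : ℝ) + 1) := by
      apply one_div_le_one_div_of_le (by positivity)
      have : (n : ℝ) ≤ k := by exact_mod_cast hk
      linarith
    change _ = (max _ _)⁻¹
    rw [max_eq_left (h1.trans hn.le)]
  have hint : Integrable (fun q => (den α x m l q)⁻¹) ν := by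
    refine ⟨by fun_prop, ?_⟩
    rw [hasFiniteIntegral_iff_ofReal (hpos.mono fun p hp => (inv_pos.2 hp).le)]
    have hmono : ∀ᵐ p ∂ν, Monotone fun k => ENNReal.ofReal (f k p) := by
      refine Eventually.of_forall fun p i j hij => ENNReal.ofReal_le_ofReal ?_
      refine inv_anti₀ ((hη j).trans_le (le_max_right _ _)) (max_le_max le_rfl ?_)
      apply one_div_le_one_div_of_le (by positivity)
      have : (i : ℝ) ≤ j := by exact_mod_cast hij
      linarith
    have := lintegral_tendsto_of_tendsto_of_monotone
      (fun k => (hfm k).ennreal_ofReal.aemeasurable) hmono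
      (hft.mono fun p hp => (ENNReal.continuous_ofReal.tendsto _).comp hp)
    refine lt_of_le_of_lt (le_of_tendsto' this fun k => ?_)
      (ENNReal.ofReal_lt_top (r := m / wLow a α))
    rw [← ofReal_integral_eq_lintegral_ofReal (hfi k) (Eventually.of_forall (hf0 k))]
    exact ENNReal.ofReal_le_ofReal (hfB k)
  refine ⟨hpos, hint, hpos.mono fun q hq => inv_pos.2 hq, ?_⟩
  filter_upwards [hν.ae_mem] with q hq
  have hq' := hν.Icc_subset hq
  rw [inv_inv]
  have hlim : Tendsto (fun k => ∫ p, kern α q p * f k p ∂ν) atTop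
      (𝓝 (∫ p, kern α q p * (den α x m l p)⁻¹ ∂ν)) := by
    refine tendsto_integral_of_dominated_convergence
      (fun p => kern α q p * (den α x m l p)⁻¹)
      (fun k => ((measurable_kern α q).mul (hfm k)).aestronglyMeasurable)
      (hν.integrable_kern_mul α q hint) (fun k => ?_) ?_
    · filter_upwards [hfle k, hν.ae_mem] with p hp hpm
      have hk0 := (kern_pos (α := α) hq' (hν.Icc_subset hpm)).le
      rw [Real.norm_of_nonneg (mul_nonneg hk0 (hf0 k p))]
      exact mul_le_mul_of_nonneg_left hp hk0
    · filter_upwards [hft] with p hp using hp.const_mul _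
  have hle : ∫ p, kern α q p * (den α x m l p)⁻¹ ∂ν ≤ wU α q * (m - q * l) := by
    refine le_of_tendsto' hlim fun k => ?_
    refine le_trans (le_of_eq ?_) (mul_le_mul_of_nonneg_left
      (h.integral_le _ (hη k) q ⟨hq'.1.le, hq'.2.le⟩) (wU_pos hq'.1).le)
    rw [← integral_const_mul]
    refine integral_congr_ae (hν.ae_mem.mono fun p hp => ?_)
    simp only [f]
    rw [kern_eq hq'.1 (hν.Icc_subset hp).1]
    ring
  rw [den_eq hq'.1]
  linarith

/-- At the edge there is at most one supersolution: the mean of two different ones, improved by one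
step of the iteration, would be a supersolution at a lower level. -/
lemma IsSupersolution.ae_eq (hν : CarriedBy ν a b) {h h' : ℝ → ℝ}
    (hs : IsSupersolution ν α (rightEdge ν α) h) (hs' : IsSupersolution ν α (rightEdge ν α) h') :
    h =ᵐ[ν] h' := by
  by_contra hne
  set S := rightEdge ν α
  -- `H` is a supersolution by convexity of the inverse, strictly so where `h` and `h'` differ, and
  -- `h₁ = (S - K)⁻¹ ≤ H` with `K` the image of `H` under the integral operator.
  let H : ℝ → ℝ := fun q => (h q + h' q) / 2
  have hHi : Integrable H ν := (hs.integrable.add hs'.integrable).div_const 2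
  let K : ℝ → ℝ := fun q => ∫ p, kern α q p * H p ∂ν
  have hK : ∀ q, K q = (∫ p, kern α q p * h p ∂ν + ∫ p, kern α q p * h' p ∂ν) / 2 := by
    intro q
    rw [← integral_add (hν.integrable_kern_mul α q hs.integrable)
      (hν.integrable_kern_mul α q hs'.integrable), ← integral_div]
    refine integral_congr_ae (Eventually.of_forall fun p => ?_)
    simp only [H]; ring
  have hKm : Measurable K := by
    have : K = fun q => wU α q * ∫ p, wU α p * H p ∂ν - wV α q * ∫ p, wV α p * H p ∂ν :=
      funext fun q => hν.integral_kern_mul α q hHi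
    rw [this]; fun_prop
  let h₁ : ℝ → ℝ := fun q => (S - K q)⁻¹
  have hmain : ∀ᵐ q ∂ν, 0 < h₁ q ∧ h₁ q ≤ H q ∧ (h₁ q = H q → h q = h' q) ∧
      (h₁ q)⁻¹ = S - K q := by
    filter_upwards [hs.pos, hs'.pos, hs.le, hs'.le] with q hp hp' hl hl'
    have hH0 : 0 < H q := by simp only [H]; positivity
    have h1 : (H q)⁻¹ + (h q - h' q) ^ 2 / (2 * h q * h' q * (h q + h' q)) =
        ((h q)⁻¹ + (h' q)⁻¹) / 2 := by
      simp only [H]; field_simp; ring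
    have h2 : 0 ≤ (h q - h' q) ^ 2 / (2 * h q * h' q * (h q + h' q)) := by positivity
    have h3 : ((h q)⁻¹ + (h' q)⁻¹) / 2 ≤ S - K q := by rw [hK]; linarith
    have h4 : (H q)⁻¹ ≤ S - K q := by linarith
    have h5 : 0 < S - K q := (inv_pos.2 hH0).trans_le h4
    refine ⟨inv_pos.2 h5, inv_le_of_inv_le₀ hH0 h4, fun heq => ?_, inv_inv _⟩
    have h6 : S - K q = (H q)⁻¹ := by rw [← heq, inv_inv]
    have h7 : (h q - h' q) ^ 2 / (2 * h q * h' q * (h q + h' q)) = 0 := by linarith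
    rw [div_eq_zero_iff] at h7
    rcases h7 with h7 | h7
    · exact sub_eq_zero.1 (pow_eq_zero_iff two_ne_zero |>.1 h7)
    · have : 0 < 2 * h q * h' q * (h q + h' q) := by positivity
      exact absurd h7 this.ne'
  have hi₁ : Integrable h₁ ν := by
    refine hHi.mono' (by fun_prop) (hmain.mono fun q hq => ?_)
    rw [Real.norm_of_nonneg hq.1.le]; exact hq.2.1
  set d := ∫ q, (H q - h₁ q) ∂ν with hd
  have hnn : 0 ≤ᵐ[ν] fun q => H q - h₁ q := hmain.mono fun q hq => sub_nonneg.2 hq.2.1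
  have hd0 : 0 < d := by
    refine lt_of_le_of_ne (integral_nonneg_of_ae hnn) fun h0 => hne ?_
    have := (integral_eq_zero_iff_of_nonneg_ae hnn (hHi.sub hi₁)).1 h0.symm
    filter_upwards [this, hmain] with q hq hq'
    exact hq'.2.2.1 (sub_eq_zero.1 hq).symm
  obtain ⟨q₀, hq₀⟩ := hν.nonempty
  have hb0 : 0 < b := (hν.Icc_subset hq₀).1.trans_le hq₀.2
  set c := wLow a α ^ 2 * (1 - b ^ 2)
  have hc : 0 < c := by
    have h1 := wLow_pos (α := α) hν.pos
    have h2 : 0 < 1 - b ^ 2 := by nlinarith [hν.lt_one]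
    positivity
  have hsup : IsSupersolution ν α (S - c * d) h₁ := by
    refine ⟨hi₁, hmain.mono fun q hq => hq.1, ?_⟩
    filter_upwards [hmain, hν.ae_mem] with q hq hqm
    rw [hq.2.2.2]
    have h1 : c * d ≤ ∫ p, kern α q p * (H p - h₁ p) ∂ν := by
      rw [hd, ← integral_const_mul]
      refine integral_mono_ae ((hHi.sub hi₁).const_mul c)
        (hν.integrable_kern_mul α q (hHi.sub hi₁)) ?_
      filter_upwards [hnn, hν.ae_mem] with p hp hpm
      exact mul_le_mul_of_nonneg_right (le_kern hν.pos hν.lt_one hqm hpm) hp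
    have h2 : ∫ p, kern α q p * (H p - h₁ p) ∂ν = K q - ∫ p, kern α q p * h₁ p ∂ν := by
      rw [← integral_sub (hν.integrable_kern_mul α q hHi) (hν.integrable_kern_mul α q hi₁)]
      refine integral_congr_ae (Eventually.of_forall fun p => ?_)
      simp only; ring
    linarith
  have := hsup.rightEdge_le hν
  have : 0 < c * d := mul_pos hc hd0
  linarith

/-- To the right of the spectrum, the true solution is a relaxed solution. -/
lemma relaxedSolution_of_lt (hν : CarriedBy ν a b) {x : ℝ} (hx : rightEdge ν α < x) :
    RelaxedSolution ν α x (-E1Real ν α x) (-E2Real ν α x) := by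
  obtain ⟨_, hd, h1, h2⟩ := (real_solution hν α).1 x hx
  have hx0 : 0 < x - rightEdge ν α := sub_pos.2 hx
  set m := -E1Real ν α x
  set l := -E2Real ν α x
  have hi : Integrable (fun q => (den α x m l q)⁻¹) ν :=
    Integrable.of_bound (by fun_prop) (x - rightEdge ν α)⁻¹ (hd.mono fun q hq => by
      rw [Real.norm_of_nonneg (inv_nonneg.2 (hx0.le.trans hq))]
      exact inv_anti₀ hx0 hq)
  refine ⟨hd.mono fun q hq => hx0.le.trans hq, fun η hη q hq => ?_, fun a' b' hν' => ?_⟩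
  · suffices h : _ ≤ ∫ p, wU α p * (den α x m l p)⁻¹ ∂ν - q * ∫ p, wV α p * (den α x m l p)⁻¹ ∂ν
      by rwa [← h1, ← h2] at h
    rw [← integral_const_mul, ← integral_sub (hν.integrable_wU_mul α hi)
      ((hν.integrable_wV_mul α hi).const_mul q)]
    refine integral_mono_ae (integrable_truncated hν hη hq)
      ((hν.integrable_wU_mul α hi).sub ((hν.integrable_wV_mul α hi).const_mul q)) ?_
    filter_upwards [hd, hν.ae_mem] with p hp hpm
    have hp' := hν.Icc_subset hpm
    have h3 : (max (den α x m l p) η)⁻¹ ≤ (den α x m l p)⁻¹ :=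
      inv_anti₀ (hx0.trans_le hp) (le_max_left _ _)
    have h4 : 0 ≤ 1 - q * p := by nlinarith [hq.1, hq.2, hp'.1, hp'.2]
    rw [wV_eq hp'.1]
    have h5 := mul_le_mul_of_nonneg_left h3 (mul_nonneg (wU_pos (α := α) hp'.1).le h4)
    refine h5.trans (le_of_eq (by ring))
  · suffices h : a' * ∫ p, wU α p * (den α x m l p)⁻¹ ∂ν ≤ ∫ p, wV α p * (den α x m l p)⁻¹ ∂ν ∧
        ∫ p, wV α p * (den α x m l p)⁻¹ ∂ν ≤ b' * ∫ p, wU α p * (den α x m l p)⁻¹ ∂ν by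
      rwa [← h1, ← h2] at h
    rw [← integral_const_mul, ← integral_const_mul]
    constructor
    · refine integral_mono_ae ((hν.integrable_wU_mul α hi).const_mul a')
        (hν.integrable_wV_mul α hi) ?_
      filter_upwards [hd, hν'.ae_mem] with p hp hpm
      rw [wV_eq (hν'.Icc_subset hpm).1, mul_assoc]
      refine mul_le_mul_of_nonneg_right hpm.1 (mul_nonneg (wU_pos (hν'.Icc_subset hpm).1).le ?_)
      exact inv_nonneg.2 (hx0.le.trans hp)
    · refine integral_mono_ae (hν.integrable_wV_mul α hi)
        ((hν.integrable_wU_mul α hi).const_mul b') ?_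
      filter_upwards [hd, hν'.ae_mem] with p hp hpm
      rw [wV_eq (hν'.Icc_subset hpm).1, mul_assoc]
      refine mul_le_mul_of_nonneg_right hpm.2 (mul_nonneg (wU_pos (hν'.Icc_subset hpm).1).le ?_)
      exact inv_nonneg.2 (hx0.le.trans hp)

lemma E2Real_neg (hν : CarriedBy ν a b) {x : ℝ} (hx : rightEdge ν α < x) : E2Real ν α x < 0 := by
  obtain ⟨_, hd, h1, h2⟩ := (real_solution hν α).1 x hx
  have hx0 : 0 < x - rightEdge ν α := sub_pos.2 hx
  rw [← neg_pos, h2]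
  refine integral_pos_of_ae_pos (hν.integrable_wV_mul α ?_) ?_
  · exact Integrable.of_bound (by fun_prop) (x - rightEdge ν α)⁻¹ (hd.mono fun q hq => by
      rw [Real.norm_of_nonneg (inv_nonneg.2 (hx0.le.trans hq))]
      exact inv_anti₀ hx0 hq)
  · filter_upwards [hd, hν.ae_mem] with q hq hqm
    exact mul_pos (wV_pos (hν.pos.trans_le hqm.1)) (inv_pos.2 (hx0.trans_le hq))

lemma RelaxedSolution.snd_mem {ν : Measure ℝ} {x m l : ℝ} (h : RelaxedSolution ν α x m l)
    (hν : CarriedBy ν a b) : l ∈ Icc 0 m := by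
  have hm := h.nonneg hν
  obtain ⟨h1, h2⟩ := h.ratio a b hν
  refine ⟨le_trans (mul_nonneg hν.pos.le hm) h1, h2.trans (mul_le_of_le_one_left hm hν.lt_one.le)⟩

lemma bddBelow_E2Real (hν : CarriedBy ν a b) (α : ℝ) :
    BddBelow (E2Real ν α '' Ioi (rightEdge ν α)) := by
  set S := rightEdge ν α
  refine ⟨E2Real ν α (S + 1) ⊓ -((S + 1) / (wLow a α * (1 - b ^ 2))), ?_⟩
  rintro _ ⟨x, hx, rfl⟩
  rcases le_total (S + 1) x with h | h
  · exact inf_le_left.trans ((real_solution hν α).2 (by simp [S]) hx h)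
  · refine inf_le_right.trans ?_
    have hr := relaxedSolution_of_lt (α := α) hν hx
    have h1 := (hr.snd_mem hν).2
    have h2 := hr.le_div hν
    obtain ⟨q₀, hq₀⟩ := hν.nonempty
    have hb0 : 0 < b := (hν.Icc_subset hq₀).1.trans_le hq₀.2
    have h3 : 0 < wLow a α * (1 - b ^ 2) :=
      mul_pos (wLow_pos hν.pos) (by nlinarith [hν.lt_one])
    have h4 : x / (wLow a α * (1 - b ^ 2)) ≤ (S + 1) / (wLow a α * (1 - b ^ 2)) := by gcongr
    linarith

/-- The boundary value of `E₂` is monotone and bounded below, so that it has a limit at the edge. -/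
lemma tendsto_E2Real_edge (hν : CarriedBy ν a b) (α : ℝ) :
    Tendsto (E2Real ν α) (𝓝[>] rightEdge ν α) (𝓝 (E2Edge ν α)) ∧ E2Edge ν α < 0 := by
  have h := (real_solution hν α).2.tendsto_nhdsGT (bddBelow_E2Real hν α)
  have he : E2Edge ν α = sInf (E2Real ν α '' Ioi (rightEdge ν α)) := h.limUnder_eq
  refine ⟨he ▸ h, ?_⟩
  have hx : rightEdge ν α < rightEdge ν α + 1 := by linarith
  rw [he]
  exact (csInf_le (bddBelow_E2Real hν α) ⟨_, hx, rfl⟩).trans_lt (E2Real_neg hν hx)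

theorem CarriedBy.thresholdWellDefined (hν : CarriedBy ν a b) (α : ℝ) :
    ThresholdWellDefined ν α where
  existsUnique_fixedPoint _ hz := hν.existsUnique_isFixedPoint α hz
  isLimitSpectrum := hν.isLimitSpectrum α
  tendsto_E2Real x hx := (continuous_snd.tendsto _).comp ((real_solution hν α).1 x hx).1
  tendsto_E2Edge := (tendsto_E2Real_edge hν α).1
  E2Edge_neg := (tendsto_E2Real_edge hν α).2

end edge

/-! ### Continuity of the threshold -/

/-- The probability measures `νn n` on `[a, b]` converge weakly to `ν`, and their supports enter
every neighbourhood of the support of `ν`. -/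
structure SupportedConv {ι : Type*} (F : Filter ι) (νn : ι → Measure ℝ) (ν : Measure ℝ)
    (a b : ℝ) : Prop where
  prob : ∀ᶠ n in F, IsProbabilityMeasure (νn n)
  carried : ∀ᶠ n in F, CarriedBy (νn n) a b
  tendsto : ∀ f : ℝ → ℝ, ContinuousOn f (Icc a b) →
    Tendsto (fun n => ∫ q, f q ∂(νn n)) F (𝓝 (∫ q, f q ∂ν))
  support : ∀ U : Set ℝ, IsOpen U → ν.support ⊆ U → ∀ᶠ n in F, νn n Uᶜ = 0

lemma SupportedConv.mono {ι : Type*} {F G : Filter ι} {νn : ι → Measure ℝ} {ν : Measure ℝ}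
    {a b : ℝ} (h : SupportedConv F νn ν a b) (hG : G ≤ F) : SupportedConv G νn ν a b :=
  ⟨h.prob.filter_mono hG, h.carried.filter_mono hG, fun f hf => (h.tendsto f hf).mono_left hG,
    fun U hU hs => (h.support U hU hs).filter_mono hG⟩

lemma supportedConv_const {ι : Type*} (F : Filter ι) {ν : Measure ℝ} [IsProbabilityMeasure ν]
    {a b : ℝ} (hν : CarriedBy ν a b) : SupportedConv F (fun _ => ν) ν a b :=
  ⟨Eventually.of_forall fun _ => inferInstance, Eventually.of_forall fun _ => hν,
    fun _ _ => tendsto_const_nhds, fun _ _ hs => Eventually.of_forall fun _ =>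
      measure_mono_null (compl_subset_compl.2 hs) Measure.measure_compl_support⟩

/-- A jointly continuous function depends on the parameter uniformly over a compact interval. -/
lemma eventually_forall_Icc_abs_sub_lt {X : Type*} [TopologicalSpace X] {a b : ℝ} {Φ : X → ℝ → ℝ}
    (hΦ : ContinuousOn (Function.uncurry Φ) (univ ×ˢ Icc a b)) (p₀ : X) {ε : ℝ} (hε : 0 < ε) :
    ∀ᶠ p in 𝓝 p₀, ∀ q ∈ Icc a b, |Φ p q - Φ p₀ q| < ε := by
  have h := isCompact_Icc.eventually_forall_of_forall_eventually (x₀ := p₀) (K := Icc a b)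
    (P := fun p q => q ∈ Icc a b → |Φ p q - Φ p₀ q| < ε) ?_
  · exact h.mono fun p hp q hq => hp q hq hq
  intro q₀ hq₀
  have h1 := hΦ (p₀, q₀) ⟨mem_univ _, hq₀⟩
  have h2 : ContinuousWithinAt (fun z : X × ℝ => Φ p₀ z.2) (univ ×ˢ Icc a b) (p₀, q₀) := by
    refine ContinuousWithinAt.comp (t := univ ×ˢ Icc a b) (g := Function.uncurry Φ)
      (f := fun z : X × ℝ => (p₀, z.2)) h1 (by fun_prop) fun z hz => ⟨mem_univ _, hz.2⟩
  have h3 := ((h1.sub h2).abs).eventually_lt (continuousWithinAt_const (b := ε))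
    (by simpa using hε)
  rw [eventually_nhdsWithin_iff] at h3
  exact h3.mono fun z hz hzq => hz ⟨mem_univ _, hzq⟩

/-- Joint continuity of an integral in the measure and in a parameter of the integrand. -/
lemma SupportedConv.tendsto_integral {ι : Type*} {F : Filter ι} {νn : ι → Measure ℝ}
    {ν : Measure ℝ} {a b : ℝ} (h : SupportedConv F νn ν a b) {X : Type*} [TopologicalSpace X]
    {Φ : X → ℝ → ℝ} (hΦ : ContinuousOn (Function.uncurry Φ) (univ ×ˢ Icc a b))
    (hm : ∀ p, Measurable (Φ p)) {p : ι → X} {p₀ : X} (hp : Tendsto p F (𝓝 p₀)) :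
    Tendsto (fun n => ∫ q, Φ (p n) q ∂(νn n)) F (𝓝 (∫ q, Φ p₀ q ∂ν)) := by
  have hc : ∀ p, ContinuousOn (Φ p) (Icc a b) := fun p =>
    hΦ.comp (f := fun q : ℝ => (p, q)) (by fun_prop) fun q hq => ⟨mem_univ _, hq⟩
  have h1 := h.tendsto (Φ p₀) (hc p₀)
  have h2 : Tendsto (fun n => ∫ q, Φ (p n) q ∂(νn n) - ∫ q, Φ p₀ q ∂(νn n)) F (𝓝 0) := by
    rw [Metric.tendsto_nhds]
    intro ε hε
    filter_upwards [h.prob, h.carried,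
      hp.eventually (eventually_forall_Icc_abs_sub_lt hΦ p₀ (half_pos hε))] with n hn hcn hun
    have hi : ∀ p, Integrable (Φ p) (νn n) := fun p => by
      obtain ⟨C, hC⟩ := isCompact_Icc.exists_bound_of_continuousOn (hc p)
      exact hcn.integrable (hm p).aestronglyMeasurable hC
    rw [dist_zero_right, ← integral_sub (hi _) (hi _)]
    refine lt_of_le_of_lt (norm_integral_le_of_norm_le_const (C := ε / 2)
      (hcn.ae_mem.mono fun q hq => ?_)) ?_
    · exact (hun q hq).le
    · simp; linarith
  simpa using h2.add h1

lemma continuousOn_wU {a b : ℝ} (ha : 0 < a) :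
    ContinuousOn (fun z : ℝ × ℝ => wU z.1 z.2) (univ ×ˢ Icc a b) := by
  unfold wU
  exact ContinuousOn.rpow (by fun_prop) (by fun_prop) fun z hz => Or.inl (ha.trans_le hz.2.1).ne'

lemma continuousOn_wV {a b : ℝ} (ha : 0 < a) :
    ContinuousOn (fun z : ℝ × ℝ => wV z.1 z.2) (univ ×ˢ Icc a b) := by
  unfold wV
  exact ContinuousOn.rpow (by fun_prop) (by fun_prop) fun z hz => Or.inl (ha.trans_le hz.2.1).ne'

lemma continuousOn_wU' {a b : ℝ} (ha : 0 < a) {Y : Type*} [TopologicalSpace Y] {s : Set Y}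
    {f g : Y → ℝ} (hf : ContinuousOn f s) (hg : ContinuousOn g s) (hgs : ∀ y ∈ s, g y ∈ Icc a b) :
    ContinuousOn (fun y => wU (f y) (g y)) s :=
  (continuousOn_wU (b := b) ha).comp (f := fun y => (f y, g y)) (hf.prodMk hg)
    fun y hy => ⟨mem_univ _, hgs y hy⟩

lemma continuousOn_wV' {a b : ℝ} (ha : 0 < a) {Y : Type*} [TopologicalSpace Y] {s : Set Y}
    {f g : Y → ℝ} (hf : ContinuousOn f s) (hg : ContinuousOn g s) (hgs : ∀ y ∈ s, g y ∈ Icc a b) :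
    ContinuousOn (fun y => wV (f y) (g y)) s :=
  (continuousOn_wV (b := b) ha).comp (f := fun y => (f y, g y)) (hf.prodMk hg)
    fun y hy => ⟨mem_univ _, hgs y hy⟩

/-- The denominator is jointly continuous in the parameters `(α, x, m, l)` and the weight. -/
lemma continuousOn_den {a b : ℝ} (ha : 0 < a) :
    ContinuousOn (fun z : (ℝ × ℝ × ℝ × ℝ) × ℝ => den z.1.1 z.1.2.1 z.1.2.2.1 z.1.2.2.2 z.2)
      (univ ×ˢ Icc a b) := by
  unfold den
  have hU := continuousOn_wU' (Y := (ℝ × ℝ × ℝ × ℝ) × ℝ) (a := a) (b := b) (s := univ ×ˢ Icc a b)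
    (f := fun z => z.1.1) (g := fun z => z.2) ha (by fun_prop) (by fun_prop) fun z hz => hz.2
  have hV := continuousOn_wV' (Y := (ℝ × ℝ × ℝ × ℝ) × ℝ) (a := a) (b := b) (s := univ ×ˢ Icc a b)
    (f := fun z => z.1.1) (g := fun z => z.2) ha (by fun_prop) (by fun_prop) fun z hz => hz.2
  fun_prop

lemma continuousOn_den_right {a b : ℝ} (ha : 0 < a) (α x m l : ℝ) :
    ContinuousOn (den α x m l) (Icc a b) :=
  (continuousOn_den (b := b) ha).comp (f := fun q : ℝ => ((α, x, m, l), q)) (by fun_prop)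
    fun q hq => ⟨mem_univ _, hq⟩

lemma CarriedBy.support_subset {ν : Measure ℝ} {a b : ℝ} (h : CarriedBy ν a b) :
    ν.support ⊆ Icc a b := Measure.support_subset_of_isClosed isClosed_Icc h.ae_mem

section limits

variable {ι : Type*} {F : Filter ι} {νn : ι → Measure ℝ} {ν : Measure ℝ} [IsProbabilityMeasure ν]
  {a b α : ℝ} {αn : ι → ℝ}

/-- Relaxed solutions are stable under weak limits. -/
lemma SupportedConv.relaxedSolution [F.NeBot] (hconv : SupportedConv F νn ν a b)
    (hν : CarriedBy ν a b) (hα : Tendsto αn F (𝓝 α)) {xn mn ln : ι → ℝ} {x m l : ℝ}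
    (hx : Tendsto xn F (𝓝 x)) (hm : Tendsto mn F (𝓝 m)) (hl : Tendsto ln F (𝓝 l))
    (h : ∀ᶠ n in F, RelaxedSolution (νn n) (αn n) (xn n) (mn n) (ln n)) :
    RelaxedSolution ν α x m l := by
  have hp : Tendsto (fun n => (αn n, xn n, mn n, ln n)) F (𝓝 (α, x, m, l)) :=
    hα.prodMk_nhds (hx.prodMk_nhds (hm.prodMk_nhds hl))
  have hden := continuousOn_den (a := a) (b := b) hν.pos
  refine ⟨?_, fun η hη q hq => ?_, fun a' b' hν' => ?_⟩
  · have ht := hconv.tendsto_integral (X := ℝ × ℝ × ℝ × ℝ)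
      (Φ := fun p q => max (-den p.1 p.2.1 p.2.2.1 p.2.2.2 q) 0)
      (by simp only [Function.uncurry_def]; exact hden.neg.sup continuousOn_const)
      (fun p => by fun_prop) hp
    have h0 : ∀ᶠ n in F,
        ∫ q, max (-den (αn n) (xn n) (mn n) (ln n) q) 0 ∂(νn n) = 0 := by
      filter_upwards [h] with n hn
      rw [integral_congr_ae (hn.den_nonneg.mono fun q hq => max_eq_right (neg_nonpos.2 hq)),
        integral_zero]
    have h1 := tendsto_nhds_unique (ht.congr' h0) tendsto_const_nhds
    obtain ⟨C, hC⟩ := (isCompact_Icc (a := a) (b := b)).exists_bound_of_continuousOn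
      ((continuousOn_den_right hν.pos α x m l).neg.sup (continuousOn_const (c := (0 : ℝ))))
    have hi : Integrable (fun q => max (-den α x m l q) 0) ν :=
      hν.integrable (by fun_prop) hC
    have h2 := (integral_eq_zero_iff_of_nonneg (fun q => le_max_right _ _) hi).1 h1
    filter_upwards [h2] with q hq
    have hq0 : max (-den α x m l q) 0 = 0 := hq
    exact neg_nonpos.1 ((le_max_left _ _).trans_eq hq0)
  · have hU := continuousOn_wU' (Y := (ℝ × ℝ × ℝ × ℝ) × ℝ) (a := a) (b := b)
      (s := univ ×ˢ Icc a b) (f := fun z => z.1.1) (g := fun z => z.2) hν.pos (by fun_prop)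
      (by fun_prop) fun z hz => hz.2
    have ht := hconv.tendsto_integral (X := ℝ × ℝ × ℝ × ℝ)
      (Φ := fun p r => wU p.1 r * (1 - q * r) * (max (den p.1 p.2.1 p.2.2.1 p.2.2.2 r) η)⁻¹)
      (by
        simp only [Function.uncurry_def]
        refine (hU.mul (by fun_prop)).mul
          (ContinuousOn.inv₀ (hden.sup continuousOn_const) fun z _ => ?_)
        exact (hη.trans_le (le_max_right _ _)).ne')
      (fun p => by fun_prop) hp
    exact le_of_tendsto_of_tendsto ht (hm.sub (hl.const_mul q))
      (h.mono fun n hn => hn.integral_le η hη q hq)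
  · -- The measures `νn n` are eventually carried by any slightly larger interval.
    have hev : ∀ ε : ℝ, 0 < ε → ε < a' → ε < 1 - b' →
        (a' - ε) * m ≤ l ∧ l ≤ (b' + ε) * m := by
      intro ε hε h1 h2
      have hs := hconv.support (Ioo (a' - ε) (b' + ε)) isOpen_Ioo
        (hν'.support_subset.trans (Icc_subset_Ioo (by linarith) (by linarith)))
      have hr : ∀ᶠ n in F, (a' - ε) * mn n ≤ ln n ∧ ln n ≤ (b' + ε) * mn n := by
        filter_upwards [h, hs] with n hn hsn
        exact hn.ratio _ _ ⟨by linarith, by linarith,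
          measure_mono_null (compl_subset_compl.2 Ioo_subset_Icc_self) hsn⟩
      exact ⟨le_of_tendsto_of_tendsto (hm.const_mul _) hl (hr.mono fun n hn => hn.1),
        le_of_tendsto_of_tendsto hl (hm.const_mul _) (hr.mono fun n hn => hn.2)⟩
    have hsmall : ∀ᶠ ε : ℝ in 𝓝[>] 0, 0 < ε ∧ ε < a' ∧ ε < 1 - b' := by
      filter_upwards [self_mem_nhdsWithin, Ioo_mem_nhdsGT hν'.pos,
        Ioo_mem_nhdsGT (sub_pos.2 hν'.lt_one)] with ε h1 h2 h3 using ⟨h1, h2.2, h3.2⟩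
    have hc1 : Tendsto (fun ε : ℝ => (a' - ε) * m) (𝓝[>] 0) (𝓝 ((a' - 0) * m)) :=
      Tendsto.mono_left (by apply Continuous.tendsto; fun_prop) nhdsWithin_le_nhds
    have hc2 : Tendsto (fun ε : ℝ => (b' + ε) * m) (𝓝[>] 0) (𝓝 ((b' + 0) * m)) :=
      Tendsto.mono_left (by apply Continuous.tendsto; fun_prop) nhdsWithin_le_nhds
    rw [sub_zero] at hc1
    rw [add_zero] at hc2
    exact ⟨le_of_tendsto hc1 (hsmall.mono fun ε hε => (hev ε hε.1 hε.2.1 hε.2.2).1),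
      ge_of_tendsto hc2 (hsmall.mono fun ε hε => (hev ε hε.1 hε.2.1 hε.2.2).2)⟩

/-- Upper semicontinuity of the right edge: the solution at a level `x` above the edge of the limit
is a supersolution, up to `ε`, for the approximating measures. -/
lemma SupportedConv.eventually_rightEdge_le (hconv : SupportedConv F νn ν a b)
    (hν : CarriedBy ν a b) (hα : Tendsto αn F (𝓝 α)) {x ε : ℝ} (hx : rightEdge ν α < x)
    (hε : 0 < ε) : ∀ᶠ n in F, rightEdge (νn n) (αn n) ≤ x + ε := by
  obtain ⟨_, hd, h1, h2⟩ := (real_solution hν α).1 x hx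
  set m := -E1Real ν α x
  set l := -E2Real ν α x
  set η := (x - rightEdge ν α) / 2 with hη
  have hη0 : 0 < η := half_pos (sub_pos.2 hx)
  let h : ℝ → ℝ := fun q => (max (den α x m l q) η)⁻¹
  have hhm : Measurable h := by fun_prop
  have hhc : ContinuousOn h (Icc a b) :=
    ((continuousOn_den_right hν.pos α x m l).sup continuousOn_const).inv₀
      fun q _ => (hη0.trans_le (le_max_right _ _)).ne'
  have hhae : ∀ᵐ q ∂ν, h q = (den α x m l q)⁻¹ := hd.mono fun q hq => by
    change (max _ _)⁻¹ = _
    rw [max_eq_left (by linarith)]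
  have hM : Tendsto (fun n => ∫ p, wU (αn n) p * h p ∂(νn n)) F (𝓝 m) := by
    have := hconv.tendsto_integral (X := ℝ) (Φ := fun α' q => wU α' q * h q)
      (by
        simp only [Function.uncurry_def]
        exact (continuousOn_wU hν.pos).mul (hhc.comp continuousOn_snd fun z hz => hz.2))
      (fun p => by fun_prop) hα
    rwa [integral_congr_ae (hhae.mono fun q hq => congrArg (wU α q * ·) hq), ← h1] at this
  have hL : Tendsto (fun n => ∫ p, wV (αn n) p * h p ∂(νn n)) F (𝓝 l) := by
    have := hconv.tendsto_integral (X := ℝ) (Φ := fun α' q => wV α' q * h q)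
      (by
        simp only [Function.uncurry_def]
        exact (continuousOn_wV hν.pos).mul (hhc.comp continuousOn_snd fun z hz => hz.2))
      (fun p => by fun_prop) hα
    rwa [integral_congr_ae (hhae.mono fun q hq => congrArg (wV α q * ·) hq), ← h2] at this
  have hunif := (hα.prodMk_nhds ((tendsto_const_nhds (x := x)).prodMk_nhds
    (hM.prodMk_nhds hL))).eventually
    (eventually_forall_Icc_abs_sub_lt
      (Φ := fun (p : ℝ × ℝ × ℝ × ℝ) q => den p.1 p.2.1 p.2.2.1 p.2.2.2 q)
      (continuousOn_den (b := b) hν.pos) (α, x, m, l) hε)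
  -- A neighbourhood of the support on which the denominator is not truncated.
  have hopen : IsOpen (Ioo (0 : ℝ) 1 ∩ den α x m l ⁻¹' Ioi η) := by
    refine ContinuousOn.isOpen_inter_preimage ?_ isOpen_Ioo isOpen_Ioi
    intro q hq
    have h3 := (continuousOn_den_right (a := q / 2) (b := 1) (half_pos hq.1) α x m l).continuousAt
      (x := q) (Icc_mem_nhds (by linarith [hq.1]) hq.2)
    exact h3.continuousWithinAt
  have hsupp : ν.support ⊆ Ioo (0 : ℝ) 1 ∩ den α x m l ⁻¹' Ioi η := by
    intro q hq
    have hqm := hν.support_subset hq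
    refine ⟨hν.Icc_subset hqm, ?_⟩
    by_contra hlt
    have hq' := hν.Icc_subset hqm
    have h3 := (continuousOn_den_right (a := q / 2) (b := 1) (half_pos hq'.1) α x m l).continuousAt
      (x := q) (Icc_mem_nhds (by linarith [hq'.1]) hq'.2)
    have h4 : den α x m l q < x - rightEdge ν α := by
      have : den α x m l q ≤ η := not_lt.1 hlt
      linarith
    have h5 : {p | den α x m l p < x - rightEdge ν α} ∈ 𝓝 q := h3.eventually_lt_const h4
    have h6 := Measure.mem_support_iff_forall q |>.1 hq _ h5
    refine h6.ne' ?_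
    have := ae_iff.1 hd
    simpa only [not_le] using this
  filter_upwards [hconv.prob, hconv.carried, hunif, hconv.support _ hopen hsupp]
    with n hn hcn hun hsn
  have hi : Integrable h (νn n) := by
    refine Integrable.of_bound hhm.aestronglyMeasurable η⁻¹ (Eventually.of_forall fun q => ?_)
    have h7 : η ≤ max (den α x m l q) η := le_max_right _ _
    rw [Real.norm_of_nonneg (inv_nonneg.2 (hη0.le.trans h7))]
    exact inv_anti₀ hη0 h7
  refine IsSupersolution.rightEdge_le hcn (h := h) ⟨hi, Eventually.of_forall fun q =>
    inv_pos.2 (hη0.trans_le (le_max_right _ _)), ?_⟩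
  have hsae : ∀ᵐ q ∂(νn n), q ∈ Ioo (0 : ℝ) 1 ∩ den α x m l ⁻¹' Ioi η := mem_ae_iff.2 hsn
  filter_upwards [hsae, hcn.ae_mem] with q hq hqm
  have h8 : (h q)⁻¹ = den α x m l q := by
    change ((max _ _)⁻¹)⁻¹ = _
    rw [inv_inv, max_eq_left (le_of_lt hq.2)]
  have h9 := (abs_lt.1 (hun q hqm)).1
  rw [h8, hcn.integral_kern_mul _ _ hi]
  unfold den at h9 ⊢
  linarith

lemma exists_tendsto_of_eventually_mem_Icc {G : Ultrafilter ι} {f : ι → ℝ} {c d : ℝ}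
    (h : ∀ᶠ n in (G : Filter ι), f n ∈ Icc c d) : ∃ x, Tendsto f G (𝓝 x) := by
  obtain ⟨x, _, hx⟩ := isCompact_Icc.ultrafilter_le_nhds' (G.map f) (s := Icc c d) h
  exact ⟨x, hx⟩

/-- The boundary values of `(E₁, E₂)` at the edge form a relaxed solution. -/
lemma exists_relaxedSolution_edge (hν : CarriedBy ν a b) (α : ℝ) :
    ∃ m, RelaxedSolution ν α (rightEdge ν α) m (-E2Edge ν α) := by
  set S := rightEdge ν α with hS
  let G : Ultrafilter ℝ := Ultrafilter.of (𝓝[>] S)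
  have hG : (G : Filter ℝ) ≤ 𝓝[>] S := Ultrafilter.of_le _
  have hgt : ∀ᶠ x in (G : Filter ℝ), S < x := hG self_mem_nhdsWithin
  have hlt : ∀ᶠ x in (G : Filter ℝ), x < S + 1 :=
    hG (mem_nhdsWithin_of_mem_nhds (Iio_mem_nhds (by linarith)))
  obtain ⟨q₀, hq₀⟩ := hν.nonempty
  have hb0 : 0 < b := (hν.Icc_subset hq₀).1.trans_le hq₀.2
  have hc : 0 < wLow a α * (1 - b ^ 2) := mul_pos (wLow_pos hν.pos) (by nlinarith [hν.lt_one])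
  have hbd : ∀ᶠ x in (G : Filter ℝ),
      -E1Real ν α x ∈ Icc 0 ((S + 1) / (wLow a α * (1 - b ^ 2))) := by
    filter_upwards [hgt, hlt] with x h1 h2
    have hr := relaxedSolution_of_lt hν h1
    exact ⟨hr.nonneg hν, (hr.le_div hν).trans (by gcongr)⟩
  obtain ⟨m, hm⟩ := exists_tendsto_of_eventually_mem_Icc hbd
  refine ⟨m, (supportedConv_const (G : Filter ℝ) hν).relaxedSolution hν tendsto_const_nhds
    (xn := id) ?_ hm (((tendsto_E2Real_edge hν α).1.mono_left hG).neg)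
    (hgt.mono fun x hx => relaxedSolution_of_lt hν hx)⟩
  exact tendsto_id.mono_right (hG.trans nhdsWithin_le_nhds)

/-- At the edge, the second component of a relaxed solution is unique. -/
lemma RelaxedSolution.snd_eq (hν : CarriedBy ν a b) {m l m' l' : ℝ}
    (h : RelaxedSolution ν α (rightEdge ν α) m l)
    (h' : RelaxedSolution ν α (rightEdge ν α) m' l') : l = l' := by
  have heq := (h.isSupersolution hν).2.ae_eq hν (h'.isSupersolution hν).2
  have hae : ∀ᵐ q ∂ν, m - m' = q * (l - l') ∧ q ∈ Icc a b := by
    filter_upwards [heq, hν.ae_mem] with q hq hqm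
    have h0 := (hν.Icc_subset hqm).1
    have h1 := inv_injective hq
    rw [den_eq h0, den_eq h0] at h1
    have h2 : wU α q * (m - q * l) = wU α q * (m' - q * l') := by linarith
    have h3 := mul_left_cancel₀ (wU_pos (α := α) h0).ne' h2
    exact ⟨by linarith, hqm⟩
  by_contra hne
  -- Otherwise `ν` is a point mass, for which `l` is a known multiple of `m`.
  have hne' : l - l' ≠ 0 := sub_ne_zero.2 hne
  obtain ⟨q₀, hq₀, hq₀m⟩ := hae.exists
  have hq' := hν.Icc_subset hq₀m
  have hc : CarriedBy ν q₀ q₀ := by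
    refine ⟨hq'.1, hq'.2, ?_⟩
    have : ∀ᵐ q ∂ν, q ∈ Icc q₀ q₀ := by
      filter_upwards [hae] with q hq
      have : q = q₀ := mul_right_cancel₀ hne' (hq.1.symm.trans hq₀)
      simp [this]
    exact mem_ae_iff.1 this
  have h1 := le_antisymm (h.ratio _ _ hc).1 (h.ratio _ _ hc).2
  have h2 := h.ratio _ _ hc
  have h3 := h'.ratio _ _ hc
  have h4 : l - l' = q₀ * (m - m') := by linarith [h2.1, h2.2, h3.1, h3.2]
  rw [hq₀, ← mul_assoc] at h4
  have h5 : (1 - q₀ * q₀) * (l - l') = 0 := by linarith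
  rcases mul_eq_zero.1 h5 with h6 | h6
  · nlinarith [hq'.1, hq'.2]
  · exact hne' h6

lemma continuous_wLow {a : ℝ} (ha : 0 < a) : Continuous (wLow a) := by
  unfold wLow
  exact Continuous.rpow continuous_const (by fun_prop) fun _ => Or.inl ha.ne'

/-- Continuity of the value of `E₂` at the edge, in the weight distribution and in `α`. -/
theorem SupportedConv.tendsto_E2Edge (hconv : SupportedConv F νn ν a b) (hν : CarriedBy ν a b)
    (hα : Tendsto αn F (𝓝 α)) :
    Tendsto (fun n => E2Edge (νn n) (αn n)) F (𝓝 (E2Edge ν α)) := by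
  classical
  rw [tendsto_iff_ultrafilter]
  intro G hG
  have hconv := hconv.mono hG
  have hα := hα.mono_left hG
  obtain ⟨q₀, hq₀⟩ := hν.nonempty
  have hb0 : 0 < b := (hν.Icc_subset hq₀).1.trans_le hq₀.2
  have hb1 : 0 < 1 - b ^ 2 := by nlinarith [hν.lt_one]
  have hL := wLow_pos (α := α) hν.pos
  have hex : ∀ n, ∃ m, (IsProbabilityMeasure (νn n) ∧ CarriedBy (νn n) a b) →
      RelaxedSolution (νn n) (αn n) (rightEdge (νn n) (αn n)) m (-E2Edge (νn n) (αn n)) := by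
    intro n
    by_cases h : IsProbabilityMeasure (νn n) ∧ CarriedBy (νn n) a b
    · have := h.1
      obtain ⟨m, hm⟩ := exists_relaxedSolution_edge h.2 (αn n)
      exact ⟨m, fun _ => hm⟩
    · exact ⟨0, fun h' => absurd h' h⟩
  choose mn hmn using hex
  have hrel : ∀ᶠ n in (G : Filter ι), RelaxedSolution (νn n) (αn n)
      (rightEdge (νn n) (αn n)) (mn n) (-E2Edge (νn n) (αn n)) := by
    filter_upwards [hconv.prob, hconv.carried] with n h1 h2 using hmn n ⟨h1, h2⟩
  set S := rightEdge ν α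
  have hSn : ∀ᶠ n in (G : Filter ι), rightEdge (νn n) (αn n) ∈ Icc 0 (S + 1 + 1) := by
    filter_upwards [hconv.prob, hconv.carried, hrel,
      hconv.eventually_rightEdge_le hν hα (x := S + 1) (by linarith) one_pos] with n h1 h2 h3 h4
    exact ⟨(h3.isSupersolution h2).2.nonneg h2, h4⟩
  have hw : ∀ᶠ n in (G : Filter ι), wLow a α / 2 < wLow a (αn n) :=
    (((continuous_wLow hν.pos).tendsto α).comp hα).eventually_const_lt (by linarith)
  have hmn' : ∀ᶠ n in (G : Filter ι),
      mn n ∈ Icc 0 ((S + 1 + 1) / (wLow a α / 2 * (1 - b ^ 2))) := by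
    filter_upwards [hconv.prob, hconv.carried, hrel, hSn, hw] with n h1 h2 h3 h4 h5
    refine ⟨h3.nonneg h2, (h3.le_div h2).trans ?_⟩
    have : 0 ≤ S + 1 + 1 := h4.1.trans h4.2
    exact div_le_div₀ this h4.2 (by positivity) (by gcongr)
  have hln' : ∀ᶠ n in (G : Filter ι), -E2Edge (νn n) (αn n) ∈
      Icc 0 ((S + 1 + 1) / (wLow a α / 2 * (1 - b ^ 2))) := by
    filter_upwards [hconv.carried, hrel, hmn'] with n h2 h3 h4
    exact ⟨(h3.snd_mem h2).1, (h3.snd_mem h2).2.trans h4.2⟩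
  obtain ⟨x, hx⟩ := exists_tendsto_of_eventually_mem_Icc hSn
  obtain ⟨m, hm⟩ := exists_tendsto_of_eventually_mem_Icc hmn'
  obtain ⟨l, hl⟩ := exists_tendsto_of_eventually_mem_Icc hln'
  have hr := hconv.relaxedSolution hν hα hx hm hl hrel
  -- The limit carries a supersolution, so it is at least `S`; semicontinuity gives the converse.
  have hxS : x = S := by
    refine le_antisymm ?_ ((hr.isSupersolution hν).2.rightEdge_le hν)
    refine le_of_forall_pos_le_add fun ε hε => ?_
    refine le_of_tendsto hx ((hconv.eventually_rightEdge_le hν hα (x := S + ε / 2) (by linarith)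
      (half_pos hε)).mono fun n hn => ?_)
    linarith
  rw [hxS] at hr
  obtain ⟨m', hm'⟩ := exists_relaxedSolution_edge hν α
  have hll : l = -E2Edge ν α := hr.snd_eq hν hm'
  have := hl.neg
  simpa [hll] using this

/-- Continuity of the threshold in the weight distribution and in `α`. -/
theorem SupportedConv.tendsto_threshold (hconv : SupportedConv F νn ν a b) (hν : CarriedBy ν a b)
    (hα : Tendsto αn F (𝓝 α)) :
    Tendsto (fun n => threshold (νn n) (αn n)) F (𝓝 (threshold ν α)) :=
  tendsto_const_nhds.div (hconv.tendsto_E2Edge hν hα) (tendsto_E2Real_edge hν α).2.ne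

lemma CarriedBy.continuous_threshold (hν : CarriedBy ν a b) : Continuous (threshold ν) :=
  continuous_iff_continuousAt.2 fun _ =>
    (supportedConv_const _ hν).tendsto_threshold hν tendsto_id

lemma CarriedBy.argminOn_nonempty (hν : CarriedBy ν a b) {A : Set ℝ} (hA : IsCompact A)
    (hA₀ : A.Nonempty) : (argminOn A (threshold ν)).Nonempty := by
  obtain ⟨x, hx, hmin⟩ := hA.exists_isMinOn hA₀ hν.continuous_threshold.continuousOn
  exact ⟨x, hx, hmin⟩

/-- Minimizers of the approximating thresholds approach the minimizers of the limit. -/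
lemma SupportedConv.tendsto_infDist_argminOn (hconv : SupportedConv F νn ν a b)
    (hν : CarriedBy ν a b) {A : Set ℝ} (hA : IsCompact A)
    (hαn : ∀ᶠ n in F, αn n ∈ argminOn A (threshold (νn n))) :
    Tendsto (fun n => Metric.infDist (αn n) (argminOn A (threshold ν))) F (𝓝 0) := by
  rw [tendsto_iff_ultrafilter]
  intro G hG
  have hconv := hconv.mono hG
  have hαn := hαn.filter_mono hG
  obtain ⟨α₀, hα₀, hlim⟩ := hA.ultrafilter_le_nhds' (G.map αn) (hαn.mono fun n hn => hn.1)
  have hlim' : Tendsto αn G (𝓝 α₀) := hlim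
  have hmem : α₀ ∈ argminOn A (threshold ν) := by
    refine ⟨hα₀, fun β hβ => ?_⟩
    exact le_of_tendsto_of_tendsto (hconv.tendsto_threshold hν hlim')
      (hconv.tendsto_threshold hν (tendsto_const_nhds (x := β))) (hαn.mono fun n hn => hn.2 hβ)
  have h := ((Metric.continuous_infDist_pt (argminOn A (threshold ν))).tendsto α₀).comp hlim'
  rwa [Metric.infDist_zero_of_mem hmem] at h

end limits

/-! ### Degrees of inhomogeneous random graphs -/

section Finite

variable {n : ℕ}

open scoped Classical in
/-- Expanding a product over vertex pairs as a sum over graphs. -/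
lemma sum_simpleGraph_prod_ite (f g : Fin n → Fin n → ℝ) :
    ∑ H : SimpleGraph (Fin n), ∏ i, ∏ j ∈ Finset.Ioi i, (if H.Adj i j then f i j else g i j) =
      ∏ i, ∏ j ∈ Finset.Ioi i, (f i j + g i j) := by
  set s : Finset (Σ _ : Fin n, Fin n) := Finset.univ.sigma fun i => Finset.Ioi i with hs
  have hmem : ∀ x : Σ _ : Fin n, Fin n, x ∈ s ↔ x.1 < x.2 := fun x => by simp [hs]
  have h1 : ∀ F : Fin n → Fin n → ℝ, ∏ i, ∏ j ∈ Finset.Ioi i, F i j = ∏ x ∈ s, F x.1 x.2 :=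
    fun F => by rw [hs, Finset.prod_sigma]
  simp only [h1]
  rw [Finset.prod_add]
  refine Finset.sum_bij' (fun H _ => s.filter fun x => H.Adj x.1 x.2)
    (fun t _ => SimpleGraph.fromRel fun i j => (⟨i, j⟩ : Σ _ : Fin n, Fin n) ∈ t)
    (fun H _ => Finset.mem_powerset.2 (Finset.filter_subset _ _)) (fun _ _ => Finset.mem_univ _)
    (fun H _ => ?_) (fun t ht => ?_) (fun H _ => ?_)
  · ext i j
    simp only [SimpleGraph.fromRel_adj, Finset.mem_filter, hmem]
    constructor
    · rintro ⟨-, h | h⟩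
      · exact h.2
      · exact h.2.symm
    · intro h
      refine ⟨h.ne, ?_⟩
      rcases lt_or_gt_of_ne h.ne with h' | h'
      · exact Or.inl ⟨h', h⟩
      · exact Or.inr ⟨h', h.symm⟩
  · ext ⟨i, j⟩
    have hts := Finset.mem_powerset.1 ht
    simp only [SimpleGraph.fromRel_adj, Finset.mem_filter, hmem]
    constructor
    · rintro ⟨hij, -, h | h⟩
      · exact h
      · exact absurd ((hmem _).1 (hts h)) (not_lt.2 hij.le)
    · intro h
      have hij := (hmem _).1 (hts h)
      exact ⟨hij, hij.ne, Or.inl h⟩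
  · rw [Finset.prod_ite]
    congr 2
    ext x
    simp only [Finset.mem_filter, Finset.mem_sdiff, not_and]
    tauto

/-- The expected degree of `i` when the edge `{k, l}`, `k < l`, is present with probability
`p k l`. As in `graphProb`, the values `p k l` with `l ≤ k` play no role; `p` is not assumed to be
symmetric. -/
noncomputable def expDeg (p : Fin n → Fin n → ℝ) (i : Fin n) : ℝ :=
  ∑ j ∈ Finset.Ioi i, p i j + ∑ j ∈ Finset.Iio i, p j i

open scoped Classical in
lemma sum_pairs_incident (p : Fin n → Fin n → ℝ) (i : Fin n) :
    ∑ k, ∑ l ∈ Finset.Ioi k, (if k = i ∨ l = i then p k l else 0) = expDeg p i := by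
  have h : ∀ k, ∀ l ∈ Finset.Ioi k, (if k = i ∨ l = i then p k l else 0) =
      (if k = i then p i l else 0) + if l = i then p k i else 0 := by
    intro k l hl
    have hkl : k < l := Finset.mem_Ioi.1 hl
    by_cases hk : k = i
    · subst hk
      simp [hkl.ne']
    · by_cases hl' : l = i
      · subst hl'
        simp [hk]
      · simp [hk, hl']
  rw [Finset.sum_congr rfl fun k _ => Finset.sum_congr rfl (h k)]
  simp only [Finset.sum_add_distrib, expDeg]
  congr 1
  · rw [Finset.sum_eq_single i (fun k _ hk => by simp [hk]) (by simp)]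
    simp
  · simp only [Finset.sum_ite_eq', Finset.mem_Ioi]
    rw [← Finset.sum_filter]
    exact Finset.sum_congr (by ext; simp) fun _ _ => rfl

lemma sum_eq_Ioi_add_Iio (f : Fin n → ℝ) (i : Fin n) :
    ∑ j, f j = ∑ j ∈ Finset.Ioi i, f j + ∑ j ∈ Finset.Iio i, f j + f i := by
  have h2 : (Finset.univ : Finset (Fin n)) = (Finset.Ioi i ∪ Finset.Iio i) ∪ {i} := by
    ext j
    simp only [Finset.mem_univ, Finset.mem_union, Finset.mem_Ioi, Finset.mem_Iio,
      Finset.mem_singleton, true_iff]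
    rcases lt_trichotomy i j with h | h | h
    · exact Or.inl (Or.inl h)
    · exact Or.inr h.symm
    · exact Or.inl (Or.inr h)
  rw [h2, Finset.sum_union, Finset.sum_union, Finset.sum_singleton]
  · rw [Finset.disjoint_left]
    intro j hj hj'
    exact absurd (Finset.mem_Ioi.1 hj) (not_lt.2 (Finset.mem_Iio.1 hj').le)
  · rw [Finset.disjoint_left]
    intro j hj hj'
    simp only [Finset.mem_singleton] at hj'
    subst hj'
    simp at hj

open scoped Classical in
lemma degree_eq_expDeg (H : SimpleGraph (Fin n)) (i : Fin n) :
    (H.degree i : ℝ) = expDeg (fun k l => if H.Adj k l then 1 else 0) i := by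
  have h1 : (H.degree i : ℝ) = ∑ j, if H.Adj i j then (1 : ℝ) else 0 := by
    rw [Finset.sum_boole]
    congr 1
    rw [← SimpleGraph.card_neighborFinset_eq_degree]
    congr 1
    ext j
    simp
  rw [h1, sum_eq_Ioi_add_Iio _ i]
  simp [expDeg, SimpleGraph.adj_comm]

lemma expDeg_le {p : Fin n → Fin n → ℝ} {C : ℝ} (hC : 0 ≤ C) (hp : ∀ i j, p i j ≤ C) (i : Fin n) :
    expDeg p i ≤ n * C := by
  have h1 : ∑ j ∈ Finset.Ioi i, p i j ≤ (Finset.Ioi i).card * C := by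
    simpa using Finset.sum_le_card_nsmul (Finset.Ioi i) (fun j => p i j) C fun j _ => hp i j
  have h2 : ∑ j ∈ Finset.Iio i, p j i ≤ (Finset.Iio i).card * C := by
    simpa using Finset.sum_le_card_nsmul (Finset.Iio i) (fun j => p j i) C fun j _ => hp j i
  have h3 : (Finset.Ioi i).card + (Finset.Iio i).card ≤ n := by
    rw [Fin.card_Ioi, Fin.card_Iio]
    have := i.2
    omega
  have h4 : ((Finset.Ioi i).card : ℝ) + (Finset.Iio i).card ≤ n := by exact_mod_cast h3
  calc expDeg p i ≤ ((Finset.Ioi i).card + (Finset.Iio i).card) * C := by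
        rw [add_mul]
        exact add_le_add h1 h2
    _ ≤ n * C := by gcongr

lemma expDeg_sub (p p' : Fin n → Fin n → ℝ) (i : Fin n) :
    expDeg p i - expDeg p' i = expDeg (fun k l => p k l - p' k l) i := by
  simp only [expDeg, Finset.sum_sub_distrib]
  ring

lemma abs_expDeg_sub_le {p p' : Fin n → Fin n → ℝ} {C : ℝ} (h : ∀ i j, |p i j - p' i j| ≤ C)
    (i : Fin n) : |expDeg p i - expDeg p' i| ≤ n * C := by
  have hC : 0 ≤ C := (abs_nonneg _).trans (h i i)
  refine abs_sub_le_iff.2 ⟨?_, ?_⟩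
  · rw [expDeg_sub]
    exact expDeg_le hC (fun k l => (abs_sub_le_iff.1 (h k l)).1) i
  · rw [expDeg_sub]
    exact expDeg_le hC (fun k l => (abs_sub_le_iff.1 (h k l)).2) i

lemma expDeg_mul (q : Fin n → ℝ) (i : Fin n) :
    expDeg (fun k l => q k * q l) i = q i * ∑ j, q j - q i ^ 2 := by
  rw [sum_eq_Ioi_add_Iio q i, expDeg, mul_add, mul_add, Finset.mul_sum, Finset.mul_sum,
    Finset.sum_congr rfl fun j _ => mul_comm (q j) (q i)]
  ring

lemma graphProb_nonneg {p : Fin n → Fin n → ℝ} (h0 : ∀ i j, 0 ≤ p i j) (h1 : ∀ i j, p i j ≤ 1)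
    (H : SimpleGraph (Fin n)) : 0 ≤ graphProb p H := by
  classical
  refine Finset.prod_nonneg fun i _ => Finset.prod_nonneg fun j _ => ?_
  split_ifs
  · exact h0 i j
  · exact sub_nonneg.2 (h1 i j)

open scoped Classical in
/-- The exponential moments of a centred degree are subgaussian near the origin. -/
lemma sum_graphProb_mul_exp_le {p : Fin n → Fin n → ℝ} (h0 : ∀ i j, 0 ≤ p i j)
    (h1 : ∀ i j, p i j ≤ 1) (i : Fin n) {t : ℝ} (ht : |t| ≤ 1) :
    ∑ H : SimpleGraph (Fin n), graphProb p H * Real.exp (t * ((H.degree i : ℝ) - expDeg p i)) ≤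
      Real.exp (n * t ^ 2) := by
  -- The weighted sum over graphs factorises over the vertex pairs.
  have hH : ∀ H : SimpleGraph (Fin n), graphProb p H * Real.exp (t * (H.degree i : ℝ)) =
      ∏ k, ∏ l ∈ Finset.Ioi k, (if H.Adj k l then
        p k l * (if k = i ∨ l = i then Real.exp t else 1) else 1 - p k l) := by
    intro H
    rw [degree_eq_expDeg, ← sum_pairs_incident, Finset.mul_sum, Real.exp_sum, graphProb,
      ← Finset.prod_mul_distrib]
    refine Finset.prod_congr rfl fun k _ => ?_
    rw [Finset.mul_sum, Real.exp_sum, ← Finset.prod_mul_distrib]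
    refine Finset.prod_congr rfl fun l _ => ?_
    by_cases hkl : H.Adj k l <;> by_cases hi : k = i ∨ l = i <;> simp [hkl, hi]
  have hfac : ∀ k l, p k l * (if k = i ∨ l = i then Real.exp t else 1) + (1 - p k l) ≤
      Real.exp (if k = i ∨ l = i then p k l * (t + t ^ 2) else 0) := by
    intro k l
    split_ifs
    · have h2 : Real.exp t - 1 ≤ t + t ^ 2 := by
        have := (abs_le.1 (Real.abs_exp_sub_one_sub_id_le ht)).2
        linarith
      have h3 := mul_le_mul_of_nonneg_left h2 (h0 k l)
      have h4 := Real.add_one_le_exp (p k l * (t + t ^ 2))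
      linarith
    · simp
  have hsum : ∑ H : SimpleGraph (Fin n), graphProb p H * Real.exp (t * (H.degree i : ℝ)) ≤
      Real.exp (expDeg p i * (t + t ^ 2)) := by
    rw [Finset.sum_congr rfl fun H _ => hH H, sum_simpleGraph_prod_ite, ← sum_pairs_incident,
      Finset.sum_mul, Real.exp_sum]
    have hnn : ∀ k l, 0 ≤ p k l * (if k = i ∨ l = i then Real.exp t else 1) + (1 - p k l) :=
      fun k l => add_nonneg (mul_nonneg (h0 k l) (by split_ifs <;> positivity))
        (sub_nonneg.2 (h1 k l))
    refine Finset.prod_le_prod (fun k _ => Finset.prod_nonneg fun l _ => hnn k l) fun k _ => ?_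
    rw [Finset.sum_mul, Real.exp_sum]
    refine Finset.prod_le_prod (fun l _ => hnn k l) fun l _ => (hfac k l).trans_eq ?_
    split_ifs <;> simp
  calc ∑ H : SimpleGraph (Fin n), graphProb p H * Real.exp (t * ((H.degree i : ℝ) - expDeg p i))
      = (∑ H : SimpleGraph (Fin n), graphProb p H * Real.exp (t * (H.degree i : ℝ))) *
          Real.exp (-(t * expDeg p i)) := by
        rw [Finset.sum_mul]
        refine Finset.sum_congr rfl fun H _ => ?_
        rw [mul_sub, sub_eq_add_neg, Real.exp_add, mul_assoc]
    _ ≤ Real.exp (expDeg p i * (t + t ^ 2)) * Real.exp (-(t * expDeg p i)) := by gcongr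
    _ = Real.exp (expDeg p i * t ^ 2) := by
        rw [← Real.exp_add]
        congr 1
        ring
    _ ≤ Real.exp (n * t ^ 2) := by
        gcongr
        simpa using expDeg_le zero_le_one h1 i

open scoped Classical in
/-- Chernoff bound for a degree. -/
lemma sum_graphProb_deviation_le {p : Fin n → Fin n → ℝ} (h0 : ∀ i j, 0 ≤ p i j)
    (h1 : ∀ i j, p i j ≤ 1) (i : Fin n) {ε : ℝ} (hε : 0 ≤ ε) (hε2 : ε ≤ 2) :
    ∑ H : SimpleGraph (Fin n),
      (if n * ε ≤ |(H.degree i : ℝ) - expDeg p i| then graphProb p H else 0) ≤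
      2 * Real.exp (-(ε ^ 2 / 4) * n) := by
  -- The exponents `± ε / 2` minimise the bound `n t² - n ε |t|` of the logarithm.
  have ht : |ε / 2| ≤ 1 := by
    rw [abs_of_nonneg (by positivity)]
    linarith
  have ht' : |-(ε / 2)| ≤ 1 := by rwa [abs_neg]
  have hb : ∀ H : SimpleGraph (Fin n),
      (if n * ε ≤ |(H.degree i : ℝ) - expDeg p i| then graphProb p H else 0) ≤
      (graphProb p H * Real.exp (ε / 2 * ((H.degree i : ℝ) - expDeg p i)) +
        graphProb p H * Real.exp (-(ε / 2) * ((H.degree i : ℝ) - expDeg p i))) *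
        Real.exp (-(ε / 2 * (n * ε))) := by
    intro H
    have hp := graphProb_nonneg h0 h1 H
    split_ifs with h
    · set X := (H.degree i : ℝ) - expDeg p i
      rw [← mul_add, mul_assoc]
      refine le_mul_of_one_le_right hp ?_
      rw [add_mul, ← Real.exp_add, ← Real.exp_add]
      have e1 := Real.exp_pos (ε / 2 * X + -(ε / 2 * (n * ε)))
      have e2 := Real.exp_pos (-(ε / 2) * X + -(ε / 2 * (n * ε)))
      rcases le_abs.1 h with h | h
      · have : 1 ≤ Real.exp (ε / 2 * X + -(ε / 2 * (n * ε))) := by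
          refine Real.one_le_exp ?_
          have := mul_le_mul_of_nonneg_left h (by positivity : 0 ≤ ε / 2)
          linarith
        linarith
      · have : 1 ≤ Real.exp (-(ε / 2) * X + -(ε / 2 * (n * ε))) := by
          refine Real.one_le_exp ?_
          have := mul_le_mul_of_nonneg_left h (by positivity : 0 ≤ ε / 2)
          linarith
        linarith
    · positivity
  refine (Finset.sum_le_sum fun H _ => hb H).trans ?_
  rw [← Finset.sum_mul, Finset.sum_add_distrib]
  have e1 := sum_graphProb_mul_exp_le h0 h1 i ht
  have e2 := sum_graphProb_mul_exp_le h0 h1 i ht'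
  calc _ ≤ (Real.exp (n * (ε / 2) ^ 2) + Real.exp (n * (-(ε / 2)) ^ 2)) *
        Real.exp (-(ε / 2 * (n * ε))) := by gcongr
    _ = 2 * Real.exp (-(ε ^ 2 / 4) * n) := by
        rw [neg_sq, ← two_mul, mul_assoc, ← Real.exp_add]
        congr 2
        ring

end Finite

section Random

variable {Ω : Type*} [MeasurableSpace Ω] {P : Measure Ω}

/-- Borel–Cantelli with real bounds that hold eventually. -/
lemma ae_eventually_notMem_of_le_ofReal {s : ℕ → Set Ω} {u : ℕ → ℝ} (hu : Summable u)
    (h : ∀ᶠ n in atTop, P (s n) ≤ ENNReal.ofReal (u n)) :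
    ∀ᵐ ω ∂P, ∀ᶠ n in atTop, ω ∉ s n := by
  obtain ⟨N, hN⟩ := eventually_atTop.1 h
  have h1 : ∑' n, P (if N ≤ n then s n else ∅) ≠ ⊤ := by
    refine ne_top_of_le_ne_top hu.tsum_ofReal_ne_top (ENNReal.tsum_le_tsum fun n => ?_)
    split_ifs with hn
    · exact hN n hn
    · simp
  filter_upwards [ae_eventually_notMem h1] with ω hω
  filter_upwards [hω, eventually_ge_atTop N] with n h2 hn
  simpa [hn] using h2

variable [IsProbabilityMeasure P]

lemma measurable_expDeg_edgeProb {n K : ℕ} (M : Matrix (Fin K) (Fin K) ℝ) (g : Fin n → Fin K)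
    (i : Fin n) : Measurable fun v : Fin n → ℝ => expDeg (edgeProb M g v) i := by
  unfold expDeg edgeProb
  fun_prop

open scoped Classical in
/-- Uniform Chernoff bound for the degrees of a degree-corrected stochastic block model. -/
lemma IsDCSBM.measure_deviation_le {μ : Measure ℝ} {n K : ℕ} {M : Matrix (Fin K) (Fin K) ℝ}
    {g : Fin n → Fin K} {q : Ω → Fin n → ℝ} {G : Ω → SimpleGraph (Fin n)}
    (h : IsDCSBM P μ M g q G)
    (hp : ∀ᵐ ω ∂P, ∀ i j, edgeProb M g (q ω) i j ∈ Icc (0 : ℝ) 1) {ε : ℝ} (hε : 0 ≤ ε)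
    (hε2 : ε ≤ 2) :
    P {ω | ∃ i, n * ε ≤ |((G ω).degree i : ℝ) - expDeg (edgeProb M g (q ω)) i|} ≤
      ENNReal.ofReal (n * (2 * Real.exp (-(ε ^ 2 / 4) * n))) := by
  have hm : MeasurableSpace.comap q inferInstance ≤ ‹MeasurableSpace Ω› :=
    h.measurable_weight.comap_le
  let B : Fin n → SimpleGraph (Fin n) → Set Ω := fun i H =>
    q ⁻¹' {v | n * ε ≤ |(H.degree i : ℝ) - expDeg (edgeProb M g v) i|}
  have hB : ∀ i H, MeasurableSet[MeasurableSpace.comap q inferInstance] (B i H) := by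
    intro i H
    refine ⟨_, ?_, rfl⟩
    have := measurable_expDeg_edgeProb M g i
    exact measurableSet_le measurable_const (measurable_const.sub this).abs
  have hfix : ∀ i, P.real {ω | n * ε ≤ |((G ω).degree i : ℝ) - expDeg (edgeProb M g (q ω)) i|} ≤
      2 * Real.exp (-(ε ^ 2 / 4) * n) := by
    intro i
    have hsub : {ω | n * ε ≤ |((G ω).degree i : ℝ) - expDeg (edgeProb M g (q ω)) i|} ⊆
        ⋃ H ∈ (Finset.univ : Finset (SimpleGraph (Fin n))), {ω | G ω = H} ∩ B i H := by
      intro ω hω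
      simp only [mem_iUnion]
      exact ⟨G ω, Finset.mem_univ _, rfl, hω⟩
    have hint : ∀ H, Integrable (fun ω => graphProb (edgeProb M g (q ω)) H) P := fun H =>
      integrable_condExp.congr (h.condLaw_graph H)
    -- The deviation event for a fixed graph is measurable with respect to the weights, so that the
    -- conditional law can be integrated over it.
    have hH : ∀ H, P.real ({ω | G ω = H} ∩ B i H) =
        ∫ ω, (B i H).indicator (fun ω => graphProb (edgeProb M g (q ω)) H) ω ∂P := by
      intro H
      have hi : Integrable ({ω | G ω = H}.indicator fun _ => (1 : ℝ)) P :=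
        (integrable_const 1).indicator (h.measurableSet_graph H)
      rw [integral_indicator (hm _ (hB i H)),
        ← setIntegral_congr_ae (hm _ (hB i H)) ((h.condLaw_graph H).mono fun ω hω _ => hω),
        setIntegral_condExp hm hi (hB i H), setIntegral_indicator (h.measurableSet_graph H)]
      simp [inter_comm]
    calc _ ≤ P.real (⋃ H ∈ (Finset.univ : Finset (SimpleGraph (Fin n))), {ω | G ω = H} ∩ B i H) :=
          measureReal_mono hsub (measure_ne_top _ _)
      _ ≤ ∑ H, P.real ({ω | G ω = H} ∩ B i H) := measureReal_biUnion_finset_le _ _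
      _ = ∫ ω, ∑ H, (B i H).indicator (fun ω => graphProb (edgeProb M g (q ω)) H) ω ∂P := by
          rw [integral_finsetSum _ fun H _ => (hint H).indicator (hm _ (hB i H))]
          exact Finset.sum_congr rfl fun H _ => hH H
      _ ≤ ∫ ω, 2 * Real.exp (-(ε ^ 2 / 4) * n) ∂P := by
          refine integral_mono_ae
            (integrable_finsetSum _ fun H _ => (hint H).indicator (hm _ (hB i H)))
            (integrable_const _) (hp.mono fun ω hω => ?_)
          refine le_trans (le_of_eq ?_) (sum_graphProb_deviation_le (fun k l => (hω k l).1)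
            (fun k l => (hω k l).2) i hε hε2)
          exact Finset.sum_congr rfl fun H _ => by
            simp only [B, indicator, mem_preimage, Set.mem_ofPred_eq]
      _ = 2 * Real.exp (-(ε ^ 2 / 4) * n) := by simp
  have hU : {ω | ∃ i, n * ε ≤ |((G ω).degree i : ℝ) - expDeg (edgeProb M g (q ω)) i|} =
      ⋃ i ∈ (Finset.univ : Finset (Fin n)),
        {ω | n * ε ≤ |((G ω).degree i : ℝ) - expDeg (edgeProb M g (q ω)) i|} := by
    ext ω
    simp
  rw [← ofReal_measureReal, hU]
  refine ENNReal.ofReal_le_ofReal ((measureReal_biUnion_finset_le _ _).trans ?_)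
  refine (Finset.sum_le_card_nsmul _ _ _ fun i _ => hfix i).trans_eq ?_
  simp

/-- Law of large numbers for triangular arrays of bounded variables; no relation between the rows
is needed. -/
lemma ae_tendsto_average {μ : Measure ℝ} {q : ∀ n : ℕ, Ω → Fin n → ℝ}
    (h : ∀ᶠ n in atTop, Measurable (q n) ∧ (∀ i, P.map (fun ω => q n ω i) = μ) ∧
      iIndepFun (fun i ω => q n ω i) P)
    {f : ℝ → ℝ} (hf : Measurable f) (hb : ∀ᵐ x ∂μ, f x ∈ Icc (0 : ℝ) 1) :
    ∀ᵐ ω ∂P, Tendsto (fun n => (∑ i, f (q n ω i)) / n) atTop (𝓝 (∫ x, f x ∂μ)) := by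
  have hdev : ∀ ε : ℝ, 0 < ε → ∀ᵐ ω ∂P, ∀ᶠ n : ℕ in atTop,
      |(∑ i, (f (q n ω i) - ∫ x, f x ∂μ))| < n * ε := by
    intro ε hε
    have hs : Summable fun n : ℕ => 2 * Real.exp (-(2 * ε ^ 2) * n) := by
      have := Real.summable_pow_mul_exp_neg_nat_mul 0 (r := 2 * ε ^ 2) (by positivity)
      simpa using this.mul_left 2
    refine (ae_eventually_notMem_of_le_ofReal (P := P)
      (s := fun n => {ω | n * ε ≤ |(∑ i, (f (q n ω i) - ∫ x, f x ∂μ))|}) hs ?_).mono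
      fun ω hω => hω.mono fun n hn => not_le.1 hn
    filter_upwards [h, eventually_gt_atTop 0] with n hn hn0
    obtain ⟨hq, hl, hi⟩ := hn
    have hn0' : (0 : ℝ) < n := by exact_mod_cast hn0
    have hqi : ∀ i, Measurable fun ω => q n ω i := fun i => (measurable_pi_apply i).comp hq
    have hmean : ∀ i, ∫ ω, f (q n ω i) ∂P = ∫ x, f x ∂μ := fun i => by
      rw [← hl i, integral_map (hqi i).aemeasurable hf.aestronglyMeasurable]
    have hsub : ∀ i, HasSubgaussianMGF (fun ω => f (q n ω i) - ∫ x, f x ∂μ)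
        ((‖(1 : ℝ) - 0‖₊ / 2) ^ 2) P := by
      intro i
      rw [← hmean i]
      refine hasSubgaussianMGF_of_mem_Icc (hf.comp (hqi i)).aemeasurable ?_
      rw [← hl i] at hb
      exact ae_of_ae_map (hqi i).aemeasurable hb
    have hind : iIndepFun (fun i ω => f (q n ω i) - ∫ x, f x ∂μ) P :=
      hi.comp (fun _ x => f x - ∫ x, f x ∂μ) fun _ => hf.sub_const _
    have hind' : iIndepFun (fun i ω => -(f (q n ω i) - ∫ x, f x ∂μ)) P :=
      hi.comp (fun _ x => -(f x - ∫ x, f x ∂μ)) fun _ => (hf.sub_const _).neg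
    have e1 := HasSubgaussianMGF.measure_sum_ge_le_of_iIndepFun hind (s := Finset.univ)
      (fun i _ => hsub i) (ε := n * ε) (by positivity)
    have e2 := HasSubgaussianMGF.measure_sum_ge_le_of_iIndepFun hind' (s := Finset.univ)
      (fun i _ => (hsub i).neg) (ε := n * ε) (by positivity)
    have hexp : -(n * ε) ^ 2 / (2 * ((∑ _i : Fin n, (‖(1 : ℝ) - 0‖₊ / 2) ^ 2 : NNReal) : ℝ)) =
        -(2 * ε ^ 2) * n := by
      simp
      field_simp
    rw [hexp] at e1 e2
    rw [← ofReal_measureReal]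
    refine ENNReal.ofReal_le_ofReal ?_
    calc _ ≤ P.real ({ω | n * ε ≤ ∑ i, (f (q n ω i) - ∫ x, f x ∂μ)} ∪
          {ω | n * ε ≤ ∑ i, -(f (q n ω i) - ∫ x, f x ∂μ)}) := by
          refine measureReal_mono fun ω hω => ?_
          rcases le_abs.1 (show n * ε ≤ |(∑ i, (f (q n ω i) - ∫ x, f x ∂μ))| from hω) with h | h
          · exact Or.inl h
          · refine Or.inr ?_
            rw [Set.mem_ofPred_eq, Finset.sum_neg_distrib]
            exact h
      _ ≤ _ := (measureReal_union_le _ _).trans (add_le_add e1 e2)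
      _ = _ := by ring
  have hall : ∀ᵐ ω ∂P, ∀ k : ℕ, ∀ᶠ n : ℕ in atTop,
      |(∑ i, (f (q n ω i) - ∫ x, f x ∂μ))| < n * (1 / ((k : ℝ) + 1)) :=
    ae_all_iff.2 fun k => hdev _ Nat.one_div_pos_of_nat
  filter_upwards [hall] with ω hω
  rw [Metric.tendsto_nhds]
  intro ε hε
  obtain ⟨k, hk⟩ := exists_nat_one_div_lt hε
  filter_upwards [hω k, eventually_gt_atTop 0] with n hn hn0
  have hn0' : (0 : ℝ) < n := by exact_mod_cast hn0
  have he : (∑ i, f (q n ω i)) / n - ∫ x, f x ∂μ = (∑ i, (f (q n ω i) - ∫ x, f x ∂μ)) / n := by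
    rw [Finset.sum_sub_distrib]
    simp
    field_simp
  rw [Real.dist_eq, he, abs_div, abs_of_pos hn0', div_lt_iff₀ hn0']
  nlinarith

end Random

/-! ### Consistency of the estimated weights -/

section Estimated

variable {n : ℕ}

lemma integral_muHat (G : SimpleGraph (Fin n)) (f : ℝ → ℝ) :
    ∫ x, f x ∂(muHat G) = (∑ i, f (qHat G i)) / n := by
  rw [muHat, integral_smul_measure, integral_finsetSum_measure fun i _ =>
    integrable_dirac (by simp)]
  simp only [integral_dirac, ENNReal.toReal_inv, ENNReal.toReal_natCast, smul_eq_mul]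
  rw [inv_mul_eq_div]

lemma isProbabilityMeasure_muHat (hn : n ≠ 0) (G : SimpleGraph (Fin n)) :
    IsProbabilityMeasure (muHat G) := by
  constructor
  simp only [muHat, Measure.smul_apply, Measure.finsetSum_apply, measure_univ, Finset.sum_const,
    Finset.card_univ, Fintype.card_fin, nsmul_eq_mul, mul_one, smul_eq_mul]
  exact ENNReal.inv_mul_cancel (by exact_mod_cast hn) (ENNReal.natCast_ne_top n)

lemma muHat_compl_eq_zero {G : SimpleGraph (Fin n)} {s : Set ℝ} (hs : MeasurableSet s)
    (h : ∀ i, qHat G i ∈ s) : muHat G sᶜ = 0 := by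
  simp [muHat, Measure.smul_apply, Measure.finsetSum_apply, Measure.dirac_apply' _ hs.compl, h]

variable {K : ℕ} {q : ∀ n : ℕ, Fin n → ℝ} {G : ∀ n : ℕ, SimpleGraph (Fin n)}
  {M : ℕ → Matrix (Fin K) (Fin K) ℝ} {g : ∀ n : ℕ, Fin n → Fin K} {B m : ℝ}

lemma abs_edgeProb_sub_le {M : Matrix (Fin K) (Fin K) ℝ} {g : Fin n → Fin K} {v : Fin n → ℝ}
    (hM : ∀ a b, |M a b| ≤ B) (hv : ∀ i, v i ∈ Icc (0 : ℝ) 1) (i j : Fin n) :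
    |edgeProb M g v i j - v i * v j| ≤ B / Real.sqrt n := by
  have h0 : 0 ≤ v i * v j := mul_nonneg (hv i).1 (hv j).1
  have h1 : v i * v j ≤ 1 := mul_le_one₀ (hv i).2 (hv j).1 (hv j).2
  have he : edgeProb M g v i j - v i * v j = v i * v j * (M (g i) (g j) / Real.sqrt n) := by
    unfold edgeProb
    ring
  rw [he, abs_mul, abs_of_nonneg h0, abs_div, abs_of_nonneg (Real.sqrt_nonneg _)]
  have h2 : |M (g i) (g j)| / Real.sqrt n ≤ B / Real.sqrt n := by
    gcongr
    exact hM _ _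
  exact (mul_le_of_le_one_left (by positivity) h1).trans h2

lemma tendsto_div_sqrt_natCast (B : ℝ) :
    Tendsto (fun n : ℕ => B / Real.sqrt n) atTop (𝓝 0) :=
  (Real.tendsto_sqrt_atTop.comp tendsto_natCast_atTop_atTop).const_div_atTop B

open scoped Classical in
/-- Concentrated degrees are close to `n m q_i`, uniformly in the vertex `i`. -/
lemma eventually_abs_degree_div_sub_lt (hM : ∀ n a b, |M n a b| ≤ B)
    (hq : ∀ᶠ n in atTop, ∀ i, q n i ∈ Icc (0 : ℝ) 1)
    (hmean : Tendsto (fun n => (∑ i, q n i) / n) atTop (𝓝 m))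
    (hdev : ∀ ε : ℝ, 0 < ε → ∀ᶠ n : ℕ in atTop, ∀ i,
      |((G n).degree i : ℝ) - expDeg (edgeProb (M n) (g n) (q n)) i| < n * ε)
    {ε : ℝ} (hε : 0 < ε) :
    ∀ᶠ n : ℕ in atTop, ∀ i, |((G n).degree i : ℝ) / n - q n i * m| < ε := by
  have hε4 : 0 < ε / 4 := by positivity
  have hB := (tendsto_order.1 (tendsto_div_sqrt_natCast B)).2 _ hε4
  have h1 := (tendsto_order.1 (tendsto_const_div_atTop_nhds_zero_nat (1 : ℝ))).2 _ hε4
  filter_upwards [hq, hdev _ hε4, hB, h1, Metric.tendsto_nhds.1 hmean _ hε4,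
    eventually_gt_atTop 0] with n hqn hdn hBn h1n hmn hn i
  have hn' : (0 : ℝ) < n := by exact_mod_cast hn
  have e1 := abs_lt.1 (hdn i)
  have e2 := abs_le.1 (abs_expDeg_sub_le (p' := fun k l => q n k * q n l)
    (abs_edgeProb_sub_le (g := g n) (hM n) hqn) i)
  rw [expDeg_mul] at e2
  have e3 := abs_lt.1 hmn
  have e4 : (n : ℝ) * (B / Real.sqrt n) < n * (ε / 4) := mul_lt_mul_of_pos_left hBn hn'
  have e5 : (1 : ℝ) < n * (ε / 4) := by
    rw [div_lt_iff₀ hn'] at h1n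
    linarith
  have e6 : q n i ^ 2 ≤ 1 := pow_le_one₀ (hqn i).1 (hqn i).2
  have e7 : |q n i * (∑ j, q n j) - n * (q n i * m)| ≤ n * (ε / 4) := by
    have he : q n i * (∑ j, q n j) - n * (q n i * m) = n * (q n i * ((∑ j, q n j) / n - m)) := by
      field_simp
    rw [he, abs_mul, abs_mul, abs_of_pos hn', abs_of_nonneg (hqn i).1]
    have : q n i * |(∑ j, q n j) / n - m| ≤ ε / 4 :=
      (mul_le_of_le_one_left (abs_nonneg _) (hqn i).2).trans hmn.le
    gcongr
  have e8 := abs_le.1 e7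
  have he : ((G n).degree i : ℝ) / n - q n i * m =
      (((G n).degree i : ℝ) - n * (q n i * m)) / n := by
    field_simp
  rw [he, abs_div, abs_of_pos hn', div_lt_iff₀ hn', abs_lt]
  have e9 := sq_nonneg (q n i)
  constructor <;> linarith

open scoped Classical in
/-- The estimated weights are uniformly consistent as soon as the degrees concentrate. -/
lemma eventually_abs_qHat_sub_lt (hM : ∀ n a b, |M n a b| ≤ B)
    (hq : ∀ᶠ n in atTop, ∀ i, q n i ∈ Icc (0 : ℝ) 1) (hm : 0 < m)
    (hmean : Tendsto (fun n => (∑ i, q n i) / n) atTop (𝓝 m))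
    (hdev : ∀ ε : ℝ, 0 < ε → ∀ᶠ n : ℕ in atTop, ∀ i,
      |((G n).degree i : ℝ) - expDeg (edgeProb (M n) (g n) (q n)) i| < n * ε)
    {ε : ℝ} (hε : 0 < ε) : ∀ᶠ n : ℕ in atTop, ∀ i, |qHat (G n) i - q n i| < ε := by
  have hdeg : ∀ ε : ℝ, 0 < ε → ∀ᶠ n : ℕ in atTop, ∀ i,
      |((G n).degree i : ℝ) / n - q n i * m| < ε := fun ε hε =>
    eventually_abs_degree_div_sub_lt hM hq hmean hdev hε
  have hsum : Tendsto (fun n : ℕ => (∑ i, ((G n).degree i : ℝ) / n) / n) atTop (𝓝 (m * m)) := by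
    have h1 : Tendsto (fun n : ℕ => (∑ i, ((G n).degree i : ℝ) / n) / n - (∑ i, q n i) / n * m)
        atTop (𝓝 0) := by
      rw [Metric.tendsto_nhds]
      intro δ hδ
      filter_upwards [hdeg _ (half_pos hδ), eventually_gt_atTop 0] with n hn hn0
      have hn' : (0 : ℝ) < n := by exact_mod_cast hn0
      rw [Real.dist_eq, sub_zero, div_mul_eq_mul_div, ← sub_div, Finset.sum_mul,
        ← Finset.sum_sub_distrib, abs_div, abs_of_pos hn', div_lt_iff₀ hn']
      calc _ ≤ ∑ i : Fin n, |((G n).degree i : ℝ) / n - q n i * m| :=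
            Finset.abs_sum_le_sum_abs _ _
        _ ≤ ∑ _i : Fin n, δ / 2 := Finset.sum_le_sum fun i _ => (hn i).le
        _ = n * (δ / 2) := by simp
        _ < δ * n := by nlinarith
    simpa using h1.add (hmean.mul_const m)
  have hsqrt : Tendsto (fun n : ℕ => Real.sqrt ((∑ i, ((G n).degree i : ℝ) / n) / n)) atTop
      (𝓝 m) := by
    have := (Real.continuous_sqrt.tendsto _).comp hsum
    rwa [Real.sqrt_mul_self hm.le] at this
  have hδ : 0 < ε * m / 4 := by positivity
  filter_upwards [hq, hdeg _ hδ, Metric.tendsto_nhds.1 hsqrt _ hδ,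
    (tendsto_order.1 hsqrt).1 _ (half_lt_self hm), eventually_gt_atTop 0]
    with n hqn hdn hsn hrn hn i
  have hn' : (0 : ℝ) < n := by exact_mod_cast hn
  set r := Real.sqrt ((∑ i, ((G n).degree i : ℝ) / n) / n) with hr
  have hr0 : 0 < r := (half_pos hm).trans hrn
  have hqh : qHat (G n) i = (G n).degree i / n / r := by
    have h2 : Real.sqrt (∑ j, ((G n).degree j : ℝ)) = n * r := by
      rw [hr, ← Finset.sum_div, div_div, Real.sqrt_div (by positivity),
        Real.sqrt_mul_self hn'.le]
      field_simp
    unfold qHat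
    rw [div_div, ← h2]
  have e1 := abs_lt.1 (hdn i)
  have e2 := abs_lt.1 hsn
  have he : qHat (G n) i - q n i = ((G n).degree i / n - q n i * r) / r := by
    rw [hqh]
    field_simp
  -- `d_i / n` is close to `q_i m` and `r` is close to `m > 0`.
  rw [he, abs_div, abs_of_pos hr0, div_lt_iff₀ hr0]
  have e3 : |q n i * (r - m)| ≤ ε * m / 4 := by
    rw [abs_mul, abs_of_nonneg (hqn i).1]
    exact (mul_le_of_le_one_left (abs_nonneg _) (hqn i).2).trans hsn.le
  have e4 := abs_le.1 e3
  have e5 : ε * (m / 2) < ε * r := mul_lt_mul_of_pos_left hrn hε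
  rw [abs_lt]
  constructor <;> linarith

/-- Convergence of moments implies convergence of averages of continuous functions. -/
lemma tendsto_average_of_tendsto_moments {μ : Measure ℝ} [IsProbabilityMeasure μ] {a b : ℝ}
    (hμ : CarriedBy μ a b) (hq : ∀ᶠ n in atTop, ∀ i, q n i ∈ Icc a b)
    (hmom : ∀ k : ℕ, Tendsto (fun n => (∑ i, q n i ^ k) / n) atTop (𝓝 (∫ x, x ^ k ∂μ)))
    {f : ℝ → ℝ} (hf : ContinuousOn f (Icc a b)) :
    Tendsto (fun n => (∑ i, f (q n i)) / n) atTop (𝓝 (∫ x, f x ∂μ)) := by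
  have hint : ∀ {f : ℝ → ℝ}, ContinuousOn f (Icc a b) → Integrable f μ := by
    intro f hf
    obtain ⟨C, hC⟩ := isCompact_Icc.exists_bound_of_continuousOn hf
    refine hμ.integrable ?_ hC
    rw [← Measure.restrict_eq_self_of_ae_mem hμ.ae_mem]
    exact hf.aestronglyMeasurable measurableSet_Icc
  have hpoly : ∀ p : Polynomial ℝ,
      Tendsto (fun n => (∑ i, p.eval (q n i)) / n) atTop (𝓝 (∫ x, p.eval x ∂μ)) := by
    intro p
    induction p using Polynomial.induction_on' with
    | add p r hp hr =>
      simp only [Polynomial.eval_add, Finset.sum_add_distrib, add_div]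
      rw [integral_add (hint p.continuous.continuousOn) (hint r.continuous.continuousOn)]
      exact hp.add hr
    | monomial k c =>
      simp only [Polynomial.eval_monomial, ← Finset.mul_sum, mul_div_assoc, integral_const_mul]
      exact (hmom k).const_mul c
  rw [Metric.tendsto_nhds]
  intro ε hε
  have hε3 : 0 < ε / 3 := by positivity
  obtain ⟨p, hp⟩ := exists_polynomial_near_of_continuousOn a b f hf _ hε3
  have h1 : |∫ x, p.eval x ∂μ - ∫ x, f x ∂μ| ≤ ε / 3 := by
    rw [← integral_sub (hint p.continuous.continuousOn) (hint hf)]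
    have := norm_integral_le_of_norm_le_const (μ := μ) (C := ε / 3)
      (f := fun x => p.eval x - f x) (hμ.ae_mem.mono fun x hx => (hp x hx).le)
    simpa using this
  filter_upwards [hq, Metric.tendsto_nhds.1 (hpoly p) _ hε3, eventually_gt_atTop 0]
    with n hqn hn hn0
  have hn' : (0 : ℝ) < n := by exact_mod_cast hn0
  have h2 : |(∑ i, p.eval (q n i)) / n - (∑ i, f (q n i)) / n| ≤ ε / 3 := by
    rw [← sub_div, ← Finset.sum_sub_distrib, abs_div, abs_of_pos hn', div_le_iff₀ hn']
    calc _ ≤ ∑ i, |p.eval (q n i) - f (q n i)| := Finset.abs_sum_le_sum_abs _ _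
      _ ≤ ∑ _i : Fin n, ε / 3 := Finset.sum_le_sum fun i _ => (hp _ (hqn i)).le
      _ = ε / 3 * n := by simp [mul_comm]
  rw [Real.dist_eq] at hn ⊢
  have e1 := abs_le.1 h1
  have e2 := abs_le.1 h2
  have e3 := abs_lt.1 hn
  rw [abs_lt]
  constructor <;> linarith

/-- The empirical measures of uniformly consistent weights converge to the weight distribution. -/
lemma supportedConv_muHat {μ : Measure ℝ} [IsProbabilityMeasure μ] {a b : ℝ}
    (hμ : CarriedBy μ a b) (hq : ∀ᶠ n in atTop, ∀ i, q n i ∈ Icc a b)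
    (hsupp : ∀ᶠ n in atTop, ∀ i, q n i ∈ μ.support)
    (hmom : ∀ k : ℕ, Tendsto (fun n => (∑ i, q n i ^ k) / n) atTop (𝓝 (∫ x, x ^ k ∂μ)))
    (hhat : ∀ ε : ℝ, 0 < ε → ∀ᶠ n in atTop, ∀ i, |qHat (G n) i - q n i| < ε) :
    SupportedConv atTop (fun n => muHat (G n)) μ (a / 2) ((1 + b) / 2) := by
  have ha := hμ.pos
  have hb := hμ.lt_one
  have hmem : ∀ᶠ n in atTop, ∀ i, qHat (G n) i ∈ Icc (a / 2) ((1 + b) / 2) := by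
    filter_upwards [hq, hhat (a / 2) (by positivity), hhat ((1 - b) / 2) (by linarith)]
      with n h1 h2 h3 i
    have e1 := abs_lt.1 (h2 i)
    have e2 := abs_lt.1 (h3 i)
    have e3 := h1 i
    exact ⟨by linarith [e3.1], by linarith [e3.2]⟩
  refine ⟨?_, ?_, fun f hf => ?_, fun U hU hs => ?_⟩
  · filter_upwards [eventually_gt_atTop 0] with n hn
    exact isProbabilityMeasure_muHat hn.ne' _
  · filter_upwards [hmem] with n hn
    exact ⟨by positivity, by linarith, muHat_compl_eq_zero measurableSet_Icc hn⟩
  · have hsub : Icc a b ⊆ Icc (a / 2) ((1 + b) / 2) :=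
      Icc_subset_Icc (by linarith) (by linarith)
    have h1 := tendsto_average_of_tendsto_moments hμ hq hmom (hf.mono hsub)
    have h2 : Tendsto (fun n : ℕ => (∑ i, f (qHat (G n) i)) / n - (∑ i, f (q n i)) / n) atTop
        (𝓝 0) := by
      rw [Metric.tendsto_nhds]
      intro ε hε
      obtain ⟨δ, hδ, huc⟩ := Metric.uniformContinuousOn_iff.1
        (isCompact_Icc.uniformContinuousOn_of_continuous hf) (ε / 2) (half_pos hε)
      filter_upwards [hq, hmem, hhat δ hδ, eventually_gt_atTop 0] with n hqn hmn hdn hn0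
      have hn' : (0 : ℝ) < n := by exact_mod_cast hn0
      rw [Real.dist_eq, sub_zero, ← sub_div, ← Finset.sum_sub_distrib, abs_div, abs_of_pos hn',
        div_lt_iff₀ hn']
      calc _ ≤ ∑ i, |f (qHat (G n) i) - f (q n i)| := Finset.abs_sum_le_sum_abs _ _
        _ ≤ ∑ _i : Fin n, ε / 2 := Finset.sum_le_sum fun i _ =>
            (huc _ (hmn i) _ (hsub (hqn i)) (hdn i)).le
        _ = n * (ε / 2) := by simp
        _ < ε * n := by nlinarith
    simp only [integral_muHat]
    simpa using h2.add h1
  · have hcomp : IsCompact μ.support :=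
      isCompact_Icc.of_isClosed_subset Measure.isClosed_support hμ.support_subset
    obtain ⟨δ, hδ, hthick⟩ := hcomp.exists_thickening_subset_open hU hs
    filter_upwards [hsupp, hhat δ hδ] with n hsn hdn
    exact muHat_compl_eq_zero hU.measurableSet fun i =>
      hthick (Metric.mem_thickening_iff.2 ⟨_, hsn i, hdn i⟩)

end Estimated

/-- Almost surely, the empirical measure of the estimated weights converges to the weight
distribution, together with its support. -/
theorem ae_supportedConv_muHat {Ω : Type*} [MeasurableSpace Ω] {P : Measure Ω}
    [IsProbabilityMeasure P] {μ : Measure ℝ} [IsProbabilityMeasure μ] {a b : ℝ}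
    (hμ : CarriedBy μ a b) {K : ℕ} {M : ℕ → Matrix (Fin K) (Fin K) ℝ} {B : ℝ}
    (hM : ∀ n a b, |M n a b| ≤ B) {g : ∀ n : ℕ, Fin n → Fin K} {q : ∀ n : ℕ, Ω → Fin n → ℝ}
    {G : ∀ n : ℕ, Ω → SimpleGraph (Fin n)}
    (hG : ∀ᶠ n in atTop, IsDCSBM P μ (M n) (g n) (q n) (G n)) :
    ∀ᵐ ω ∂P, SupportedConv atTop (fun n => muHat (G n ω)) μ (a / 2) ((1 + b) / 2) := by
  classical
  have hb := hμ.lt_one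
  have hIcc := hμ.Icc_subset
  have hcoord : ∀ s : Set ℝ, MeasurableSet s → μ sᶜ = 0 → ∀ n,
      IsDCSBM P μ (M n) (g n) (q n) (G n) → ∀ᵐ ω ∂P, ∀ i, q n ω i ∈ s := by
    intro s hs hs0 n hn
    refine ae_all_iff.2 fun i => ?_
    have hqi : Measurable fun ω => q n ω i := (measurable_pi_apply i).comp hn.measurable_weight
    have : ∀ᵐ x ∂(P.map fun ω => q n ω i), x ∈ s := by
      rw [hn.law_weight i]
      exact mem_ae_iff.2 hs0
    exact ae_of_ae_map hqi.aemeasurable this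
  have hev : ∀ s : Set ℝ, MeasurableSet s → μ sᶜ = 0 →
      ∀ᵐ ω ∂P, ∀ᶠ n in atTop, ∀ i, q n ω i ∈ s := by
    intro s hs hs0
    obtain ⟨N, hN⟩ := eventually_atTop.1 hG
    have : ∀ᵐ ω ∂P, ∀ n, N ≤ n → ∀ i, q n ω i ∈ s :=
      ae_all_iff.2 fun n => by
        by_cases hn : N ≤ n
        · exact (hcoord s hs hs0 n (hN n hn)).mono fun ω h _ => h
        · exact Eventually.of_forall fun ω h => absurd h hn
    exact this.mono fun ω h => eventually_atTop.2 ⟨N, h⟩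
  have hmom : ∀ᵐ ω ∂P, ∀ k : ℕ,
      Tendsto (fun n => (∑ i, q n ω i ^ k) / n) atTop (𝓝 (∫ x, x ^ k ∂μ)) := by
    refine ae_all_iff.2 fun k => ae_tendsto_average (f := fun x => x ^ k)
      (hG.mono fun n hn => ⟨hn.measurable_weight, hn.law_weight, hn.indep_weight⟩) (by fun_prop) ?_
    filter_upwards [hμ.ae_mem] with x hx
    exact ⟨pow_nonneg (hIcc hx).1.le _, pow_le_one₀ (hIcc hx).1.le (hIcc hx).2.le⟩
  have hprob : ∀ᶠ n in atTop, ∀ᵐ ω ∂P, ∀ i j,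
      edgeProb (M n) (g n) (q n ω) i j ∈ Icc (0 : ℝ) 1 := by
    -- The correction is of order `1 / √n`, while `q_i q_j ∈ [a², b]` stays away from `0` and `1`.
    have hgap : 0 < min (a * a) (1 - b) := by
      have := hμ.pos
      exact lt_min (by positivity) (by linarith)
    filter_upwards [hG, (tendsto_order.1 (tendsto_div_sqrt_natCast B)).2 _ hgap] with n hn hBn
    filter_upwards [hcoord _ measurableSet_Icc hμ.null n hn] with ω hω i j
    have e1 := abs_le.1 (abs_edgeProb_sub_le (g := g n) (hM n)
      (fun i => ⟨(hIcc (hω i)).1.le, (hIcc (hω i)).2.le⟩) i j)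
    have e2 : a * a ≤ q n ω i * q n ω j :=
      mul_le_mul (hω i).1 (hω j).1 hμ.pos.le (hμ.pos.le.trans (hω i).1)
    have e3 : q n ω i * q n ω j ≤ b := by
      have := mul_le_of_le_one_right (hIcc (hω i)).1.le (hIcc (hω j)).2.le
      linarith [(hω i).2]
    have e4 := min_le_left (a * a) (1 - b)
    have e5 := min_le_right (a * a) (1 - b)
    constructor <;> linarith
  have hdev : ∀ ε : ℝ, 0 < ε → ε ≤ 2 → ∀ᵐ ω ∂P, ∀ᶠ n : ℕ in atTop, ∀ i,
      |((G n ω).degree i : ℝ) - expDeg (edgeProb (M n) (g n) (q n ω)) i| < n * ε := by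
    intro ε hε hε2
    have hs : Summable fun n : ℕ => n * (2 * Real.exp (-(ε ^ 2 / 4) * n)) := by
      have := (Real.summable_pow_mul_exp_neg_nat_mul 1 (r := ε ^ 2 / 4) (by positivity)).mul_left 2
      refine this.congr fun n => ?_
      ring
    refine (ae_eventually_notMem_of_le_ofReal (P := P) hs (s := fun n => {ω | ∃ i,
      n * ε ≤ |((G n ω).degree i : ℝ) - expDeg (edgeProb (M n) (g n) (q n ω)) i|}) ?_).mono
      fun ω hω => hω.mono fun n hn i => not_le.1 fun hle => hn ⟨i, hle⟩
    filter_upwards [hG, hprob] with n hn hpn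
    exact hn.measure_deviation_le hpn hε.le hε2
  have hdev' : ∀ᵐ ω ∂P, ∀ k : ℕ, ∀ᶠ n : ℕ in atTop, ∀ i,
      |((G n ω).degree i : ℝ) - expDeg (edgeProb (M n) (g n) (q n ω)) i| < n * (1 / (k + 1)) := by
    refine ae_all_iff.2 fun k => hdev _ Nat.one_div_pos_of_nat ?_
    have : 1 / ((k : ℝ) + 1) ≤ 1 := by
      rw [div_le_one (by positivity)]
      linarith [(Nat.cast_nonneg k : (0 : ℝ) ≤ k)]
    linarith
  have hm : 0 < ∫ x, x ∂μ := by
    have hi : Integrable (fun x : ℝ => x) μ :=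
      Integrable.of_mem_Icc a b measurable_id.aemeasurable hμ.ae_mem
    have : ∫ _, a ∂μ ≤ ∫ x, x ∂μ :=
      integral_mono_ae (integrable_const _) hi (hμ.ae_mem.mono fun x hx => hx.1)
    simp only [integral_const, probReal_univ, smul_eq_mul, one_mul] at this
    exact hμ.pos.trans_le this
  filter_upwards [hmom, hdev', hev _ measurableSet_Icc hμ.null,
    hev _ Measure.isClosed_support.measurableSet Measure.measure_compl_support]
    with ω h1 h2 h3 h4
  refine supportedConv_muHat hμ h3 h4 h1 fun ε hε => ?_
  refine eventually_abs_qHat_sub_lt hM (g := g)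
    (h3.mono fun n hn i => ⟨(hIcc (hn i)).1.le, (hIcc (hn i)).2.le⟩) hm (by simpa using h1 1)
    (fun ε hε => ?_) hε
  obtain ⟨k, hk⟩ := exists_nat_one_div_lt hε
  filter_upwards [h2 k] with n hn i
  have hk' : (n : ℝ) * (1 / (k + 1)) ≤ n * ε := by gcongr
  exact (hn i).trans_le hk'

theorem mainTheorem7 {Ω : Type*} [MeasurableSpace Ω] (P : Measure Ω) [IsProbabilityMeasure P]
    (μ : Measure ℝ) [IsProbabilityMeasure μ]
    (hμ : ∃ s : Set ℝ, IsCompact s ∧ s ⊆ Ioo 0 1 ∧ μ sᶜ = 0)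
    (K : ℕ) (c : Fin K → ℝ) (hc : ∀ k, 0 < c k)
    (M : ℕ → Matrix (Fin K) (Fin K) ℝ) (hM : ∃ B : ℝ, ∀ n a b, |M n a b| ≤ B)
    (g : ∀ n : ℕ, Fin n → Fin K)
    (hg : ∀ k, Tendsto (fun n : ℕ => ({i | g n i = k}.ncard : ℝ) / n) atTop (𝓝 (c k)))
    (q : ∀ n : ℕ, Ω → Fin n → ℝ) (G : ∀ n : ℕ, Ω → SimpleGraph (Fin n))
    (hG : ∀ᶠ n in atTop, IsDCSBM P μ (M n) (g n) (q n) (G n))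
    (A : Set ℝ) (hA : IsCompact A) (hA₀ : A.Nonempty) :
    (∀ α ∈ A, ThresholdWellDefined μ α) ∧
    (argminOn A (threshold μ)).Nonempty ∧
    ∀ᵐ ω ∂P,
      (∀ᶠ n in atTop, (∀ α ∈ A, ThresholdWellDefined (muHat (G n ω)) α) ∧
        (argminOn A (threshold (muHat (G n ω)))).Nonempty) ∧
      ∀ αHat : ℕ → ℝ,
        (∀ᶠ n in atTop, αHat n ∈ argminOn A (threshold (muHat (G n ω)))) →
          Tendsto (fun n => Metric.infDist (αHat n) (argminOn A (threshold μ))) atTop (𝓝 0) ∧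
          ∀ αOpt : ℝ, argminOn A (threshold μ) = {αOpt} → Tendsto αHat atTop (𝓝 αOpt) := by
  obtain ⟨s, hs, hs01, hs0⟩ := hμ
  obtain ⟨B, hB⟩ := hM
  have hsne : s.Nonempty := by
    by_contra h
    rw [not_nonempty_iff_eq_empty] at h
    simp [h] at hs0
  obtain ⟨a, ha, hamin⟩ := hs.exists_isLeast hsne
  obtain ⟨b, hb, hbmax⟩ := hs.exists_isGreatest hsne
  have hμ : CarriedBy μ a b := ⟨(hs01 ha).1, (hs01 hb).2,
    measure_mono_null (compl_subset_compl.2 fun x hx => ⟨hamin hx, hbmax hx⟩) hs0⟩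
  -- The slightly larger interval that eventually carries the estimated weights.
  have hμ' : CarriedBy μ (a / 2) ((1 + b) / 2) := by
    have h1 := hμ.pos
    have h2 := hμ.lt_one
    refine ⟨by positivity, by linarith, measure_mono_null (compl_subset_compl.2 ?_) hμ.null⟩
    exact Icc_subset_Icc (by linarith) (by linarith)
  refine ⟨fun α _ => hμ.thresholdWellDefined α, hμ.argminOn_nonempty hA hA₀, ?_⟩
  filter_upwards [ae_supportedConv_muHat hμ hB hG] with ω hω
  refine ⟨?_, fun αHat hα => ?_⟩
  · filter_upwards [hω.prob, hω.carried] with n hn hcn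
    exact ⟨fun α _ => hcn.thresholdWellDefined α, hcn.argminOn_nonempty hA hA₀⟩
  · have h := hω.tendsto_infDist_argminOn hμ' hA hα
    refine ⟨h, fun αOpt hOpt => ?_⟩
    rw [hOpt] at h
    simp only [Metric.infDist_singleton] at h
    exact tendsto_iff_dist_tendsto_zero.2 h
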